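/- Let $K$ be a nontrivial commutative semiring that is positive, i.e. $ab\neq 0$ whenever $a\neq 0\neq b$, and $a+b=0$ implies $a=b=0$. First-order formulas $\varphi$ over a finite relational vocabulary $\tau$ are built from $x=y$, $x\neq y$, $R(\bar x)$, $\neg R(\bar x)$ by $\wedge,\vee,\exists,\forall$. For a finite nonempty set $A$, a $K$-interpretation is a map $\pi$ from the set of literals $R(\bar a),\neg R(\bar a)$ ($R\in\tau$, $\bar a\in A^{\mathrm{ar}(R)}$) to $K$, and the value $[\![\varphi]\!]_{\pi,s}\in K$ under an assignment $s$ is defined by: $[\![x=y]\!]_{\pi,s}$ is $1$ if $s(x)=s(y)$ and $0$ otherwise, $[\![x\ne y]\!]_{\pi,s}$ is $1$ if $s(x)\neq s(y)$ and $0$ otherwise, $[\![R(\bar x)]\!]_{\pi,s}=\pi(R(s(\bar x)))$, $[\![\neg R(\bar x)]\!]_{\pi,s}=\pi(\neg R(s(\bar x)))$, $\wedge$ is interpreted by the product, $\vee$ by the sum, $[\![\exists x\varphi]\!]_{\pi,s}=\sum_{a\in A}[\![\varphi]\!]_{\pi,s(a/x)}$ and $[\![\forall x\varphi]\!]_{\pi,s}=\prod_{a\in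 A}[\![\varphi]\!]_{\pi,s(a/x)}$. A $K$-Turing machine is a one-tape Turing machine whose cells contain symbols of a finite alphabet $\Gamma$ (including a blank) or elements of $K$, and which has finitely many $K$-valued registers, initially $0$. If the scanned symbol is in $\Gamma$, the transition depends on the state and this symbol. If it is an element $a\in K$, the transition depends on the state and on whether $a$ equals the content of a register determined by the state. In one step the machine may write a symbol of $\Gamma$ or one of finitely many constants of $K$, or (if $a\in K$ is scanned) replace $a$ by $a+x$ or $a\cdot x$, where $x$ is the content of a register; it may load $a\in K$ into a set of registers; and it moves the head by at most one cell. It halts if no transition is defined or if a requested operation or load is impossible because the scanned symbol is in $\Gamma$. Its output is the string from the head up to the next blank. Time is the number of steps and space the number of visited cells. Inputs are encoded as follows. Let $A$ be a finite nonempty set of natural numbers, given by the increasing list of its elements in binary. Formulas are given as strings over a finite alphabet in bracketed prefix notation with indices of variables and relation symbols in binary. An assignment $s$ is given as a list of pairs $(x,s(x))$ in binary, in which every free variable of $\varphi$ occurs. A $K$-interpretation $\pi$ is given by its vocabulary (the list of its symbols, each with its arity in unary), followed by the values $\pi(\ell)\in K$ of all literals $\ell$, one per cell: symbol by symbol, first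 the facts and then the negated facts, each in lexicographic order, where each literal of a symbol of arity $0$ is repeated $|A|$ times. Write $|\varphi|$ for the length of the encoding of $\varphi$, $|A|$ for the cardinality of $A$, and $n$ for the sum of the encoding lengths of $\varphi$, $\pi$, $s$ and $A$. Then there are a $K$-Turing machine $M$, a constant $C$ and a polynomial $p$ (depending only on $K$) such that for every finite relational vocabulary $\tau$ and all $A$, $\varphi$, $\pi$, $s$ as above, $M$ started on the encoding of $(\varphi,\pi,s,A)$ halts with output $[\![\varphi]\!]_{\pi,s}$ after at most $C\cdot n^2\cdot|\varphi|\cdot|A|^{|\varphi|}$ steps, and it visits at most $p(n)$ cells. -/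

import Mathlib

namespace SemiringFO

universe u

/-! ### Positive semirings -/

/-- A semiring is positive if it has no divisors of `0` and `a + b = 0` only for `a = b = 0`. -/
structure IsPositiveSemiring (K : Type u) [Semiring K] : Prop where
  mul_ne_zero : ∀ a b : K, a ≠ 0 → b ≠ 0 → a * b ≠ 0
  eq_zero_of_add_eq_zero : ∀ a b : K, a + b = 0 → a = 0 ∧ b = 0

/-! ### Turing machines over a semiring -/

/-- The two arithmetic operations of a machine. -/
inductive ArithOp
  | add
  | mul

/-- The value of an arithmetic operation. -/
def ArithOp.apply {K : Type u} [Semiring K] : ArithOp → K → K → K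
  | .add, a, x => a + x
  | .mul, a, x => a * x

/-- The shift operations. Shifting the tape to the left is moving the head to the right. -/
inductive Shift
  | left
  | id
  | right

/-- The displacement of the head relative to the tape. -/
def Shift.move : Shift → ℤ
  | .left => 1
  | .id => 0
  | .right => -1

/-- What a transition writes: a tape symbol of the finite alphabet, a constant of `K`, nothing
(the symbol is kept), or the result of an operation with the scanned value and a register. -/
inductive Write (K : Type u) (Γ R : Type)
  | sym (g : Γ)
  | const (k : K)
  | keep
  | op (o : ArithOp) (r : R)

/-- A `K`-Turing machine over a semiring without order, so that the only branch predicate is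
equality and the branch predicate function only selects a register. A cell of the tape holds an
element of the disjoint union `Γ ⊕ K`. The second argument of the partial transition function `δ`
is a symbol of `Γ` or a truth value. -/
structure KTM (K : Type u) where
  Q : Type
  finite_Q : Finite Q
  q₀ : Q
  R : Type
  finite_R : Finite R
  P : Q → R
  Γ : Type
  finite_Γ : Finite Γ
  blank : Γ
  inputs : Set (Γ ⊕ K)
  blank_notMem : Sum.inl blank ∉ inputs
  δ : Q → Γ ⊕ Bool → Option (Q × Write K Γ R × Set R × Shift)

/-- A configuration: state, contents of the registers, contents of the tape, and head position.
Instead of shifting the tape, we move the head: the cell at `head` is the one that has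
coordinate `1` on the shifted tape. -/
structure KTM.Cfg {K : Type u} (M : KTM K) where
  state : M.Q
  reg : M.R → K
  tape : ℤ → M.Γ ⊕ K
  head : ℤ

open Classical in
/-- The argument of the transition function when the symbol `a` is scanned: `a` itself if
`a ∈ Γ`, and the truth value of the comparison of `a` with the selected register if `a ∈ K`. -/
noncomputable def KTM.scan {K : Type u} (M : KTM K) (c : M.Cfg) : M.Γ ⊕ Bool :=
  match c.tape c.head with
  | .inl g => .inl g
  | .inr a => .inr (decide (a = c.reg (M.P c.state)))

/-- The new contents of the scanned cell; `none` if the machine has to halt because the scanned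
symbol is not an element of `K` although an arithmetic operation is requested. -/
def KTM.written {K : Type u} [Semiring K] (M : KTM K) (c : M.Cfg) :
    Write K M.Γ M.R → Option (M.Γ ⊕ K)
  | .sym g => some (.inl g)
  | .const k => some (.inr k)
  | .keep => some (c.tape c.head)
  | .op o r =>
    match c.tape c.head with
    | .inl _ => none
    | .inr a => some (.inr (o.apply a (c.reg r)))

open Classical in
/-- The new contents of the registers when the registers in `s` are to be loaded with the scanned
symbol; `none` if the machine has to halt because this symbol is not an element of `K` and `s` is
not empty. -/
noncomputable def KTM.loaded {K : Type u} (M : KTM K) (c : M.Cfg) (s : Set M.R) :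
    Option (M.R → K) :=
  match c.tape c.head with
  | .inl _ => if s = ∅ then some c.reg else none
  | .inr a => some fun r => if r ∈ s then a else c.reg r

/-- One transition; `none` if the machine halts. -/
noncomputable def KTM.step {K : Type u} [Semiring K] (M : KTM K) (c : M.Cfg) : Option M.Cfg :=
  match M.δ c.state (M.scan c) with
  | none => none
  | some (q, z, s, d) =>
    (M.written c z).bind fun v => (M.loaded c s).map fun ρ =>
      ⟨q, ρ, Function.update c.tape c.head v, c.head + d.move⟩

/-- The initial configuration: the input word is in the cells `1, 2, …`, all other cells are
blank, and the registers are `0`. -/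
def KTM.init {K : Type u} [Semiring K] (M : KTM K) (w : List (M.Γ ⊕ K)) : M.Cfg where
  state := M.q₀
  reg := fun _ => 0
  tape := fun i => if 1 ≤ i then w.getD (i - 1).toNat (.inl M.blank) else .inl M.blank
  head := 1

/-- The configuration after `t` steps on input `w`; it no longer changes once the machine has
halted. -/
noncomputable def KTM.conf {K : Type u} [Semiring K] (M : KTM K) (w : List (M.Γ ⊕ K)) :
    ℕ → M.Cfg
  | 0 => M.init w
  | t + 1 => (M.step (M.conf w t)).getD (M.conf w t)

/-- `u` is the output read off from a configuration: the maximal blank-free string that starts at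
the head and extends to the right. -/
def KTM.IsOutput {K : Type u} (M : KTM K) (c : M.Cfg) (u : List (M.Γ ⊕ K)) : Prop :=
  (∀ i : ℕ, ∀ h : i < u.length, c.tape (c.head + i) = u[i]) ∧
  Sum.inl M.blank ∉ u ∧ c.tape (c.head + u.length) = .inl M.blank

/-- On the input `w`, which is a word over the input alphabet, the machine halts within `time`
steps after having visited at most `space` cells, and its output is `u`, a word over the input
alphabet. -/
def KTM.ComputesWithin {K : Type u} [Semiring K] (M : KTM K) (w u : List (M.Γ ⊕ K))
    (time space : ℕ) : Prop :=
  (∀ a ∈ w, a ∈ M.inputs) ∧ (∀ a ∈ u, a ∈ M.inputs) ∧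
  ∃ t ≤ time, M.step (M.conf w t) = none ∧
    ((Finset.range (t + 1)).image fun i => (M.conf w i).head).card ≤ space ∧
    M.IsOutput (M.conf w t) u

/-! ### First-order logic with semiring semantics -/

/-- A finite relational vocabulary: the list of the arities of its symbols. -/
abbrev Vocabulary := List ℕ

/-- The relation symbols of a vocabulary. -/
abbrev Vocabulary.Symbol (τ : Vocabulary) := Fin (List.length τ)

/-- The arity of a relation symbol. -/
def Vocabulary.ar (τ : Vocabulary) (R : τ.Symbol) : ℕ := List.get τ R

/-- First-order formulas in negation normal form. The variables are `x₀, x₁, …`, given by their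
indices. -/
inductive Formula (τ : Vocabulary)
  | eq (x y : ℕ)
  | neq (x y : ℕ)
  | rel (R : τ.Symbol) (x : Fin (τ.ar R) → ℕ)
  | nrel (R : τ.Symbol) (x : Fin (τ.ar R) → ℕ)
  | and (φ ψ : Formula τ)
  | or (φ ψ : Formula τ)
  | ex (x : ℕ) (φ : Formula τ)
  | all (x : ℕ) (φ : Formula τ)

/-- The free variables of a formula. -/
def Formula.freeVars {τ : Vocabulary} : Formula τ → Set ℕ
  | .eq x y => {x, y}
  | .neq x y => {x, y}
  | .rel _ x => Set.range x
  | .nrel _ x => Set.range x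
  | .and φ ψ => φ.freeVars ∪ ψ.freeVars
  | .or φ ψ => φ.freeVars ∪ ψ.freeVars
  | .ex x φ => φ.freeVars \ {x}
  | .all x φ => φ.freeVars \ {x}

/-- The literals `R(a₁, …, aₖ)` and `¬R(a₁, …, aₖ)` over a set `A`. -/
inductive Literal (τ : Vocabulary) (A : Type)
  | pos (R : τ.Symbol) (a : Fin (τ.ar R) → A)
  | neg (R : τ.Symbol) (a : Fin (τ.ar R) → A)

/-- The value of a formula under a `K`-interpretation and an assignment. -/
def Formula.eval {K : Type u} [CommSemiring K] {τ : Vocabulary} {A : Type} [Fintype A]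
    [DecidableEq A] (π : Literal τ A → K) : Formula τ → (ℕ → A) → K
  | .eq x y, s => if s x = s y then 1 else 0
  | .neq x y, s => if s x ≠ s y then 1 else 0
  | .rel R x, s => π (.pos R fun i => s (x i))
  | .nrel R x, s => π (.neg R fun i => s (x i))
  | .and φ ψ, s => φ.eval π s * ψ.eval π s
  | .or φ ψ, s => φ.eval π s + ψ.eval π s
  | .ex x φ, s => ∑ a : A, φ.eval π (Function.update s x a)
  | .all x φ, s => ∏ a : A, φ.eval π (Function.update s x a)

/-! ### Encodings -/

/-- The finite alphabet used in the encodings, besides the elements of the semiring. -/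
inductive Letter
  | zero
  | one
  | eq
  | neq
  | rel
  | nrel
  | and
  | or
  | ex
  | all
  | var
  | elem
  | close
  | sep

/-- Binary notation, least significant digit first; `0` is the empty string. -/
def encNat (n : ℕ) : List Letter := n.bits.map fun b => if b then .one else .zero

/-- A variable is written as a letter followed by its index in binary. -/
def encVar (x : ℕ) : List Letter := .var :: encNat x

/-- An element of the universe is written as a letter followed by its binary notation. -/
def encElem (a : ℕ) : List Letter := .elem :: encNat a

/-- Formulas are written in prefix notation with closing brackets and binary indices. -/
def encFormula {τ : Vocabulary} : Formula τ → List Letter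
  | .eq x y => .eq :: (encVar x ++ encVar y ++ [.close])
  | .neq x y => .neq :: (encVar x ++ encVar y ++ [.close])
  | .rel R x => .rel :: (encNat R ++ (List.ofFn x).flatMap encVar ++ [.close])
  | .nrel R x => .nrel :: (encNat R ++ (List.ofFn x).flatMap encVar ++ [.close])
  | .and φ ψ => .and :: (encFormula φ ++ encFormula ψ ++ [.close])
  | .or φ ψ => .or :: (encFormula φ ++ encFormula ψ ++ [.close])
  | .ex x φ => .ex :: (encVar x ++ encFormula φ ++ [.close])
  | .all x φ => .all :: (encVar x ++ encFormula φ ++ [.close])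

/-- The elements of a finite set of natural numbers in increasing order. -/
def elements (A : Finset ℕ) : List A := (Finset.univ : Finset A).sort

/-- A finite set is written as the increasing list of its elements. -/
def encSet (A : Finset ℕ) : List Letter := (elements A).flatMap fun a => encElem a

/-- An assignment is written as a list of pairs of a variable and its value, where the variables
run through the list `V`. -/
def encAssignment {A : Finset ℕ} (V : List ℕ) (s : ℕ → A) : List Letter :=
  V.flatMap fun x => encVar x ++ encElem (s x)

/-- All `k`-tuples over `A` in lexicographic order. -/
def tuples (A : Finset ℕ) : (k : ℕ) → List (Fin k → A)
  | 0 => [Fin.elim0]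
  | k + 1 => (elements A).flatMap fun a => (tuples A k).map fun v => Fin.cons a v

/-- The list of tuples for which the literals of a `k`-ary symbol are written down. The literals
of a symbol of arity `0` are repeated `|A|` times, as if the symbol had arity `1`. -/
def argTuples (A : Finset ℕ) : (k : ℕ) → List (Fin k → A)
  | 0 => List.replicate A.card Fin.elim0
  | k + 1 => tuples A (k + 1)

/-- The values of all literals: symbol by symbol, first the facts, then the negated facts, each
in the lexicographic order of the tuples. -/
def encValues {K : Type u} {τ : Vocabulary} {A : Finset ℕ} (π : Literal τ A → K) : List K :=
  (List.finRange (List.length τ)).flatMap fun R =>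
    (argTuples A (τ.ar R)).map (fun a => π (.pos R a)) ++
    (argTuples A (τ.ar R)).map (fun a => π (.neg R a))

/-- A vocabulary is written as the list of its symbols, each followed by as many marks as its
arity says. -/
def encVocabulary (τ : Vocabulary) : List Letter :=
  List.flatMap (fun k => Letter.rel :: List.replicate k .var) τ

/-- A `K`-interpretation is written as its vocabulary followed by the values of all literals. -/
def encInterpretation {K : Type u} {τ : Vocabulary} {A : Finset ℕ} (π : Literal τ A → K) :
    List (Letter ⊕ K) :=
  (encVocabulary τ).map Sum.inl ++ (encValues π).map Sum.inr

/-- The input word: formula, interpretation, assignment and set, separated by a letter. -/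
def encInput {K : Type u} {τ : Vocabulary} {A : Finset ℕ} (φ : Formula τ) (π : Literal τ A → K)
    (V : List ℕ) (s : ℕ → A) : List (Letter ⊕ K) :=
  (encFormula φ).map Sum.inl ++ Sum.inl .sep :: (encInterpretation π ++
    Sum.inl .sep :: ((encAssignment V s).map Sum.inl ++
    Sum.inl .sep :: (encSet A).map Sum.inl))

/-- The sum of the encoding lengths of formula, interpretation, assignment and set. -/
def inputSize {K : Type u} {τ : Vocabulary} {A : Finset ℕ} (φ : Formula τ) (π : Literal τ A → K)
    (V : List ℕ) (s : ℕ → A) : ℕ :=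
  (encFormula φ).length + (encInterpretation π).length + (encAssignment V s).length +
    (encSet A).length

end SemiringFO

/-!
The value of a formula is computed by the naive recursion along the formula. The content of the
theorem is that one machine with one tape can do this, uniformly in the vocabulary, within the
bounds for time and space, although it can use the elements of `K` only as black boxes.

*Programs.* `Code K α` is a piece of finite control whose exits are labelled by `α`. Codes are
composed by `Code.bind` and `Code.iter`, and `Code.Runs` is the corresponding notion of a bounded
run; `Code.Runs.computesWithin` turns a run into a computation of a `KTM`. The machine never
compares elements of `K`: it only distinguishes cells that hold letters from cells that hold
elements of `K`.

*Stacks.* The part of the tape on the left of the input carries finitely many stacks, the cells of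
which are interleaved (`pos`, `Rep`). If all heights are at most `H`, then one operation on the top
of a stack takes `O(H)` steps and the machine stays within `O(H)` cells. `Does n H c σ u a σ'`
says that `c` transforms the stacks `σ` into `σ'` with at most `u` such operations.

*Literals.* A variable is looked up in the current assignment, which is a stack of items, and its
value is replaced by its rank in the universe, in unary (`does_lookup`). The ranks of the arguments
of an atom are the digits of the number of the tuple in base `|A|` (`getElem?_tuples`), and the
values that precede the facts of the symbol are counted by means of the vocabulary
(`getElem?_encValues`, `does_fetch`). All these numbers are bounded by the length of the input, so
the value of an atom `φ` is found with `O(H * |φ|)` operations (`does_evalRel`).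

*Formulas.* The formula is held by two stacks with the current position between them, so that the
scope of a quantifier can be read again for every element of the universe. For a quantifier the
rank of the value of its variable is incremented after every round, and the value of the scope is
added to the sum, or multiplied with the product, which is kept on a stack of values
(`does_rounds`). By induction on `φ`, the evaluation takes
`O(H * |φ| * |A| ^ d)` operations, where `d` is the nesting depth of the quantifiers
(`does_evalLoop`).

*Bounds.* The stacks have heights at most `H = 20 * n * |A|`, where the factor `|A|` accounts for the
ranks in unary in the current assignment. As one operation takes `O(H)` steps, the number of
steps is `O(n ^ 2 * |A| ^ 2 * |φ| * |A| ^ d)`, and `d + 2 ≤ |φ|` (`quantDepth_add_two_le`, `steps_le`).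
-/

namespace SemiringFO

universe u

/-! ### Structured programs for a one-tape machine -/

/-- The finite tape alphabet: the letters of the input, the blank, a marker for the cell to which
every tape operation returns, and a marker for input cells that have been consumed. -/
inductive Cell
  | blank
  | home
  | used
  | letter (l : Letter)

instance : Finite Letter :=
  Finite.of_surjective (fun i : Fin 14 => [Letter.zero, .one, .eq, .neq, .rel, .nrel, .and, .or,
    .ex, .all, .var, .elem, .close, .sep][i])
    (by rintro ⟨⟩ <;> simp [Fin.exists_fin_succ])

/-- Registers, tape and head position of a machine over the alphabet `Cell` with two registers. -/
structure Mem (K : Type u) where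
  reg : Bool → K
  tape : ℤ → Cell ⊕ K
  head : ℤ

/-- The part of a transition that acts on the memory. -/
structure Act (K : Type u) where
  write : Write K Cell Bool
  load : Option Bool
  shift : Shift

/-- A piece of finite control that is left through exits labelled by `α`. The branch predicate of
the machine is never used, so the control sees only whether a cell holds a symbol of `Cell`
or some element of `K`, which is represented by `none`. -/
structure Code (K : Type u) (α : Type) where
  Q : Type
  finite_Q : Finite Q
  start : Q ⊕ α
  δ : Q → Option Cell → (Q ⊕ α) × Act K

variable {K : Type u} [CommSemiring K] {α β : Type}

/-- What the control sees in the scanned cell. -/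
def Mem.scan (m : Mem K) : Option Cell := (m.tape m.head).getLeft?

/-- The new content of the scanned cell. -/
def Mem.written (m : Mem K) : Write K Cell Bool → Option (Cell ⊕ K)
  | .sym g => some (.inl g)
  | .const k => some (.inr k)
  | .keep => some (m.tape m.head)
  | .op o r =>
    match m.tape m.head with
    | .inl _ => none
    | .inr x => some (.inr (o.apply x (m.reg r)))

/-- The new contents of the registers. -/
def Mem.loaded (m : Mem K) : Option Bool → Option (Bool → K)
  | none => some m.reg
  | some r =>
    match m.tape m.head with
    | .inl _ => none
    | .inr x => some (Function.update m.reg r x)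

/-- The effect of an action; `none` if it needs an element of `K` and a symbol is scanned. -/
def Mem.act (m : Mem K) (a : Act K) : Option (Mem K) :=
  (m.written a.write).bind fun v => (m.loaded a.load).map fun ρ =>
    ⟨ρ, Function.update m.tape m.head v, m.head + a.shift.move⟩

/-- `Steps c lo hi t x m y m'`: in `t` steps the code `c` gets from `x` and memory `m` to `y` and
`m'`, and whenever a step is made, the head is between `lo` and `hi`. -/
inductive Code.Steps (c : Code K α) (lo hi : ℤ) :
    ℕ → c.Q ⊕ α → Mem K → c.Q ⊕ α → Mem K → Prop
  | refl (x : c.Q ⊕ α) (m : Mem K) : Steps c lo hi 0 x m x m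
  | step {t : ℕ} {q : c.Q} {m m₁ m₂ : Mem K} {y : c.Q ⊕ α} (hlo : lo ≤ m.head) (hhi : m.head ≤ hi)
      (hact : m.act (c.δ q m.scan).2 = some m₁)
      (h : Steps c lo hi t (c.δ q m.scan).1 m₁ y m₂) : Steps c lo hi (t + 1) (.inl q) m y m₂

theorem Code.Steps.trans {c : Code K α} {lo hi : ℤ} {t s : ℕ} {x y z : c.Q ⊕ α} {m m₁ m₂ : Mem K}
    (h : c.Steps lo hi t x m y m₁) (h' : c.Steps lo hi s y m₁ z m₂) :
    c.Steps lo hi (t + s) x m z m₂ := by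
  induction h with
  | refl => simpa using h'
  | step hlo hhi hact _ ih => rw [Nat.add_right_comm]; exact .step hlo hhi hact (ih h')

/-- Runs are transported along maps of control states that commute with the transitions. -/
theorem Code.Steps.map {c : Code K α} {d : Code K β} (f : c.Q ⊕ α → d.Q ⊕ β) {lo hi : ℤ} {t : ℕ}
    (hf : ∀ q, ∃ q', f (.inl q) = .inl q' ∧ ∀ s, d.δ q' s = (f (c.δ q s).1, (c.δ q s).2))
    {x y : c.Q ⊕ α} {m m' : Mem K} (h : c.Steps lo hi t x m y m') :
    d.Steps lo hi t (f x) m (f y) m' := by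
  induction h with
  | refl => exact .refl _ _
  | @step t q m m₁ m₂ y hlo hhi hact h ih =>
    obtain ⟨q', hq, hδ⟩ := hf q
    rw [hq]
    refine .step hlo hhi (m₁ := m₁) ?_ ?_
    · rw [hδ]; exact hact
    · rw [hδ]; exact ih

/-- Started in memory `m`, the code `c` is left within `T` steps through the exit `a` with memory
`m'`, and until then the head is between `lo` and `hi`. -/
def Code.Runs (c : Code K α) (lo hi : ℤ) (T : ℕ) (m : Mem K) (a : α) (m' : Mem K) : Prop :=
  ∃ t ≤ T, c.Steps lo hi t c.start m (.inr a) m'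

theorem Code.Runs.mono {c : Code K α} {lo hi : ℤ} {T T' : ℕ} {m m' : Mem K} {a : α}
    (h : c.Runs lo hi T m a m') (hT : T ≤ T') : c.Runs lo hi T' m a m' :=
  let ⟨t, ht, h⟩ := h; ⟨t, ht.trans hT, h⟩

/-- The code that is left at once through the exit `a`. -/
def Code.pure (a : α) : Code K α where
  Q := Empty
  finite_Q := inferInstance
  start := .inr a
  δ := fun q _ => q.elim

theorem Code.runs_pure {lo hi : ℤ} (a : α) (m : Mem K) :
    (Code.pure a : Code K α).Runs lo hi 0 m a m :=
  ⟨0, le_rfl, .refl _ _⟩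

/-- A single step. -/
def Code.prim (f : Option Cell → α × Act K) : Code K α where
  Q := Unit
  finite_Q := inferInstance
  start := .inl ()
  δ := fun _ s => (.inr (f s).1, (f s).2)

theorem Code.runs_prim {lo hi : ℤ} {f : Option Cell → α × Act K} {m m' : Mem K} {a : α}
    (hlo : lo ≤ m.head) (hhi : m.head ≤ hi) (ha : (f m.scan).1 = a)
    (h : m.act (f m.scan).2 = some m') :
    (Code.prim f : Code K α).Runs lo hi 1 m a m' :=
  ⟨1, le_rfl, .step hlo hhi h (by rw [← ha]; exact .refl _ _)⟩

/-- Sequential composition; the exit of the first code selects the second one. -/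
def Code.bind [Finite α] (c : Code K α) (f : α → Code K β) : Code K β :=
  let enter (a : α) : (c.Q ⊕ Σ a, (f a).Q) ⊕ β := Sum.map (fun q => .inr ⟨a, q⟩) id (f a).start
  { Q := c.Q ⊕ Σ a, (f a).Q
    finite_Q := by
      have := c.finite_Q
      have := fun a => (f a).finite_Q
      infer_instance
    start := Sum.elim (fun q => .inl (.inl q)) enter c.start
    δ := fun q s => match q with
      | .inl q => (Sum.elim (fun q => .inl (.inl q)) enter (c.δ q s).1, (c.δ q s).2)
      | .inr ⟨a, q⟩ => (Sum.map (fun q => .inr ⟨a, q⟩) id ((f a).δ q s).1, ((f a).δ q s).2) }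

theorem Code.Runs.bind [Finite α] {c : Code K α} {f : α → Code K β} {lo hi : ℤ} {T T' : ℕ}
    {m m₁ m₂ : Mem K} {a : α} {b : β} (h : c.Runs lo hi T m a m₁)
    (h' : (f a).Runs lo hi T' m₁ b m₂) : (c.bind f).Runs lo hi (T + T') m b m₂ := by
  obtain ⟨t, ht, h⟩ := h
  obtain ⟨t', ht', h'⟩ := h'
  refine ⟨t + t', add_le_add ht ht', ?_⟩
  have h1 := h.map (d := c.bind f) (Sum.elim (fun q => .inl (.inl q))
    fun a => Sum.map (fun q => .inr ⟨a, q⟩) id (f a).start) fun q => ⟨.inl q, rfl, fun s => rfl⟩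
  have h2 := h'.map (d := c.bind f) (Sum.map (fun q => .inr ⟨a, q⟩) id)
    fun q => ⟨.inr ⟨a, q⟩, rfl, fun s => rfl⟩
  exact h1.trans h2

/-- The step that changes nothing. -/
def Act.nop : Act K := ⟨.keep, none, .id⟩

theorem Mem.act_nop (m : Mem K) : m.act Act.nop = some m := by
  simp [Mem.act, Act.nop, Shift.move, Mem.written, Mem.loaded]

/-- Iteration: `f a` either demands another round with a new parameter or yields the exit. Each
round starts with an idle step, so that a round may consist of no step of its own. -/
def Code.iter [Finite α] (f : α → Code K (α ⊕ β)) (a : α) : Code K β :=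
  let enter (a : α) : (f a).Q ⊕ (α ⊕ β) → (α ⊕ Σ a, (f a).Q) ⊕ β :=
    Sum.elim (fun q => .inl (.inr ⟨a, q⟩)) (Sum.map .inl id)
  { Q := α ⊕ Σ a, (f a).Q
    finite_Q := by
      have := fun a => (f a).finite_Q
      infer_instance
    start := .inl (.inl a)
    δ := fun q s => match q with
      | .inl a => (enter a (f a).start, Act.nop)
      | .inr ⟨a, q⟩ => (enter a ((f a).δ q s).1, ((f a).δ q s).2) }

theorem Code.iter_round [Finite α] {f : α → Code K (α ⊕ β)} {lo hi : ℤ} {T : ℕ}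
    {m m₁ : Mem K} {a : α} {r : α ⊕ β} (hlo : lo ≤ m.head) (hhi : m.head ≤ hi)
    (h : (f a).Runs lo hi T m r m₁) :
    ∃ t ≤ T + 1, (Code.iter f a).Steps lo hi t (.inl (.inl a)) m (Sum.map .inl id r) m₁ := by
  obtain ⟨t, ht, h⟩ := h
  have h1 := h.map (d := Code.iter f a) (Sum.elim (fun q => .inl (.inr ⟨a, q⟩)) (Sum.map .inl id))
    fun q => ⟨.inr ⟨a, q⟩, rfl, fun s => rfl⟩
  exact ⟨t + 1, by omega, .step hlo hhi (m₁ := m) (Mem.act_nop m) h1⟩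

theorem Code.Runs.iter_done [Finite α] {f : α → Code K (α ⊕ β)} {lo hi : ℤ} {T : ℕ}
    {m m₁ : Mem K} {a : α} {b : β} (hlo : lo ≤ m.head) (hhi : m.head ≤ hi)
    (h : (f a).Runs lo hi T m (.inr b) m₁) : (Code.iter f a).Runs lo hi (T + 1) m b m₁ :=
  Code.iter_round hlo hhi h

theorem Code.Runs.iter_next [Finite α] {f : α → Code K (α ⊕ β)} {lo hi : ℤ} {T T' : ℕ}
    {m m₁ m₂ : Mem K} {a a' : α} {b : β} (hlo : lo ≤ m.head) (hhi : m.head ≤ hi)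
    (h : (f a).Runs lo hi T m (.inl a') m₁) (h' : (Code.iter f a').Runs lo hi T' m₁ b m₂) :
    (Code.iter f a).Runs lo hi (T + 1 + T') m b m₂ := by
  obtain ⟨t, ht, h⟩ := Code.iter_round hlo hhi h
  obtain ⟨t', ht', h'⟩ := h'
  refine ⟨t + t', by omega, h.trans ?_⟩
  exact h'.map (c := Code.iter f a') (d := Code.iter f a) id fun q => ⟨q, rfl, fun s => rfl⟩

/-! ### Programs as machines over a semiring -/

/-- The machine that runs a code and halts when the code is left. -/
def Code.toKTM (c : Code K Unit) : KTM K where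
  Q := c.Q ⊕ Unit
  finite_Q := by have := c.finite_Q; infer_instance
  q₀ := c.start
  R := Bool
  finite_R := inferInstance
  P := fun _ => false
  Γ := Cell
  finite_Γ := by
    refine Finite.of_surjective
      (fun x : Option (Option (Option Letter)) => match x with
        | none => Cell.blank
        | some none => .home
        | some (some none) => .used
        | some (some (some l)) => .letter l) ?_
    rintro (_ | _ | _ | l)
    exacts [⟨none, rfl⟩, ⟨some none, rfl⟩, ⟨some (some none), rfl⟩, ⟨some (some (some l)), rfl⟩]
  blank := .blank
  inputs := {x | x ≠ .inl .blank}
  blank_notMem := by simp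
  δ := fun q x => match q with
    | .inl q =>
      let r := c.δ q x.getLeft?
      some (r.1, r.2.write, {i | r.2.load = some i}, r.2.shift)
    | .inr _ => none

/-- The configuration of the machine that corresponds to a control state and a memory. -/
def Code.cfg (c : Code K Unit) (x : c.Q ⊕ Unit) (m : Mem K) : c.toKTM.Cfg :=
  ⟨x, m.reg, m.tape, m.head⟩

theorem Code.step_cfg (c : Code K Unit) (q : c.Q) {m m' : Mem K}
    (h : m.act (c.δ q m.scan).2 = some m') :
    c.toKTM.step (c.cfg (.inl q) m) = some (c.cfg (c.δ q m.scan).1 m') := by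
  have hs : (c.toKTM.scan (c.cfg (.inl q) m)).getLeft? = m.scan := by
    unfold KTM.scan Mem.scan
    simp only [Code.cfg]
    cases m.tape m.head <;> rfl
  have hδ : c.toKTM.δ (c.cfg (.inl q) m).state (c.toKTM.scan (c.cfg (.inl q) m)) =
      some ((c.δ q m.scan).1, (c.δ q m.scan).2.write,
        {i | (c.δ q m.scan).2.load = some i}, (c.δ q m.scan).2.shift) := by
    rw [← hs]; rfl
  unfold KTM.step
  rw [hδ]
  clear hs hδ
  revert h
  generalize c.δ q m.scan = r
  obtain ⟨x, a⟩ := r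
  intro h
  have hw : c.toKTM.written (c.cfg (.inl q) m) a.write = m.written a.write := by
    cases a.write
    case op =>
      simp only [KTM.written, Mem.written, Code.cfg]
      cases m.tape m.head <;> rfl
    all_goals rfl
  have hl : ∀ ρ, m.loaded a.load = some ρ →
      c.toKTM.loaded (c.cfg (.inl q) m) {i | a.load = some i} = some ρ := by
    intro ρ
    unfold KTM.loaded Mem.loaded
    simp only [Code.cfg]
    cases a.load with
    | none =>
      cases m.tape m.head with
      | inl g => simp only [reduceCtorEq, Set.ofPred_false, if_true]; exact id
      | inr y => simp only [reduceCtorEq, Set.ofPred_false, Set.mem_empty_iff_false, if_false]; exact id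
    | some r =>
      cases m.tape m.head with
      | inl g => simp
      | inr y =>
        intro hρ
        rw [← Option.some.inj hρ]
        refine congrArg some (funext fun i => ?_)
        by_cases hi : i = r
        · subst hi
          exact (if_pos rfl).trans (Function.update_self (β := fun _ : Bool => K) i y m.reg).symm
        · exact (if_neg fun h => hi (Option.some.inj h).symm).trans
            (Function.update_of_ne (β := fun _ : Bool => K) hi y m.reg).symm
  unfold Mem.act at h
  cases hv : m.written a.write with
  | none => simp [hv] at h
  | some v =>
    cases hρ : m.loaded a.load with
    | none => simp [hv, hρ] at h
    | some ρ =>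
      simp only [hv, hρ, Option.bind_some, Option.map_some, Option.some.injEq] at h
      simp only [hw, hv, ← h]
      change Option.map _ (c.toKTM.loaded (c.cfg (Sum.inl q) m) {i | a.load = some i}) = _
      rw [hl ρ hρ]
      rfl

theorem Code.conf_of_steps {c : Code K Unit} {lo hi : ℤ} {w : List (Cell ⊕ K)} {t : ℕ}
    {x y : c.Q ⊕ Unit} {m m' : Mem K} (h : c.Steps lo hi t x m y m') :
    ∀ s, c.toKTM.conf w s = c.cfg x m →
      c.toKTM.conf w (s + t) = c.cfg y m' ∧
      ∀ i < t, lo ≤ (c.toKTM.conf w (s + i)).head ∧ (c.toKTM.conf w (s + i)).head ≤ hi := by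
  induction h with
  | refl => intro s hs; exact ⟨hs, by simp⟩
  | @step t q m m₁ m₂ y hlo hhi hact h ih =>
    intro s hs
    have h1 : c.toKTM.conf w (s + 1) = c.cfg (c.δ q m.scan).1 m₁ := by
      change (c.toKTM.step (c.toKTM.conf w s)).getD (c.toKTM.conf w s) = _
      rw [hs, c.step_cfg q hact]; rfl
    obtain ⟨h2, h3⟩ := ih (s + 1) h1
    refine ⟨by rw [← h2]; congr 1; omega, fun i hi' => ?_⟩
    rcases i with _ | i
    · rw [Nat.add_zero, hs]; exact ⟨hlo, hhi⟩
    · have := h3 i (by omega)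
      rwa [Nat.add_assoc, Nat.add_comm 1 i] at this

/-- A run of a code from the initial memory to an exit is a computation of the machine. -/
theorem Code.Runs.computesWithin {c : Code K Unit} {w v : List (Cell ⊕ K)} {T S : ℕ} {lo hi : ℤ}
    {m' : Mem K}
    (h : c.Runs lo hi T ⟨(c.toKTM.init w).reg, (c.toKTM.init w).tape, 1⟩ () m')
    (hlo : lo ≤ m'.head) (hhi : m'.head ≤ hi) (hS : (hi - lo + 1).toNat ≤ S)
    (hw : ∀ a ∈ w, a ≠ .inl .blank) (hv : ∀ a ∈ v, a ≠ .inl .blank)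
    (hval : ∀ i : ℕ, ∀ h : i < v.length, m'.tape (m'.head + i) = v[i])
    (hend : m'.tape (m'.head + v.length) = .inl .blank) :
    c.toKTM.ComputesWithin w v T S := by
  obtain ⟨t, ht, h⟩ := h
  obtain ⟨h1, h2⟩ := Code.conf_of_steps (w := w) h 0 rfl
  simp only [Nat.zero_add] at h1 h2
  refine ⟨hw, hv, t, ht, ?_, ?_, ?_⟩
  · rw [h1]; rfl
  · have hsub : ((Finset.range (t + 1)).image fun i => (c.toKTM.conf w i).head) ⊆
        Finset.Icc lo hi := by
      intro z hz
      obtain ⟨i, hi, rfl⟩ := Finset.mem_image.1 hz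
      rw [Finset.mem_Icc]
      rcases Nat.lt_succ_iff_lt_or_eq.1 (Finset.mem_range.1 hi) with hi | rfl
      · exact h2 i hi
      · rw [h1]; exact ⟨hlo, hhi⟩
    have := Finset.card_le_card hsub
    rw [Int.card_Icc] at this
    omega
  · rw [h1]
    exact ⟨hval, fun hb => hv _ hb rfl, hend⟩

end SemiringFO

namespace SemiringFO

universe u

variable {K : Type u}

/-! ### Stacks on the tape -/

/-- The names of the stacks. The name `inp` stands for the unread part of the input. The formula is
on `fR` from the current position on, and in reverse order on `fL` before it. The connectives whose
scope is open are on `cs`, the values of subformulas on `vs`, and the current assignment on `env`.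
The universe is on `set`, its cardinality in unary on `card`, and vocabulary and values of the
interpretation are on `voc` and `val`; each of these has a companion `…L` that takes the symbols
while the stack is searched. A word to be searched for is on `key` and the result of a lookup on
`res`. The stacks `idx`, `cnt` and `siz` hold unary numbers: the number of a tuple, the number of a
symbol, and the number of the facts of a symbol. -/
inductive Stk
  | inp | fL | fR | cs | vs | env | envL | key | keyL | res | set | setL | card | cardL
  | voc | vocL | val | valL | idx | cnt | siz | tmp
  deriving DecidableEq

/-- The symbols on the stacks. -/
abbrev Sym (K : Type u) := Letter ⊕ K

/-- The contents of all stacks; the head of a list is the top of the stack. -/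
abbrev State (K : Type u) := Stk → List (Sym K)

/-- The content of a tape cell that holds a stack symbol, or none. -/
def cellOf : Option (Sym K) → Cell ⊕ K
  | none => .inl .blank
  | some (.inl l) => .inl (.letter l)
  | some (.inr a) => .inr a

/-- The cell of the symbol at height `j` of a stack: the stacks are interleaved on the cells left
of the cell `0`. -/
def pos (i : Stk) (j : ℕ) : ℤ := -((1 + i.ctorIdx + 22 * j : ℕ) : ℤ)

theorem Stk.ctorIdx_lt (i : Stk) : i.ctorIdx < 22 := by cases i <;> decide

theorem Stk.ctorIdx_inj {i j : Stk} (h : i.ctorIdx = j.ctorIdx) : i = j := by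
  cases i <;> cases j <;> first | rfl | (revert h; decide)

theorem pos_inj {i i' : Stk} {j j' : ℕ} (h : pos i j = pos i' j') : i = i' ∧ j = j' := by
  have h1 := i.ctorIdx_lt
  have h2 := i'.ctorIdx_lt
  unfold pos at h
  exact ⟨Stk.ctorIdx_inj (by omega), by omega⟩

theorem Stk.exists_ctorIdx {r : ℕ} (hr : r < 22) : ∃ i : Stk, i.ctorIdx = r := by
  interval_cases r
  exacts [⟨.inp, rfl⟩, ⟨.fL, rfl⟩, ⟨.fR, rfl⟩, ⟨.cs, rfl⟩, ⟨.vs, rfl⟩, ⟨.env, rfl⟩, ⟨.envL, rfl⟩,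
    ⟨.key, rfl⟩, ⟨.keyL, rfl⟩, ⟨.res, rfl⟩, ⟨.set, rfl⟩, ⟨.setL, rfl⟩, ⟨.card, rfl⟩, ⟨.cardL, rfl⟩,
    ⟨.voc, rfl⟩, ⟨.vocL, rfl⟩, ⟨.val, rfl⟩, ⟨.valL, rfl⟩, ⟨.idx, rfl⟩, ⟨.cnt, rfl⟩, ⟨.siz, rfl⟩,
    ⟨.tmp, rfl⟩]

theorem exists_pos {z : ℤ} (hz : z < 0) : ∃ i j, pos i j = z := by
  obtain ⟨i, hi⟩ := Stk.exists_ctorIdx (Nat.mod_lt (-z - 1).toNat (by omega : 22 > 0))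
  exact ⟨i, (-z - 1).toNat / 22, by unfold pos; omega⟩

theorem pos_bounds {i : Stk} {j H : ℕ} (hj : j ≤ H) : -(22 * (H + 2) : ℤ) ≤ pos i j ∧ pos i j < 0 := by
  have h1 := i.ctorIdx_lt
  unfold pos
  omega

/-- The memory represents the given stacks of height at most `H`, where `n` is the length of the
input. The head is on the marked cell `0`. -/
structure Rep (n H : ℕ) (σ : State K) (m : Mem K) : Prop where
  head : m.head = 0
  home : m.tape 0 = .inl .home
  stack : ∀ i ≠ .inp, ∀ j : ℕ, m.tape (pos i j) = cellOf (σ i).reverse[j]?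
  spare : ∀ j : ℕ, m.tape (pos .inp j) = .inl .blank
  height : ∀ i ≠ .inp, (σ i).length ≤ H
  input : (σ .inp).length ≤ n
  used : ∀ j : ℕ, j + (σ .inp).length < n → m.tape (1 + j) = .inl .used
  rest : ∀ j : ℕ, m.tape (1 + (n - (σ .inp).length) + j) = cellOf (σ .inp)[j]?

theorem cellOf_ne_home (x : Option (Sym K)) : cellOf x ≠ .inl .home := by
  rcases x with _ | _ | _ <;> simp [cellOf]

/-- What the control sees in the cell that holds a stack symbol, or none. -/
def scanOf : Option (Sym K) → Option Cell
  | none => some .blank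
  | some (.inl l) => some (.letter l)
  | some (.inr _) => none

theorem scan_cellOf {m : Mem K} {x : Option (Sym K)} (h : m.tape m.head = cellOf x) :
    m.scan = scanOf x := by
  rcases x with _ | _ | _ <;> simp [Mem.scan, h, cellOf, scanOf]

variable [CommSemiring K]

/-- Moving the head by several cells. -/
def moveBy (d : Shift) : ℕ → Code K Unit
  | 0 => .pure ()
  | p + 1 => (Code.prim fun _ => ((), ⟨.keep, none, d⟩)).bind fun _ => moveBy d p

theorem Mem.act_keep (m : Mem K) (d : Shift) :
    m.act ⟨.keep, none, d⟩ = some ⟨m.reg, m.tape, m.head + d.move⟩ := by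
  simp [Mem.act, Mem.written, Mem.loaded]

theorem runs_moveBy {lo hi : ℤ} (d : Shift) (p : ℕ) {m : Mem K} (h1 : lo ≤ m.head)
    (h2 : m.head ≤ hi) (h3 : lo ≤ m.head + p * d.move) (h4 : m.head + p * d.move ≤ hi) :
    (moveBy d p : Code K Unit).Runs lo hi p m () ⟨m.reg, m.tape, m.head + p * d.move⟩ := by
  induction p generalizing m with
  | zero =>
    simp only [Nat.cast_zero, zero_mul, add_zero]
    exact Code.runs_pure () m
  | succ p ih =>
    have e : m.head + d.move + p * d.move = m.head + (p + 1 : ℕ) * d.move := by push_cast; ring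
    have h5 : lo ≤ m.head + d.move ∧ m.head + d.move ≤ hi := by
      cases d <;> simp only [Shift.move] at * <;> push_cast at * <;> omega
    have := ih (m := ⟨m.reg, m.tape, m.head + d.move⟩) h5.1 h5.2 (by rw [e]; exact h3)
      (by rw [e]; exact h4)
    simp only [e] at this
    exact ((Code.runs_prim h1 h2 rfl (m.act_keep d)).bind this).mono (by omega)

/-- Returning to the marked cell. -/
def goHome (d : Shift) : Code K Unit :=
  Code.iter (fun _ : Unit => .prim fun s => match s with
    | some .home => (.inr (), Act.nop)
    | _ => (.inl (), ⟨.keep, none, d⟩)) ()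

/-- A run of `goHome` from a cell at distance `p`, if no cell in between carries the mark. -/
theorem runs_goHome {lo hi : ℤ} (d : Shift) (p : ℕ) {m : Mem K} (hd : m.head = -(p * d.move))
    (h1 : lo ≤ m.head) (h2 : m.head ≤ hi) (h0 : lo ≤ 0) (h0' : 0 ≤ hi)
    (hhome : m.tape 0 = .inl .home)
    (hne : ∀ i : ℕ, 0 < i → i ≤ p → m.tape (-(i * d.move)) ≠ .inl .home) :
    (goHome d : Code K Unit).Runs lo hi (2 * p + 2) m () ⟨m.reg, m.tape, 0⟩ := by
  induction p generalizing m with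
  | zero =>
    have h : m.head = 0 := by simpa using hd
    have hs : m.scan = some .home := by simp [Mem.scan, h, hhome]
    have hm : m = ⟨m.reg, m.tape, 0⟩ := by rw [← h]
    rw [← hm]
    exact (Code.Runs.iter_done h1 h2
      (Code.runs_prim h1 h2 (by rw [hs]) (by rw [hs]; exact m.act_nop))).mono (by omega)
  | succ p ih =>
    have hs : m.scan ≠ some .home := by
      have := hne (p + 1) (by omega) le_rfl
      rw [← hd] at this
      unfold Mem.scan
      revert this
      cases m.tape m.head <;> simp
    have e : m.head + d.move = -(p * d.move) := by rw [hd]; push_cast; ring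
    have h5 : lo ≤ m.head + d.move ∧ m.head + d.move ≤ hi := by
      cases d <;> simp only [Shift.move] at * <;> push_cast at * <;> omega
    have := ih (m := ⟨m.reg, m.tape, m.head + d.move⟩) e h5.1 h5.2 hhome
      fun i hi hip => hne i hi (by omega)
    refine (Code.Runs.iter_next h1 h2 (a' := ()) (m₁ := ⟨m.reg, m.tape, m.head + d.move⟩)
      (Code.runs_prim h1 h2 ?_ ?_) this).mono (by omega)
    · revert hs; rcases m.scan with _ | _ | _ | _ | _ <;> simp
    · rw [← m.act_keep d]
      revert hs; rcases m.scan with _ | _ | _ | _ | _ <;> simp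

/-- Walking to the first free cell of a stack. The exit tells whether the stack is empty. -/
def walk (i : Stk) : Code K Bool :=
  (moveBy .right (1 + i.ctorIdx)).bind fun _ =>
    Code.iter (fun first : Bool => (Code.prim fun s => match s with
      | some .blank => (true, Act.nop)
      | _ => (false, Act.nop)).bind fun b =>
        if b then .pure (.inr first) else (moveBy .right 22).bind fun _ => .pure (.inl false)) true

variable {n H : ℕ} {σ : State K} {m : Mem K}

/-- The leftmost cell that is visited. -/
def low (H : ℕ) : ℤ := -(22 * (H + 2) : ℤ)

theorem runs_walk (hm : Rep n H σ m) {i : Stk} (hi : i ≠ .inp) :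
    (walk i : Code K Bool).Runs (low H) (n + 1) (24 * (H + 2)) m (decide (σ i = []))
      ⟨m.reg, m.tape, pos i (σ i).length⟩ := by
  have hH := hm.height i hi
  have key : ∀ r, r ≤ (σ i).length → ∀ f : Bool,
      (Code.iter (fun first : Bool => (Code.prim fun s => match s with
        | some .blank => (true, Act.nop)
        | _ => (false, Act.nop)).bind fun b =>
          if b then .pure (.inr first) else (moveBy .right 22).bind fun _ => .pure (.inl false)) f
            : Code K Bool).Runs (low H) (n + 1) (24 * (r + 1))
        ⟨m.reg, m.tape, pos i ((σ i).length - r)⟩ (f && decide (r = 0))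
        ⟨m.reg, m.tape, pos i (σ i).length⟩ := by
    intro r
    induction r with
    | zero =>
      intro _ f
      obtain ⟨h1, h2⟩ := pos_bounds (i := i) hH
      have h2' : pos i (σ i).length ≤ (n + 1 : ℤ) := by omega
      have hs := scan_cellOf (m := ⟨m.reg, m.tape, pos i (σ i).length⟩) (hm.stack i hi _)
      rw [List.getElem?_eq_none (by simp)] at hs
      simp only [Nat.sub_zero, decide_true, Bool.and_true]
      refine Code.Runs.mono (Code.Runs.iter_done h1 h2' (Code.Runs.bind
        (Code.runs_prim (a := true) (m' := ⟨m.reg, m.tape, pos i (σ i).length⟩)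
          h1 h2' ?_ ?_) (Code.runs_pure _ _))) (by omega)
      · rw [hs]; rfl
      · rw [hs]; exact Mem.act_nop _
    | succ r ih =>
      intro hr f
      obtain ⟨h1, h2⟩ := pos_bounds (i := i) (j := (σ i).length - (r + 1)) (H := H) (by omega)
      obtain ⟨h3, h4⟩ := pos_bounds (i := i) (j := (σ i).length - r) (H := H) (by omega)
      have h2' : pos i ((σ i).length - (r + 1)) ≤ (n + 1 : ℤ) := by omega
      have hs := scan_cellOf (m := ⟨m.reg, m.tape, pos i ((σ i).length - (r + 1))⟩) (hm.stack i hi _)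
      obtain ⟨x, hx⟩ : ∃ x, (σ i).reverse[(σ i).length - (r + 1)]? = some x :=
        ⟨_, List.getElem?_eq_getElem (by rw [List.length_reverse]; omega)⟩
      rw [hx] at hs
      have e : pos i ((σ i).length - (r + 1)) + (22 : ℕ) * Shift.right.move =
          pos i ((σ i).length - r) := by
        unfold pos Shift.move; push_cast; omega
      have mv := runs_moveBy (lo := low H) (hi := n + 1) .right 22
        (m := ⟨m.reg, m.tape, pos i ((σ i).length - (r + 1))⟩) h1 h2'
        (by rw [e]; exact h3) (by rw [e]; omega)
      rw [e] at mv
      have := ih (by omega) false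
      simp only [Bool.false_and] at this
      simp only [Nat.add_eq_zero_iff, one_ne_zero, and_false, decide_false, Bool.and_false]
      refine Code.Runs.mono (Code.Runs.iter_next h1 h2' (Code.Runs.bind
        (Code.runs_prim (a := false) (m' := ⟨m.reg, m.tape, pos i ((σ i).length - (r + 1))⟩)
          h1 h2' ?_ ?_) (Code.Runs.bind mv (Code.runs_pure _ _))) this)
          (by omega)
      · rw [hs]
        rcases x with _ | _ <;> rfl
      · rw [← Mem.act_nop]; congr 1; split <;> rfl
  have h1 := i.ctorIdx_lt
  have e : (0 : ℤ) + (1 + i.ctorIdx : ℕ) * Shift.right.move = pos i 0 := by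
    unfold pos Shift.move; push_cast; omega
  obtain ⟨h3, h4⟩ := pos_bounds (i := i) (j := 0) (H := H) (by omega)
  have mv := runs_moveBy (lo := low H) (hi := n + 1) .right (1 + i.ctorIdx) (m := m)
    (by rw [hm.head]; unfold low; omega) (by rw [hm.head]; omega)
    (by rw [hm.head, e]; exact h3) (by rw [hm.head, e]; omega)
  rw [hm.head, e] at mv
  have := key _ le_rfl true
  rw [Nat.sub_self, Bool.true_and] at this
  have e2 : decide ((σ i).length = 0) = decide (σ i = []) := by simp
  rw [e2] at this
  exact (mv.bind this).mono (by omega)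

/-- Going back to the marked cell from the cells of a stack. -/
theorem runs_goHome_stack {m : Mem K} {i : Stk} {j : ℕ} (hj : j ≤ H) (hd : m.head = pos i j)
    (hhome : m.tape 0 = .inl .home) (hne : ∀ z < 0, m.tape z ≠ .inl .home) :
    (goHome .left : Code K Unit).Runs (low H) (n + 1) (44 * (H + 2)) m () ⟨m.reg, m.tape, 0⟩ := by
  obtain ⟨h1, h2⟩ := pos_bounds (i := i) hj
  have h3 := i.ctorIdx_lt
  refine (runs_goHome .left (1 + i.ctorIdx + 22 * j) ?_ (by rw [hd]; exact h1) (by omega)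
    (by unfold low; omega) (by omega) hhome fun p hp _ => hne _ ?_).mono (by omega)
  · rw [hd]; unfold pos Shift.move; push_cast; ring
  · simp only [Shift.move]; omega

omit [CommSemiring K] in
theorem Rep.ne_home (hm : Rep n H σ m) {z : ℤ} (hz : z < 0) : m.tape z ≠ .inl .home := by
  obtain ⟨i, j, rfl⟩ := exists_pos hz
  by_cases hi : i = .inp
  · subst hi; simp [hm.spare]
  · rw [hm.stack i hi]; exact cellOf_ne_home _

/-- Pushing the symbol that is written by `emit`. -/
def pushWith (i : Stk) (emit : Code K Unit) : Code K Unit :=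
  (walk i).bind fun _ => emit.bind fun _ => goHome .left

omit [CommSemiring K] in
/-- Changing one end of a stack preserves the representation. -/
theorem Rep.update_stack (hm : Rep n H σ m) {i : Stk} (hi : i ≠ .inp) {l : List (Sym K)} {j : ℕ}
    {x : Option (Sym K)} (hl : ∀ p, l.reverse[p]? = if p = j then x else (σ i).reverse[p]?)
    (hH : l.length ≤ H) (ρ : Bool → K) :
    Rep n H (Function.update σ i l) ⟨ρ, Function.update m.tape (pos i j) (cellOf x), 0⟩ := by
  have hpos : ∀ z : ℤ, 0 ≤ z → Function.update m.tape (pos i j) (cellOf x) z = m.tape z := by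
    intro z hz
    refine Function.update_of_ne ?_ _ _
    unfold pos
    omega
  have hinp : Function.update σ i l .inp = σ .inp := Function.update_of_ne hi.symm _ _
  refine ⟨rfl, ?_, ?_, ?_, ?_, ?_, ?_, ?_⟩
  · simp only; rw [hpos _ le_rfl]; exact hm.home
  · intro i' hi' p
    simp only
    by_cases h : i' = i
    · subst h
      rw [Function.update_self, hl]
      by_cases hp : p = j
      · subst hp; simp
      · rw [Function.update_of_ne (fun e => hp (pos_inj e).2), if_neg hp, hm.stack _ hi]
    · rw [Function.update_of_ne h, Function.update_of_ne (fun e => h (pos_inj e).1), hm.stack _ hi']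
  · intro p
    simp only
    rw [Function.update_of_ne (fun e => hi (pos_inj e).1.symm)]
    exact hm.spare p
  · intro i' hi'
    by_cases h : i' = i
    · subst h; rwa [Function.update_self]
    · rw [Function.update_of_ne h]; exact hm.height _ hi'
  · rw [hinp]; exact hm.input
  · intro p hp
    rw [hinp] at hp
    simp only; rw [hpos _ (by omega)]; exact hm.used p hp
  · intro p
    have := hm.input
    rw [hinp]
    simp only; rw [hpos _ (by omega)]; exact hm.rest p

theorem runs_pushWith (hm : Rep n H σ m) {i : Stk} (hi : i ≠ .inp) (hH : (σ i).length < H)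
    {emit : Code K Unit} {x : Sym K}
    (hemit : emit.Runs (low H) (n + 1) 3 ⟨m.reg, m.tape, pos i (σ i).length⟩ ()
      ⟨m.reg, Function.update m.tape (pos i (σ i).length) (cellOf (some x)),
        pos i (σ i).length⟩) :
    ∃ m', (pushWith i emit).Runs (low H) (n + 1) (70 * (H + 2)) m () m' ∧
      Rep n H (Function.update σ i (x :: σ i)) m' ∧ m'.reg = m.reg := by
  have hrep := hm.update_stack hi (l := x :: σ i) (j := (σ i).length) (x := some x)
    (fun p => by
      rw [List.reverse_cons, List.getElem?_append]
      split_ifs with h1 h2 h2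
      · simp at h1; omega
      · rfl
      · simp [h2]
      · rw [List.getElem?_eq_none (by simp at h1 ⊢; omega),
          List.getElem?_eq_none (by simp at h1 ⊢; omega)]) hH m.reg
  refine ⟨_, ?_, hrep, rfl⟩
  refine Code.Runs.mono ((runs_walk hm hi).bind (hemit.bind
    (runs_goHome_stack hH.le rfl hrep.home fun z hz => hrep.ne_home hz))) (by omega)

/-- Pushing a letter. -/
def emitLetter (l : Letter) : Code K Unit := .prim fun _ => ((), ⟨.sym (.letter l), none, .id⟩)

/-- Writing a constant. -/
def emitConst (k : K) : Code K Unit := .prim fun _ => ((), ⟨.const k, none, .id⟩)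

/-- Writing the content of a register. The machine has no such instruction, but it can add the
register to the constant `0`. -/
def emitReg (r : Bool) : Code K Unit :=
  (emitConst 0).bind fun _ => .prim fun _ => ((), ⟨.op .add r, none, .id⟩)

/-- Writing the result of an operation on the contents of the registers `false` and `true`. -/
def emitOp (o : ArithOp) : Code K Unit :=
  (emitReg false).bind fun _ => .prim fun _ => ((), ⟨.op o true, none, .id⟩)

section emit
variable {lo hi p : ℤ} {ρ : Bool → K} {τ : ℤ → Cell ⊕ K}

theorem runs_emitLetter (h1 : lo ≤ p) (h2 : p ≤ hi) (l : Letter) :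
    (emitLetter l).Runs lo hi 1 ⟨ρ, τ, p⟩ () ⟨ρ, Function.update τ p (cellOf (some (.inl l))), p⟩ :=
  Code.runs_prim h1 h2 rfl (by simp [Mem.act, Mem.written, Mem.loaded, Shift.move, cellOf])

theorem runs_emitConst (h1 : lo ≤ p) (h2 : p ≤ hi) (k : K) :
    (emitConst k).Runs lo hi 1 ⟨ρ, τ, p⟩ () ⟨ρ, Function.update τ p (cellOf (some (.inr k))), p⟩ :=
  Code.runs_prim h1 h2 rfl (by simp [Mem.act, Mem.written, Mem.loaded, Shift.move, cellOf])

theorem runs_emitReg (h1 : lo ≤ p) (h2 : p ≤ hi) (r : Bool) :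
    (emitReg r).Runs lo hi 2 ⟨ρ, τ, p⟩ ()
      ⟨ρ, Function.update τ p (cellOf (some (.inr (ρ r)))), p⟩ := by
  unfold emitReg
  refine Code.Runs.mono (Code.Runs.bind (runs_emitConst h1 h2 0) (Code.runs_prim h1 h2 rfl ?_)) le_rfl
  simp [Mem.act, Mem.written, Mem.loaded, Shift.move, cellOf, ArithOp.apply]

theorem runs_emitOp (h1 : lo ≤ p) (h2 : p ≤ hi) (o : ArithOp) :
    (emitOp o).Runs lo hi 3 ⟨ρ, τ, p⟩ ()
      ⟨ρ, Function.update τ p (cellOf (some (.inr (o.apply (ρ false) (ρ true))))), p⟩ := by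
  unfold emitOp
  refine Code.Runs.mono (Code.Runs.bind (runs_emitReg h1 h2 false)
    (Code.runs_prim h1 h2 rfl ?_)) le_rfl
  simp [Mem.act, Mem.written, Mem.loaded, Shift.move, cellOf]

end emit

/-- What a program learns when it removes the top symbol of a stack. -/
inductive Top
  | empty
  | val
  | letter (l : Letter)

instance : Finite Top :=
  Finite.of_surjective (fun x : Option (Option Letter) => match x with
    | none => Top.empty
    | some none => .val
    | some (some l) => .letter l)
    (by rintro (_ | _ | l); exacts [⟨none, rfl⟩, ⟨some none, rfl⟩, ⟨some (some l), rfl⟩])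

/-- The information about the top symbol of a stack. -/
def topOf : List (Sym K) → Top
  | [] => .empty
  | .inl l :: _ => .letter l
  | .inr _ :: _ => .val

/-- Consuming the next input symbol: the first input cell that has not been marked as used. An element of the semiring is loaded into register `r`. -/
def popInp (r : Bool) : Code K Top :=
  (Code.iter (fun _ : Unit => .prim fun s => match s with
    | some (.letter l) => (.inr (.letter l), ⟨.sym .used, none, .id⟩)
    | none => (.inr .val, ⟨.sym .used, some r, .id⟩)
    | some .blank => (.inr .empty, Act.nop)
    | _ => (.inl (), ⟨.keep, none, .left⟩)) ()).bind fun t => (goHome .right).bind fun _ => .pure t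

/-- Removing the top symbol of a stack. An element of the semiring is loaded into register `r`. -/
def popReg (i : Stk) (r : Bool) : Code K Top :=
  if i = .inp then popInp r else
  (walk i).bind fun e => if e then (goHome .left).bind fun _ => .pure .empty else
    (moveBy .left 22).bind fun _ => (Code.prim fun s => match s with
      | some (.letter l) => (.letter l, ⟨.sym .blank, none, .id⟩)
      | none => (.val, ⟨.sym .blank, some r, .id⟩)
      | _ => (.empty, Act.nop)).bind fun t => (goHome .left).bind fun _ => .pure t

/-- The registers after an element of the semiring has been loaded from the top of a stack. -/
def loadTop (ρ : Bool → K) (r : Bool) : List (Sym K) → Bool → K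
  | .inr a :: _ => Function.update ρ r a
  | _ => ρ

theorem runs_popInp (hm : Rep n H σ m) (hn : n ≤ H) (r : Bool) :
    ∃ m', (popInp r).Runs (low H) (n + 1) (70 * (H + 2)) m (topOf (σ .inp)) m' ∧
      Rep n H (Function.update σ .inp (σ .inp).tail) m' ∧
      m'.reg = loadTop m.reg r (σ .inp) := by
  have hin := hm.input
  obtain ⟨c, hc⟩ : ∃ c, c + (σ .inp).length = n := ⟨n - (σ .inp).length, by omega⟩
  have hcell : ∀ j : ℕ, m.tape (1 + c + j) = cellOf (σ .inp)[j]? := by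
    intro j
    rw [← hm.rest j]
    congr 2
    omega
  have hs : Mem.scan ⟨m.reg, m.tape, (1 + c : ℤ)⟩ = scanOf (σ .inp)[0]? := by
    refine scan_cellOf ?_
    rw [← hcell]
    simp
  -- the tape after the symbol has been read
  let T : ℤ → Cell ⊕ K := if σ .inp = [] then m.tape else
    Function.update m.tape (1 + c) (.inl .used)
  have hT : ∀ z : ℤ, z ≠ 1 + c → T z = m.tape z := by
    intro z hz
    simp only [T]
    split_ifs
    · rfl
    · exact Function.update_of_ne hz _ _
  have hlow : low H ≤ 0 := by unfold low; omega
  have key : ∀ q : ℕ, q ≤ c + 1 →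
      (Code.iter (fun _ : Unit => .prim fun s => match s with
        | some (.letter l) => (.inr (.letter l), ⟨.sym .used, none, .id⟩)
        | none => (.inr .val, ⟨.sym .used, some r, .id⟩)
        | some .blank => (.inr .empty, Act.nop)
        | _ => (.inl (), ⟨.keep, none, .left⟩)) () : Code K Top).Runs (low H) (n + 1) (2 * (q + 1))
        ⟨m.reg, m.tape, 1 + c - q⟩ (topOf (σ .inp)) ⟨loadTop m.reg r (σ .inp), T, 1 + c⟩ := by
    intro q
    induction q with
    | zero =>
      intro _
      simp only [Nat.cast_zero, sub_zero]
      refine Code.Runs.mono (Code.Runs.iter_done (by simp only; omega) (by simp only; omega)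
        (Code.runs_prim (by simp only; omega) (by simp only; omega) ?_ ?_)) le_rfl
      · rw [hs]
        rcases σ .inp with _ | ⟨_ | _, _⟩ <;> rfl
      · rw [hs]
        have := hcell 0
        revert this
        simp only [T]
        rcases σ .inp with _ | ⟨_ | _, _⟩ <;>
          simp +contextual [Mem.act, Mem.written, Mem.loaded, scanOf, cellOf, loadTop, Shift.move,
            Act.nop]
    | succ q ih =>
      intro hq
      have hne : (Mem.scan ⟨m.reg, m.tape, 1 + c - ((q + 1 : ℕ) : ℤ)⟩) = some .home ∨
          (Mem.scan ⟨m.reg, m.tape, 1 + c - ((q + 1 : ℕ) : ℤ)⟩) = some .used := by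
        by_cases hqc : q = c
        · left
          have : (1 : ℤ) + c - ((q + 1 : ℕ) : ℤ) = 0 := by omega
          simp only [Mem.scan]; rw [this, hm.home]; rfl
        · right
          have : (1 : ℤ) + c - ((q + 1 : ℕ) : ℤ) = 1 + ((c - (q + 1) : ℕ) : ℤ) := by omega
          simp only [Mem.scan]; rw [this, hm.used (c - (q + 1)) (by omega)]; rfl
      have e : (1 : ℤ) + c - ((q + 1 : ℕ) : ℤ) + Shift.left.move = 1 + c - q := by
        simp only [Shift.move]; omega
      refine Code.Runs.mono (Code.Runs.iter_next (by simp only; omega) (by simp only; omega)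
        (Code.runs_prim (a := Sum.inl ()) (m' := ⟨m.reg, m.tape, 1 + c - q⟩) (by simp only; omega)
          (by simp only; omega) ?_ ?_) (ih (by omega))) (by omega)
      · rcases hne with h | h <;> rw [h]
      · rw [← e]
        rcases hne with h | h <;> rw [h] <;> exact Mem.act_keep _ _
  have hk := key (c + 1) le_rfl
  have e : (⟨m.reg, m.tape, 1 + c - ((c + 1 : ℕ) : ℤ)⟩ : Mem K) = m := by
    rw [show (1 : ℤ) + c - ((c + 1 : ℕ) : ℤ) = m.head by rw [hm.head]; omega]
  rw [e] at hk
  have back := runs_goHome (lo := low H) (hi := n + 1) .right (c + 1)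
    (m := ⟨loadTop m.reg r (σ .inp), T, 1 + c⟩) (by simp only [Shift.move]; omega)
    (by simp only; omega) (by simp only; omega) hlow (by omega)
    (by simp only; rw [hT 0 (by omega)]; exact hm.home)
    (fun i hi hic => by
      -- all cells between the marked cell and the consumed symbol are input cells
      have e : -((i : ℤ) * Shift.right.move) = i := by simp only [Shift.move]; omega
      rw [e]
      by_cases h : i = c + 1
      · subst h
        have := hcell 0
        simp only [T]
        push_cast
        rw [add_comm (c : ℤ) 1]
        split_ifs with h0
        · rw [Nat.cast_zero, add_zero] at this; rw [this]; exact cellOf_ne_home _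
        · simp
      · simp only
        rw [hT _ (by omega)]
        have := hm.used (i - 1) (by omega)
        rw [show (1 : ℤ) + ((i - 1 : ℕ) : ℤ) = i by omega] at this
        rw [this]
        simp)
  refine ⟨⟨loadTop m.reg r (σ .inp), T, 0⟩,
    Code.Runs.mono (hk.bind (back.bind (Code.runs_pure _ _))) (by omega), ?_, rfl⟩
  have hother : ∀ i ≠ .inp, Function.update σ .inp (σ .inp).tail i = σ i :=
    fun i hi => Function.update_of_ne hi _ _
  refine ⟨rfl, ?_, ?_, ?_, ?_, ?_, ?_, ?_⟩
  · simp only; rw [hT 0 (by omega)]; exact hm.home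
  · intro i hi j
    rw [hother i hi, ← hm.stack i hi j]
    exact hT _ (by unfold pos; omega)
  · intro j
    rw [← hm.spare j]
    exact hT _ (by unfold pos; omega)
  · intro i hi
    rw [hother i hi]; exact hm.height i hi
  · rw [Function.update_self, List.length_tail]; omega
  · intro j hj
    rw [Function.update_self, List.length_tail] at hj
    simp only
    by_cases h : j = c
    · subst h
      have : σ .inp ≠ [] := by
        intro h0; rw [h0] at hc hj; simp at hc hj; omega
      simp [T, this]
    · rw [hT _ (by omega)]; exact hm.used j (by omega)
  · intro j
    rw [Function.update_self, List.length_tail]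
    simp only [T]
    cases hl : σ .inp with
    | nil =>
      have := hm.rest j
      rw [hl] at this
      simpa using this
    | cons x l =>
      rw [hl] at hc
      simp only [List.length_cons] at hc
      rw [if_neg (by simp), Function.update_of_ne (by simp only [List.length_cons]; omega)]
      have := hcell (j + 1)
      rw [hl] at this
      simp only [List.length_cons, List.tail_cons, List.getElem?_cons_succ] at this ⊢
      rw [← this]
      congr 1
      omega

theorem runs_popReg (hm : Rep n H σ m) (hn : n ≤ H) (i : Stk) (r : Bool) :
    ∃ m', (popReg i r).Runs (low H) (n + 1) (90 * (H + 2)) m (topOf (σ i)) m' ∧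
      Rep n H (Function.update σ i (σ i).tail) m' ∧ m'.reg = loadTop m.reg r (σ i) := by
  unfold popReg
  by_cases hi : i = .inp
  · subst hi
    obtain ⟨m', h1, h2, h3⟩ := runs_popInp hm hn r
    exact ⟨m', by rw [if_pos rfl]; exact h1.mono (by omega), h2, h3⟩
  rw [if_neg hi]
  have hH := hm.height i hi
  have hw := runs_walk hm hi
  cases hl : σ i with
  | nil =>
    rw [hl] at hw
    refine ⟨m, ?_, ?_, rfl⟩
    · have := runs_goHome_stack (n := n) (H := H) (m := ⟨m.reg, m.tape, pos i 0⟩) (i := i) (j := 0)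
        (by omega) rfl hm.home fun z hz => hm.ne_home hz
      have e : m = ⟨m.reg, m.tape, 0⟩ := by rw [← hm.head]
      refine Code.Runs.mono (hw.bind (Code.Runs.bind (m₁ := m) (by rw [e]; exact this)
        (Code.runs_pure _ _))) (by omega)
    · rw [List.tail_nil, ← hl, Function.update_eq_self]; exact hm
  | cons x l =>
    have hlen : (σ i).length = l.length + 1 := by rw [hl]; rfl
    have hrep := fun ρ => hm.update_stack hi (l := l) (j := l.length) (x := none)
      (fun p => by
        rw [hl, List.reverse_cons, List.getElem?_append]
        split_ifs with h1 h'
        · exact List.getElem?_eq_none (by simp; omega)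
        · rfl
        · rw [List.getElem?_eq_none (by simp at h' ⊢; omega),
            List.getElem?_eq_none (by simp at h' ⊢; omega)]) (by omega) ρ
    obtain ⟨h1, h2⟩ := pos_bounds (i := i) (j := l.length + 1) (H := H) (by omega)
    obtain ⟨h3, h4⟩ := pos_bounds (i := i) (j := l.length) (H := H) (by omega)
    have e : pos i (l.length + 1) + (22 : ℕ) * Shift.left.move = pos i l.length := by
      unfold pos Shift.move; push_cast; ring
    have mv := runs_moveBy (lo := low H) (hi := n + 1) .left 22
        (m := ⟨m.reg, m.tape, pos i (l.length + 1)⟩) h1 (by simp only; omega)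
        (by rw [e]; exact h3) (by rw [e]; omega)
    rw [e] at mv
    rw [hlen] at hw
    have hcell : m.tape (pos i l.length) = cellOf (some x) := by
      rw [hm.stack i hi, hl]; simp
    have home := fun ρ => runs_goHome_stack (n := n) (H := H)
      (m := ⟨ρ, Function.update m.tape (pos i l.length) (cellOf none), pos i l.length⟩)
      (i := i) (j := l.length) (by omega) rfl (hrep ρ).home fun z hz => (hrep ρ).ne_home hz
    have hs : Mem.scan ⟨m.reg, m.tape, pos i l.length⟩ = scanOf (some x) := scan_cellOf hcell
    refine ⟨_, ?_, hrep (loadTop m.reg r (x :: l)), rfl⟩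
    have hd : decide (x :: l = []) = false := by simp
    rw [hl, hd] at hw
    refine Code.Runs.mono (hw.bind (mv.bind ((Code.runs_prim (a := topOf (x :: l)) h3
      (by simp only; omega) ?_ ?_).bind ((home _).bind (Code.runs_pure _ _))))) (by omega)
    · simp only [hs]; cases x <;> rfl
    · simp only [hs]
      cases x <;> simp [Mem.act, Mem.written, Mem.loaded, scanOf, hcell, cellOf, Shift.move]

end SemiringFO

namespace SemiringFO

universe u

variable {K : Type u} [CommSemiring K] {α β : Type}

/-! ### Programs on stacks -/

/-- A bound for the number of steps of one operation on stacks of height at most `H`. -/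
def unitTime (H : ℕ) : ℕ := 300 * (H + 2)

/-- `Does n H c σ u a σ'`: on a memory that represents the stacks `σ`, the code `c` is left through
the exit `a` with a memory that represents `σ'`, after at most `u` units of time. All stacks have
height at most `H`, and the input has length `n`. -/
def Does (n H : ℕ) (c : Code K α) (σ : State K) (u : ℕ) (a : α) (σ' : State K) : Prop :=
  n ≤ H → ∀ m, Rep n H σ m →
    ∃ m', c.Runs (low H) (n + 1) (u * unitTime H) m a m' ∧ Rep n H σ' m'

section
variable {n H u v : ℕ} {σ σ₁ σ₂ : State K} {a : α} {b : β}

theorem Does.weaken {c : Code K α} {σ₁' : State K} (h : Does n H c σ u a σ₁) (huv : u ≤ v)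
    (hσ : σ₁ = σ₁') : Does n H c σ v a σ₁' := by
  subst hσ
  intro hn m hm
  obtain ⟨m', h1, h2⟩ := h hn m hm
  exact ⟨m', h1.mono (Nat.mul_le_mul_right _ huv), h2⟩

theorem does_pure : Does n H (.pure a) σ 0 a σ :=
  fun _ m hm => ⟨m, (Code.runs_pure a m).mono (Nat.zero_le _), hm⟩

theorem Does.bind [Finite α] {c : Code K α} {f : α → Code K β} (h : Does n H c σ u a σ₁)
    (h' : Does n H (f a) σ₁ v b σ₂) : Does n H (c.bind f) σ (u + v) b σ₂ := by
  intro hn m hm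
  obtain ⟨m₁, h1, h2⟩ := h hn m hm
  obtain ⟨m₂, h3, h4⟩ := h' hn m₁ h2
  exact ⟨m₂, by rw [Nat.add_mul]; exact h1.bind h3, h4⟩

omit [CommSemiring K] in
theorem Rep.head_bounds {m : Mem K} (hm : Rep n H σ m) : low H ≤ m.head ∧ m.head ≤ n + 1 := by
  rw [hm.head]; unfold low; omega

theorem Does.iter_done [Finite α] {f : α → Code K (α ⊕ β)} (h : Does n H (f a) σ u (.inr b) σ₁) :
    Does n H (.iter f a) σ (u + 1) b σ₁ := by
  intro hn m hm
  obtain ⟨m₁, h1, h2⟩ := h hn m hm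
  refine ⟨m₁, (Code.Runs.iter_done hm.head_bounds.1 hm.head_bounds.2 h1).mono ?_, h2⟩
  unfold unitTime
  rw [Nat.add_mul]
  omega

theorem Does.iter_next [Finite α] {f : α → Code K (α ⊕ β)} {a' : α}
    (h : Does n H (f a) σ u (.inl a') σ₁) (h' : Does n H (.iter f a') σ₁ v b σ₂) :
    Does n H (.iter f a) σ (u + 1 + v) b σ₂ := by
  intro hn m hm
  obtain ⟨m₁, h1, h2⟩ := h hn m hm
  obtain ⟨m₂, h3, h4⟩ := h' hn m₁ h2
  refine ⟨m₂, (Code.Runs.iter_next hm.head_bounds.1 hm.head_bounds.2 h1 h3).mono ?_, h4⟩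
  unfold unitTime
  rw [Nat.add_mul, Nat.add_mul]
  omega

theorem Does.seq [Finite α] {c : Code K α} {f : α → Code K β} (h : Does n H c σ u a σ₁)
    (hu : u ≤ v) (h' : Does n H (f a) σ₁ (v - u) b σ₂) : Does n H (c.bind f) σ v b σ₂ :=
  (h.bind h').weaken (by omega) rfl

theorem Does.last [Finite α] {f : α → Code K (α ⊕ β)} (h : Does n H (f a) σ u (.inr b) σ₁)
    (hu : u + 1 ≤ v) : Does n H (.iter f a) σ v b σ₁ :=
  h.iter_done.weaken hu rfl

theorem Does.next [Finite α] {f : α → Code K (α ⊕ β)} {a' : α}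
    (h : Does n H (f a) σ u (.inl a') σ₁) (hu : u + 1 ≤ v)
    (h' : Does n H (.iter f a') σ₁ (v - (u + 1)) b σ₂) : Does n H (.iter f a) σ v b σ₂ :=
  (h.iter_next h').weaken (by omega) rfl

theorem Does.done {σ₁ : State K} (hσ : σ = σ₁) : Does n H (.pure a) σ u a σ₁ :=
  does_pure.weaken (Nat.zero_le _) hσ

/-- Removing the top symbol of a stack. -/
def pop (i : Stk) : Code K Top := popReg i false

theorem does_pop {i : Stk} : Does n H (pop i) σ 1 (topOf (σ i))
    (Function.update σ i (σ i).tail) := by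
  intro hn m hm
  obtain ⟨m', h1, h2, -⟩ := runs_popReg hm hn i false
  exact ⟨m', h1.mono (by unfold unitTime; omega), h2⟩

/-- Pushing a letter. -/
def push (i : Stk) (l : Letter) : Code K Unit := pushWith i (emitLetter l)

theorem pos_bounds' {i : Stk} {j H n : ℕ} (hj : j ≤ H) :
    low H ≤ pos i j ∧ pos i j ≤ n + 1 := by
  have := pos_bounds (i := i) hj
  unfold low
  omega

theorem does_push {i : Stk} {l : Letter} (hi : i ≠ .inp) (hH : (σ i).length < H) :
    Does n H (push i l) σ 1 () (Function.update σ i (.inl l :: σ i)) := by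
  intro hn m hm
  have hb := pos_bounds' (i := i) (n := n) hH.le
  obtain ⟨m', h1, h2, -⟩ := runs_pushWith hm hi hH ((runs_emitLetter hb.1 hb.2 l).mono (by omega))
  exact ⟨m', h1.mono (by unfold unitTime; omega), h2⟩

/-- Pushing a constant of the semiring. -/
def pushConst (i : Stk) (k : K) : Code K Unit := pushWith i (emitConst k)

theorem does_pushConst {i : Stk} {k : K} (hi : i ≠ .inp) (hH : (σ i).length < H) :
    Does n H (pushConst i k) σ 1 () (Function.update σ i (.inr k :: σ i)) := by
  intro hn m hm
  have hb := pos_bounds' (i := i) (n := n) hH.le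
  obtain ⟨m', h1, h2, -⟩ := runs_pushWith hm hi hH ((runs_emitConst hb.1 hb.2 k).mono (by omega))
  exact ⟨m', h1.mono (by unfold unitTime; omega), h2⟩

/-- Pushing what has been removed by `popReg _ false`. -/
def pushTop (j : Stk) : Top → Code K Unit
  | .empty => .pure ()
  | .letter l => push j l
  | .val => pushWith j (emitReg false)

theorem runs_pushTop {j : Stk} {m : Mem K} {x : Sym K} {l : List (Sym K)} (hm : Rep n H σ m)
    (hreg : ∀ a, x = .inr a → m.reg false = a)
    (hj : j ≠ .inp) (hH : (σ j).length < H) :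
    ∃ m', (pushTop j (topOf (x :: l))).Runs (low H) (n + 1) (70 * (H + 2)) m () m' ∧
      Rep n H (Function.update σ j (x :: σ j)) m' ∧ m'.reg = m.reg := by
  have hb := pos_bounds' (i := j) (n := n) hH.le
  cases x with
  | inl l => exact runs_pushWith hm hj hH ((runs_emitLetter hb.1 hb.2 l).mono (by omega))
  | inr a =>
    refine runs_pushWith hm hj hH ?_
    have := runs_emitReg (ρ := m.reg) (τ := m.tape) hb.1 hb.2 false
    rw [hreg a rfl] at this
    exact this.mono (by omega)

/-- Moving the top symbol of a stack to another stack. -/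
def moveTop (i j : Stk) : Code K Top :=
  (popReg i false).bind fun t => (pushTop j t).bind fun _ => .pure t

theorem does_moveTop_nil {i j : Stk} (h : σ i = []) : Does n H (moveTop i j) σ 1 .empty σ := by
  intro hn m hm
  obtain ⟨m', h1, h2, -⟩ := runs_popReg hm hn i false
  rw [h] at h1 h2
  rw [List.tail_nil, ← h, Function.update_eq_self] at h2
  exact ⟨m', Code.Runs.mono (h1.bind ((Code.runs_pure _ _).bind (Code.runs_pure _ _)))
    (by unfold unitTime; omega), h2⟩

theorem does_moveTop {i j : Stk} {x : Sym K} {l : List (Sym K)} (h : σ i = x :: l) (hij : i ≠ j)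
    (hj : j ≠ .inp) (hH : (σ j).length < H) :
    Does n H (moveTop i j) σ 1 (topOf (x :: l))
      (Function.update (Function.update σ i l) j (x :: σ j)) := by
  intro hn m hm
  obtain ⟨m₁, h1, h2, h3⟩ := runs_popReg hm hn i false
  rw [h] at h1 h2 h3
  have hσ : Function.update σ i l j = σ j := Function.update_of_ne hij.symm _ _
  obtain ⟨m₂, h4, h5, -⟩ := runs_pushTop (j := j) (x := x) (l := l) h2
    (fun a ha => by subst ha; rw [h3]; simp [loadTop]) hj (by rwa [List.tail_cons, hσ])
  rw [List.tail_cons, hσ] at h5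
  exact ⟨m₂, Code.Runs.mono (h1.bind (h4.bind (Code.runs_pure _ _)))
    (by unfold unitTime; omega), h5⟩

/-- Copying the top symbol of a stack to another stack. -/
def copyTop (i j : Stk) : Code K Unit :=
  (popReg i false).bind fun t => (pushTop i t).bind fun _ => pushTop j t

theorem does_copyTop {i j : Stk} {x : Sym K} {l : List (Sym K)} (h : σ i = x :: l)
    (hi : i ≠ .inp) (hj : j ≠ .inp) (hH : (σ j).length < H) :
    Does n H (copyTop i j) σ 1 () (Function.update σ j (x :: σ j)) := by
  intro hn m hm
  have hl := hm.height i hi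
  rw [h, List.length_cons] at hl
  obtain ⟨m₁, h1, h2, h3⟩ := runs_popReg hm hn i false
  rw [h] at h1 h2 h3
  have hreg : ∀ a, x = .inr a → m₁.reg false = a :=
    fun a ha => by subst ha; rw [h3]; simp [loadTop]
  obtain ⟨m₂, h4, h5, h6⟩ := runs_pushTop (j := i) (x := x) (l := l) h2 hreg hi
    (by rwa [Function.update_self])
  simp only [List.tail_cons, Function.update_self, Function.update_idem] at h5
  rw [← h, Function.update_eq_self] at h5
  obtain ⟨m₃, h7, h8, -⟩ := runs_pushTop (j := j) (x := x) (l := l) h5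
    (fun a ha => by rw [h6]; exact hreg a ha) hj hH
  exact ⟨m₃, Code.Runs.mono (h1.bind (h4.bind h7)) (by unfold unitTime; omega), h8⟩

/-- Replacing the two topmost symbols of a stack by the result of an arithmetic operation. -/
def arith (o : ArithOp) (i : Stk) : Code K Unit :=
  (popReg i true).bind fun _ => (popReg i false).bind fun _ => pushWith i (emitOp o)

theorem does_arith {o : ArithOp} {i : Stk} {x y : K} {l : List (Sym K)}
    (h : σ i = .inr y :: .inr x :: l) (hi : i ≠ .inp) :
    Does n H (arith o i) σ 1 () (Function.update σ i (.inr (o.apply x y) :: l)) := by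
  intro hn m hm
  have hH := hm.height i hi
  obtain ⟨m₁, h1, h2, h3⟩ := runs_popReg hm hn i true
  obtain ⟨m₂, h4, h5, h6⟩ := runs_popReg h2 hn i false
  rw [h] at h1 h2 h3 h5 h6 hH
  simp only [List.tail_cons, Function.update_self, Function.update_idem, loadTop] at h3 h5 h6
  have hl : l.length < H := by simp only [List.length_cons] at hH; omega
  have hb := pos_bounds' (i := i) (n := n) hl.le
  have := runs_emitOp (ρ := m₂.reg) (τ := m₂.tape) hb.1 hb.2 o
  rw [h6, h3] at this
  simp only [Function.update_self, ne_eq, Bool.true_eq_false, not_false_eq_true,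
    Function.update_of_ne] at this
  obtain ⟨m₃, h7, h8, -⟩ := runs_pushWith h5 hi (by rwa [Function.update_self])
    (emit := emitOp o) (x := .inr (o.apply x y)) (by
      rw [Function.update_self, h6, h3]; exact this)
  simp only [Function.update_self, Function.update_idem] at h8
  exact ⟨m₃, Code.Runs.mono (h1.bind (h4.bind h7)) (by unfold unitTime; omega), h8⟩

end

end SemiringFO

namespace SemiringFO

universe u

noncomputable instance : DecidableEq Letter := Classical.decEq _

variable {K : Type u} {n H : ℕ} {σ : State K}

/-! ### Moving, copying and comparing words -/

/-- A word of letters as the content of a stack. -/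
def str (w : List Letter) : List (Sym K) := w.map Sum.inl

@[simp, grind =] theorem str_nil : (str [] : List (Sym K)) = [] := rfl

@[simp, grind =] theorem str_cons (x : Letter) (w : List Letter) :
    (str (x :: w) : List (Sym K)) = .inl x :: str w := rfl

@[simp, grind =] theorem str_append (v w : List Letter) :
    (str (v ++ w) : List (Sym K)) = str v ++ str w := List.map_append

@[simp, grind =] theorem reverse_str (w : List Letter) : (str w : List (Sym K)).reverse = str w.reverse :=
  List.map_reverse.symm

@[simp, grind =] theorem length_str (w : List Letter) : (str w : List (Sym K)).length = w.length :=
  List.length_map _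

/-- A number in unary notation. -/
def ones (r : ℕ) : List (Sym K) := List.replicate r (.inl .one)

variable [CommSemiring K]

/-- Moving all symbols of a stack to another stack. -/
def moveAll (i j : Stk) : Code K Unit :=
  .iter (fun _ : Unit => (moveTop i j).bind fun t => match t with
    | .empty => .pure (.inr ())
    | _ => .pure (.inl ())) ()

theorem does_moveAll {i j : Stk} {l : List (Sym K)} (h : σ i = l) (hij : i ≠ j) (hj : j ≠ .inp)
    (hH : (σ j).length + l.length ≤ H) :
    Does n H (moveAll i j) σ (2 * l.length + 2) ()
      (Function.update (Function.update σ i []) j (l.reverse ++ σ j)) := by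
  induction l generalizing σ with
  | nil =>
    refine Does.last (u := 1) (.seq (does_moveTop_nil h) le_rfl (.done ?_)) (by simp)
    rw [← h, Function.update_eq_self, h]; simp
  | cons x l ih =>
    simp only [List.length_cons] at hH
    refine Does.next (u := 1) (a' := ()) (.seq (does_moveTop h hij hj (by omega)) le_rfl
      (σ₂ := Function.update (Function.update σ i l) j (x :: σ j)) ?_) (by simp)
      ((ih (by simp [hij]) (by simp; omega)).weaken (by simp; omega) ?_)
    · cases x <;> exact .done rfl
    · funext z
      by_cases h1 : z = j
      · subst h1; simp
      · by_cases h2 : z = i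
        · subst h2; simp [h1]
        · simp [h1, h2]

/-- Emptying a stack. -/
def clear (i : Stk) : Code K Unit :=
  .iter (fun _ : Unit => (pop i).bind fun t => match t with
    | .empty => .pure (.inr ())
    | _ => .pure (.inl ())) ()

theorem does_clear {i : Stk} {l : List (Sym K)} (h : σ i = l) :
    Does n H (clear i) σ (2 * l.length + 2) () (Function.update σ i []) := by
  induction l generalizing σ with
  | nil =>
    refine Does.last (u := 1) (.seq does_pop le_rfl ?_) (by simp)
    rw [h]; exact .done rfl
  | cons x l ih =>
    refine Does.next (u := 1) (a' := ()) (.seq does_pop le_rfl (σ₂ := Function.update σ i l) ?_)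
      (by simp) ((ih (by simp)).weaken (by simp; omega) (by simp))
    rw [h]; cases x <;> exact .done rfl

/-- Moving letters from `i` to `j` up to and including the first one that satisfies `p`. All
letters before that one are also copied to `c`, if such a stack is given. -/
def moveUntil (p : Letter → Bool) (i j : Stk) (c : Option Stk) : Code K Top :=
  .iter (fun _ : Unit => (moveTop i j).bind fun t => match t with
    | .letter l => if p l then .pure (.inr t) else match c with
      | none => .pure (.inl ())
      | some c => (push c l).bind fun _ => .pure (.inl ())
    | _ => .pure (.inr t)) ()

theorem does_moveUntil {p : Letter → Bool} {i j : Stk} {w : List Letter} {x : Letter}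
    {l : List (Sym K)} (h : σ i = str w ++ .inl x :: l) (hw : ∀ y ∈ w, p y = false)
    (hx : p x = true) (hij : i ≠ j) (hj : j ≠ .inp) (hH : (σ j).length + w.length < H) :
    Does n H (moveUntil p i j none) σ (2 * w.length + 2) (.letter x)
      (Function.update (Function.update σ i l) j (.inl x :: (str w.reverse ++ σ j))) := by
  induction w generalizing σ with
  | nil =>
    refine Does.last (u := 1) (.seq (does_moveTop h hij hj (by simpa using hH)) le_rfl ?_) (by simp)
    simp only [topOf, hx, if_true]
    exact .done (by simp)
  | cons y w ih =>
    simp only [List.length_cons] at hH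
    refine Does.next (u := 1) (a' := ()) (.seq (does_moveTop (x := .inl y)
      (l := str w ++ .inl x :: l) (h.trans (by simp)) hij hj (by omega)) le_rfl
      (σ₂ := Function.update (Function.update σ i (str w ++ .inl x :: l)) j (.inl y :: σ j)) ?_)
      (by simp) ((ih (by simp [hij]) (fun z hz => hw z (List.mem_cons_of_mem _ hz))
        (by simp; omega)).weaken (by simp; omega) ?_)
    · simp only [topOf, hw y List.mem_cons_self]; exact .done rfl
    · funext z
      by_cases h1 : z = j
      · subst h1; simp
      · by_cases h2 : z = i
        · subst h2; simp [h1]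
        · simp [h1, h2]

theorem does_moveUntil_nil {p : Letter → Bool} {i j : Stk} {c : Option Stk} (h : σ i = []) :
    Does n H (moveUntil p i j c) σ 2 .empty σ :=
  .last (u := 1) (.seq (does_moveTop_nil h) le_rfl (.done rfl)) le_rfl

theorem does_moveUntil_copy {p : Letter → Bool} {i j c : Stk} {w : List Letter} {x : Letter}
    {l : List (Sym K)} (h : σ i = str w ++ .inl x :: l) (hw : ∀ y ∈ w, p y = false)
    (hx : p x = true) (hij : i ≠ j) (hj : j ≠ .inp) (hic : i ≠ c) (hjc : j ≠ c) (hc : c ≠ .inp)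
    (hH : (σ j).length + w.length < H) (hcH : (σ c).length + w.length ≤ H) :
    Does n H (moveUntil p i j (some c)) σ (3 * w.length + 2) (.letter x)
      (Function.update (Function.update (Function.update σ i l) j
        (.inl x :: (str w.reverse ++ σ j))) c (str w.reverse ++ σ c)) := by
  induction w generalizing σ with
  | nil =>
    refine Does.last (u := 1) (.seq (does_moveTop h hij hj (by simpa using hH)) le_rfl ?_) (by simp)
    simp only [topOf, hx, if_true]
    refine .done (funext fun z => ?_)
    by_cases h1 : z = c
    · subst h1; simp [hic.symm, hjc.symm]
    · simp [h1]
  | cons y w ih =>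
    simp only [List.length_cons] at hH hcH
    refine Does.next (u := 2) (a' := ()) (.seq (does_moveTop (x := .inl y)
      (l := str w ++ .inl x :: l) (h.trans (by simp)) hij hj (by omega)) (by simp)
      (σ₂ := Function.update (Function.update (Function.update σ i (str w ++ .inl x :: l)) j
        (.inl y :: σ j)) c (.inl y :: σ c)) ?_)
      (by simp; omega) ((ih (by simp [hij, hic]) (fun z hz => hw z (List.mem_cons_of_mem _ hz))
        (by simp [hjc]; omega) (by simp; omega)).weaken (by simp; omega) ?_)
    · simp only [topOf, hw y List.mem_cons_self]
      refine .seq (does_push hc ?_) le_rfl (.done ?_)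
      · simp [hic.symm, hjc.symm]; omega
      · simp [hic.symm, hjc.symm]
    · funext z
      by_cases h0 : z = c
      · subst h0; simp
      by_cases h1 : z = j
      · subst h1; simp [h0]
      · by_cases h2 : z = i
        · subst h2; simp [h1, h0]
        · simp [h1, h2, h0]

/-- Whether a letter is a binary digit. -/
def Letter.isBit : Letter → Bool
  | .zero | .one => true
  | _ => false

/-- Whether the removed symbol is a given binary digit. -/
def Top.isDigit : Letter → Top → Bool
  | .zero, .letter .zero => true
  | .one, .letter .one => true
  | _, _ => false

theorem isDigit_letter {x y : Letter} (hx : x.isBit = true) (hy : y.isBit = true) :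
    (Top.letter y).isDigit x = decide (x = y) := by
  cases x <;> cases hx <;> cases y <;> cases hy <;> simp [Top.isDigit]

/-- Whether there was no symbol left. -/
def Top.isEmpty : Top → Bool
  | .empty => true
  | _ => false

/-- Comparing the word on the stack `key` with the word of digits on top of the stack `i`. The
latter is moved to `j`, together with the letter that terminates it. -/
def matchKey (i j : Stk) : Code K Bool :=
  (Code.iter (fun ok : Bool => (moveTop i j).bind fun t => match t with
    | .letter l => if l.isBit then
        if ok then (moveTop .key .keyL).bind fun t => .pure (.inl (t.isDigit l))
        else .pure (.inl false)
      else if ok then (moveTop .key .keyL).bind fun t => .pure (.inr t.isEmpty)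
        else .pure (.inr false)
    | _ => .pure (.inr false)) true).bind fun r => (moveAll .keyL .key).bind fun _ => .pure r

/-- The part `k₁` of the key that has been moved to `keyL` is unknown, because the key is left alone
once a difference has been found. -/
theorem does_matchKey_loop {i j : Stk} {w k : List Letter} {x : Letter} {l : List (Sym K)}
    {ok : Bool} (h : σ i = str w ++ .inl x :: l) (hw : ∀ y ∈ w, y.isBit = true)
    (hk : σ .key = str k) (hkb : ∀ y ∈ k, y.isBit = true) (hx : x.isBit = false) (hij : i ≠ j)
    (hj : j ≠ .inp) (hi : i ≠ .key ∧ i ≠ .keyL) (hj' : j ≠ .key ∧ j ≠ .keyL)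
    (hH : (σ j).length + w.length < H) (hkH : (σ .keyL).length + k.length ≤ H) :
    ∃ k₁ k₂, k = k₁ ++ k₂ ∧ k₁.length ≤ w.length + 1 ∧
    Does n H (Code.iter (fun ok : Bool => (moveTop i j).bind fun t => match t with
      | .letter l => if l.isBit then
          if ok then (moveTop .key .keyL).bind fun t => .pure (.inl (t.isDigit l))
          else .pure (.inl false)
        else if ok then (moveTop .key .keyL).bind fun t => .pure (.inr t.isEmpty)
          else .pure (.inr false)
      | _ => .pure (.inr false)) ok) σ (3 * w.length + 3) (ok && decide (w = k))
      (Function.update (Function.update (Function.update (Function.update σ i l) j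
        (.inl x :: (str w.reverse ++ σ j))) .key (str k₂)) .keyL (str k₁.reverse ++ σ .keyL)) := by
  induction w generalizing σ ok k with
  | nil =>
    have h1 := does_moveTop (n := n) (H := H) h hij hj (by simpa using hH)
    cases ok with
    | false =>
      refine ⟨[], k, rfl, by simp, .last (u := 1) (.seq h1 le_rfl ?_) (by simp)⟩
      simp only [topOf, hx]
      refine .done (funext fun z => ?_)
      simp only [Function.update_apply]
      grind
    | true =>
      cases k with
      | nil =>
        refine ⟨[], [], rfl, by simp, .last (u := 2) (.seq h1 (by simp) ?_) (by simp)⟩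
        simp only [str_nil, topOf, hx]
        refine .seq (does_moveTop_nil (by simp [hi.1.symm, hj'.1.symm, hk])) le_rfl
          (.done (funext fun z => ?_))
        simp only [Function.update_apply]
        grind
      | cons y k =>
        simp only [List.length_cons] at hkH
        refine ⟨[y], k, rfl, by simp, .last (u := 2) (.seq h1 (by simp) ?_) (by simp)⟩
        simp only [topOf, hx]
        refine .seq (does_moveTop (x := .inl y) (l := str k)
          (by simp [hi.1.symm, hj'.1.symm, hk]) (by decide) (by decide)
          (by simp [hi.2.symm, hj'.2.symm]; omega)) le_rfl (.done (funext fun z => ?_))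
        simp only [Function.update_apply]
        grind
  | cons y w ih =>
    simp only [List.length_cons] at hH
    have h1 := does_moveTop (n := n) (H := H) (x := .inl y) (l := str w ++ .inl x :: l)
      (h.trans (by simp)) hij hj (by omega)
    have hy := hw y List.mem_cons_self
    have hw' := fun z hz => hw z (List.mem_cons_of_mem _ hz)
    cases ok with
    | false =>
      obtain ⟨k₁, k₂, e, hle, hd⟩ := ih (σ := Function.update (Function.update σ i
        (str w ++ .inl x :: l)) j (.inl y :: σ j)) (ok := false) (k := k) (by simp [hij]) hw'
        (by simp [hi.1.symm, hj'.1.symm, hk]) hkb (by simp; omega)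
        (by simp [hi.2.symm, hj'.2.symm]; omega)
      refine ⟨k₁, k₂, e, by simp; omega, .next (u := 1) (a' := false) (.seq h1 le_rfl ?_)
        (by simp only [List.length_cons]; omega) (hd.weaken (by simp; omega) (funext fun z => ?_))⟩
      · simp only [topOf, hy]; exact .done rfl
      · simp only [Function.update_apply]
        grind
    | true =>
      cases k with
      | nil =>
        obtain ⟨k₁, k₂, e, hle, hd⟩ := ih (σ := Function.update (Function.update σ i
          (str w ++ .inl x :: l)) j (.inl y :: σ j)) (ok := false) (k := []) (by simp [hij]) hw'
          (by simp [hi.1.symm, hj'.1.symm, hk]) hkb (by simp; omega)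
          (by simp [hi.2.symm, hj'.2.symm]; omega)
        refine ⟨k₁, k₂, e, by simp; omega, .next (u := 2) (a' := false) (.seq h1 (by simp) ?_)
          (by simp only [List.length_cons]; omega) (hd.weaken (by simp; omega) (funext fun z => ?_))⟩
        · simp only [topOf, hy]
          refine .seq (does_moveTop_nil (by simp [hi.1.symm, hj'.1.symm, hk])) le_rfl ?_
          cases y <;> exact .done rfl
        · simp only [Function.update_apply]
          grind
      | cons b k =>
        simp only [List.length_cons] at hkH
        have hb := hkb b List.mem_cons_self
        obtain ⟨k₁, k₂, e, hle, hd⟩ := ih (σ := Function.update (Function.update (Function.update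
          (Function.update σ i (str w ++ .inl x :: l)) j (.inl y :: σ j)) .key (str k)) .keyL
          (.inl b :: σ .keyL)) (ok := decide (y = b)) (k := k) (by simp [hij, hi]) hw'
          (by simp) (fun z hz => hkb z (List.mem_cons_of_mem _ hz)) (by simp [hj']; omega)
          (by simp; omega)
        refine ⟨b :: k₁, k₂, by rw [e]; rfl, by simp; omega, ?_⟩
        rw [show (true && decide (y :: w = b :: k)) = (decide (y = b) && decide (w = k)) by simp]
        refine .next (u := 2) (a' := decide (y = b)) (.seq h1 (by simp) ?_)
          (by simp) (hd.weaken (by simp; omega) (funext fun z => ?_))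
        · simp only [topOf, hy]
          refine .seq (does_moveTop (x := .inl b) (l := str k)
            (by simp [hi.1.symm, hj'.1.symm, hk]) (by decide) (by decide)
            (by simp [hi.2.symm, hj'.2.symm]; omega)) le_rfl ?_
          rw [show decide (y = b) = (topOf (Sum.inl b :: (str k : List (Sym K)))).isDigit y from
            (isDigit_letter hy hb).symm]
          refine .done ?_; simp [hj'.2.symm, hi.2.symm]
        · simp only [Function.update_apply]
          grind

theorem does_matchKey {i j : Stk} {w k : List Letter} {x : Letter} {l : List (Sym K)}
    (h : σ i = str w ++ .inl x :: l) (hw : ∀ y ∈ w, y.isBit = true)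
    (hk : σ .key = str k) (hkb : ∀ y ∈ k, y.isBit = true) (hkL : σ .keyL = [])
    (hx : x.isBit = false) (hij : i ≠ j)
    (hj : j ≠ .inp) (hi : i ≠ .key ∧ i ≠ .keyL) (hj' : j ≠ .key ∧ j ≠ .keyL)
    (hH : (σ j).length + w.length < H) (hkH : k.length ≤ H) :
    Does n H (matchKey i j) σ (5 * w.length + 7) (decide (w = k))
      (Function.update (Function.update σ i l) j (.inl x :: (str w.reverse ++ σ j))) := by
  obtain ⟨k₁, k₂, e, hle, hd⟩ := does_matchKey_loop (ok := true) h hw hk hkb hx hij hj hi hj' hH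
    (by simpa [hkL] using hkH)
  rw [Bool.true_and] at hd
  have hlen : k.length = k₁.length + k₂.length := by rw [e, List.length_append]
  refine .seq hd (by omega) (.seq (does_moveAll rfl (by decide) (by decide) ?_) ?_ (.done ?_))
  · simp [hkL]; omega
  · simp [hkL]; omega
  · funext z
    simp only [Function.update_apply]
    grind

end SemiringFO

namespace SemiringFO

universe u

variable {K : Type u} [CommSemiring K] {n H : ℕ} {σ : State K}

/-! ### Looking up variables and elements -/

/-- The word popped from the stack `env` for one item of the current assignment: a payload, a mark
that tells the kind of the payload, and the index of the variable. -/
def itemWord (e : List Letter × Letter × List Letter) : List Letter :=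
  e.1 ++ e.2.1 :: (e.2.2 ++ [.var])

/-- The payload and the key of an item are words of digits. -/
def ItemOk (e : List Letter × Letter × List Letter) : Prop :=
  (∀ y ∈ e.1, y.isBit = true) ∧ e.2.1.isBit = false ∧ ∀ y ∈ e.2.2, y.isBit = true

/-- Searching the first item on the stack `env` with the given key. Its payload is copied to `res`,
and its mark is returned. -/
def findVar : Code K Top :=
  .iter (fun _ : Unit => (moveUntil (fun l => !l.isBit) .env .envL (some .res)).bind fun t =>
    (matchKey .env .envL).bind fun r => if r then .pure (.inr t) else
      (clear .res).bind fun _ => .pure (.inl ())) ()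

theorem does_findVar {es : List (List Letter × Letter × List Letter)} {p k : List Letter}
    {x : Letter} {l : List (Sym K)}
    (h : σ .env = str (es.flatMap itemWord) ++ (str (itemWord (p, x, k)) ++ l))
    (hes : ∀ e ∈ es, ItemOk e ∧ e.2.2 ≠ k) (hok : ItemOk (p, x, k))
    (hk : σ .key = str k) (hkL : σ .keyL = []) (hr : σ .res = [])
    (hH : (σ .envL).length + (es.flatMap itemWord).length + (itemWord (p, x, k)).length ≤ H) :
    Does n H findVar σ (10 * ((es.flatMap itemWord).length + (itemWord (p, x, k)).length)) (.letter x)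
      (Function.update (Function.update (Function.update σ .env l) .envL
        (str (es.flatMap itemWord ++ itemWord (p, x, k)).reverse ++ σ .envL)) .res
        (str p.reverse)) := by
  induction es generalizing σ with
  | nil =>
    simp only [itemWord, List.flatMap_nil, List.nil_append, List.length_append, List.length_cons,
      List.length_nil, str_append, str_cons, str_nil] at h hH ⊢
    obtain ⟨h1, h2, h3⟩ := hok
    refine .last (u := 3 * p.length + 2 + (5 * k.length + 7)) (.seq (does_moveUntil_copy
      (p := fun l => !l.isBit) (w := p) (x := x) (l := str k ++ .inl .var :: l) (by rw [h]; simp)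
      (fun y hy => by simp [h1 y hy]) (by simpa using h2) (by decide) (by decide) (by decide)
      (by decide) (by decide) (by omega) (by simp [hr]; omega)) (by omega)
      (.seq (does_matchKey (w := k) (k := k) (x := .var) (l := l) (by simp) h3 (by simpa using hk)
        h3 (by simpa using hkL) rfl (by decide) (by decide) (by decide) (by decide) ?_ ?_)
        (by omega) ?_)) (by omega)
    · simp; omega
    · omega
    · simp only [decide_true, if_true]
      refine .done (funext fun z => ?_)
      simp only [Function.update_apply]
      cases z <;> simp [hr]
  | cons e es ih =>
    obtain ⟨p', x', k'⟩ := e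
    obtain ⟨⟨h1, h2, h3⟩, hne⟩ := hes _ List.mem_cons_self
    simp only [List.flatMap_cons, List.length_append, str_append, List.append_assoc] at h hH ⊢
    have hlen : (itemWord (p', x', k')).length = p'.length + k'.length + 2 := by
      simp [itemWord]; omega
    have hne' : k' ≠ k := hne
    set L := str (es.flatMap itemWord) ++ (str (itemWord (p, x, k)) ++ l) with hL
    refine .next (u := 5 * p'.length + 4 + (5 * k'.length + 7)) (a' := ()) (.seq (does_moveUntil_copy
      (p := fun l => !l.isBit) (w := p') (x := x') (l := str k' ++ .inl .var :: L)
      (by rw [h]; simp [itemWord])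
      (fun y hy => by simp [h1 y hy]) (by simpa using h2) (by decide) (by decide) (by decide)
      (by decide) (by decide) (by omega) (by simp [hr]; omega)) (by omega)
      (.seq (does_matchKey (w := k') (k := k) (x := .var) (l := L) (by simp) h3 (by simpa using hk)
        hok.2.2 (by simpa using hkL) rfl (by decide) (by decide) (by decide) (by decide) ?_ ?_)
        (by omega) (σ₂ := Function.update (Function.update σ .env L) .envL
          (str (itemWord (p', x', k')).reverse ++ σ .envL)) ?_)) (by omega)
      ((ih (by simp [hL]) (fun e he => hes e (List.mem_cons_of_mem _ he)) (by simpa using hk)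
        (by simpa using hkL) (by simpa using hr) ?_).weaken ?_ ?_)
    · simp; omega
    · simp [itemWord] at hH; omega
    · simp only [hne', decide_false]
      refine .seq (does_clear rfl) (by simp [hr]; omega) (.done (funext fun z => ?_))
      simp only [Function.update_apply]
      cases z <;> simp [hr, itemWord]
    · simp only [length_str, Function.update_self, List.length_append, List.length_reverse]; omega
    · omega
    · funext z
      simp only [Function.update_apply]
      cases z <;> simp

/-- The word popped from the stack `set`. -/
def setWord (ws : List (List Letter)) : List Letter := ws.flatMap (· ++ [.elem])

/-- Searching the word on the stack `key` on the stack `set`. -/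
def findElem : Code K Unit :=
  .iter (fun _ : Unit => (matchKey .set .setL).bind fun r =>
    .pure (if r then .inr () else .inl ())) ()

theorem does_findElem {ws : List (List Letter)} {k : List Letter} {l : List (Sym K)}
    (h : σ .set = str (setWord ws) ++ (str k ++ .inl .elem :: l))
    (hws : ∀ w ∈ ws, (∀ y ∈ w, y.isBit = true) ∧ w ≠ k) (hkb : ∀ y ∈ k, y.isBit = true)
    (hk : σ .key = str k) (hkL : σ .keyL = [])
    (hH : (σ .setL).length + (setWord ws).length + k.length < H) :
    Does n H findElem σ (8 * ((setWord ws).length + k.length + 1)) ()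
      (Function.update (Function.update σ .set l) .setL
        (.inl .elem :: (str (setWord ws ++ k).reverse ++ σ .setL))) := by
  induction ws generalizing σ with
  | nil =>
    refine .last (u := 5 * k.length + 7) (.seq (does_matchKey (w := k) (k := k) (x := .elem) (l := l)
      (by simpa [setWord] using h) hkb hk hkb hkL rfl (by decide) (by decide) (by decide) (by decide)
      ?_ ?_) (by omega) ?_) (by omega)
    · omega
    · omega
    · simp only [decide_true, if_true]
      exact .done (by simp [setWord])
  | cons w ws ih =>
    obtain ⟨hw, hne⟩ := hws _ List.mem_cons_self
    have hsw : setWord (w :: ws) = w ++ .elem :: setWord ws := by simp [setWord]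
    rw [hsw] at h hH ⊢
    simp only [List.length_append, List.length_cons, str_append, List.append_assoc] at h hH ⊢
    refine .next (u := 5 * w.length + 7) (a' := ()) (.seq (does_matchKey (w := w) (k := k)
      (x := .elem) (l := str (setWord ws) ++ (str k ++ .inl .elem :: l)) (by simpa using h) hw hk hkb
      hkL rfl (by decide) (by decide) (by decide) (by decide) (by omega) (by omega)) (by omega) ?_)
      (by omega)
      ((ih (σ := Function.update (Function.update σ .set
        (str (setWord ws) ++ (str k ++ .inl .elem :: l))) .setL
          (.inl .elem :: (str w.reverse ++ σ .setL))) (by simp)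
        (fun e he => hws e (List.mem_cons_of_mem _ he)) (by simpa using hk)
        (by simpa using hkL) ?_).weaken ?_ ?_)
    · simp only [hne, decide_false]; exact .done rfl
    · simp; omega
    · omega
    · funext z
      simp only [Function.update_apply]
      cases z <;> simp

/-- Whether a letter starts an element. -/
def Letter.isElem : Letter → Bool
  | .elem => true
  | _ => false

theorem isElem_of_isBit {y : Letter} (h : y.isBit = true) : y.isElem = false := by
  cases y <;> first | rfl | cases h

/-- Counting the remaining elements on the stack `set`. -/
def countElems : Code K Unit :=
  .iter (fun _ : Unit => (moveUntil Letter.isElem .set .setL none).bind fun t => match t with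
    | .empty => .pure (.inr ())
    | _ => (push .res .one).bind fun _ => .pure (.inl ())) ()

omit [CommSemiring K] in
theorem ones_succ (r : ℕ) (l : List (Sym K)) : ones (r + 1) ++ l = ones r ++ .inl .one :: l := by
  simp [ones, List.replicate_succ']

theorem does_countElems {ws : List (List Letter)} (h : σ .set = str (setWord ws))
    (hws : ∀ w ∈ ws, ∀ y ∈ w, y.isBit = true)
    (hH : (σ .setL).length + (setWord ws).length ≤ H) (hr : (σ .res).length + ws.length ≤ H) :
    Does n H countElems σ (4 * (setWord ws).length + 3) ()
      (Function.update (Function.update (Function.update σ .set []) .setL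
        (str (setWord ws).reverse ++ σ .setL)) .res (ones ws.length ++ σ .res)) := by
  induction ws generalizing σ with
  | nil =>
    refine .last (u := 2) (.seq (does_moveUntil_nil (by simpa [setWord] using h)) le_rfl
      (.done (funext fun z => ?_))) (by simp [setWord])
    simp only [Function.update_apply]
    cases z <;> simp [setWord, h, ones]
  | cons w ws ih =>
    have hsw : setWord (w :: ws) = w ++ .elem :: setWord ws := by simp [setWord]
    rw [hsw] at h hH ⊢
    simp only [List.length_append, List.length_cons, str_append, str_cons] at h hH hr ⊢
    refine .next (u := 2 * w.length + 3) (a' := ()) (.seq (does_moveUntil h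
      (fun y hy => isElem_of_isBit (hws w List.mem_cons_self y hy)) rfl (by decide) (by decide)
      (by omega)) (by omega) (.seq (does_push (by decide) ?_) (by omega) (.done rfl))) (by omega)
      ((ih (by simp) (fun v hv => hws v (List.mem_cons_of_mem _ hv)) ?_ ?_).weaken (by omega) ?_)
    · simp; omega
    · simp; omega
    · simp; omega
    · funext z
      simp only [Function.update_apply]
      cases z <;> simp [ones_succ]

/-- Replacing the word on the stack `res`, the index of an element of the universe, by the rank of
this element in unary. -/
def rankOf : Code K Unit :=
  (moveAll .res .key).bind fun _ => findElem.bind fun _ => countElems.bind fun _ =>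
    (moveAll .setL .set).bind fun _ => clear .key

theorem does_rankOf {ws ws' : List (List Letter)} {k : List Letter}
    (h : σ .set = str (setWord (ws ++ k :: ws')))
    (hws : ∀ w ∈ ws, w ≠ k) (hb : ∀ w ∈ ws ++ k :: ws', ∀ y ∈ w, y.isBit = true)
    (hr : σ .res = str k.reverse) (hk : σ .key = []) (hkL : σ .keyL = []) (hsL : σ .setL = [])
    (hH : (setWord (ws ++ k :: ws')).length ≤ H) :
    Does n H rankOf σ (20 * ((setWord (ws ++ k :: ws')).length + 1)) ()
      (Function.update σ .res (ones ws'.length)) := by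
  have hsw : setWord (ws ++ k :: ws') = setWord ws ++ (k ++ .elem :: setWord ws') := by
    simp [setWord]
  have hlen : ws'.length ≤ (setWord ws').length := by
    clear hws hb h hH hsw
    induction ws' with
    | nil => simp
    | cons w ws ih => simp only [setWord, List.flatMap_cons, List.length_append] at ih ⊢; simp; omega
  rw [hsw] at h hH ⊢
  simp only [List.length_append, List.length_cons, str_append, str_cons] at h hH ⊢
  refine .seq (does_moveAll hr (by decide) (by decide) ?_) ?_
    (.seq (does_findElem (ws := ws) (k := k) (l := str (setWord ws')) (by simpa using h)
      (fun w hw => ⟨hb w (by simp [hw]), hws w hw⟩) (hb k (by simp)) (by simp [hk])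
      (by simpa using hkL) ?_) ?_
    (.seq (does_countElems (ws := ws') (by simp) (fun w hw => hb w (by simp [hw])) ?_ ?_) ?_
    (.seq (does_moveAll rfl (by decide) (by decide) ?_) ?_ ((does_clear rfl).weaken ?_ ?_))))
  · simp [hk]; omega
  · simp; omega
  · simp [hsL]; omega
  · simp; omega
  · simp [hsL]; omega
  · simp; omega
  · simp; omega
  · simp [hsL]; omega
  · simp [hsL]; omega
  · simp [hk, hsL]; omega
  · funext z
    simp only [Function.update_apply]
    cases z <;> simp [hk, h, hsL]

/-- Looking up the variable on the stack `key`: the rank of its value is pushed in unary on the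
stack `res`. -/
def lookup : Code K Unit :=
  findVar.bind fun t => (moveAll .envL .env).bind fun _ => (clear .key).bind fun _ => match t with
    | .letter .elem => rankOf
    | _ => .pure ()

/-- Lookup of a variable whose value is given by its rank. -/
theorem does_lookup_rank {es : List (List Letter × Letter × List Letter)} {r : ℕ} {k : List Letter}
    {l : List (Sym K)}
    (h : σ .env = str (es.flatMap itemWord) ++
      (str (itemWord (List.replicate r .one, .close, k)) ++ l))
    (hes : ∀ e ∈ es, ItemOk e ∧ e.2.2 ≠ k) (hok : ItemOk (List.replicate r .one, .close, k))
    (hk : σ .key = str k) (hkL : σ .keyL = []) (hr : σ .res = []) (heL : σ .envL = [])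
    (hH : (σ .env).length ≤ H) :
    Does n H lookup σ (20 * ((σ .env).length + 1)) ()
      (Function.update (Function.update σ .key []) .res (ones r)) := by
  have hlen : (σ .env).length = (es.flatMap itemWord).length +
      ((itemWord (List.replicate r .one, .close, k)).length + l.length) := by
    rw [h]; simp only [List.length_append, length_str]
  have hkl : (itemWord (List.replicate r .one, .close, k)).length = r + k.length + 2 := by
    simp [itemWord]; omega
  refine .seq (does_findVar h hes hok hk hkL hr (by rw [heL]; simp only [List.length_nil]; omega))
    (by omega) (.seq (does_moveAll rfl (by decide) (by decide) ?_) ?_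
    (.seq (does_clear rfl) ?_ (.done ?_)))
  · simp [heL, -List.length_flatMap]; omega
  · simp [heL, -List.length_flatMap]; omega
  · simp [heL, hk, -List.length_flatMap]; omega
  · funext z
    simp only [Function.update_apply]
    cases z <;> simp [h, heL, ones, str]

/-- Lookup of a variable whose value is given by its binary notation. The elements are on the stack
`set` in decreasing order, so that the rank is the number of elements below the one found. -/
theorem does_lookup_elem {es : List (List Letter × Letter × List Letter)} {v k : List Letter}
    {l : List (Sym K)} {ws ws' : List (List Letter)}
    (h : σ .env = str (es.flatMap itemWord) ++ (str (itemWord (v, .elem, k)) ++ l))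
    (hes : ∀ e ∈ es, ItemOk e ∧ e.2.2 ≠ k) (hok : ItemOk (v, .elem, k))
    (hk : σ .key = str k) (hkL : σ .keyL = []) (hr : σ .res = []) (heL : σ .envL = [])
    (hH : (σ .env).length ≤ H)
    (hs : σ .set = str (setWord (ws ++ v :: ws')))
    (hws : ∀ w ∈ ws, w ≠ v) (hb : ∀ w ∈ ws ++ v :: ws', ∀ y ∈ w, y.isBit = true)
    (hsL : σ .setL = []) (hsH : (σ .set).length ≤ H) :
    Does n H lookup σ (20 * ((σ .env).length + (σ .set).length + 2)) ()
      (Function.update (Function.update σ .key []) .res (ones ws'.length)) := by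
  have hlen : (σ .env).length = (es.flatMap itemWord).length +
      ((itemWord (v, .elem, k)).length + l.length) := by
    rw [h]; simp only [List.length_append, length_str]
  have hkl : (itemWord (v, .elem, k)).length = v.length + k.length + 2 := by
    simp [itemWord]; omega
  have hsl : (σ .set).length = (setWord (ws ++ v :: ws')).length := by rw [hs, length_str]
  refine .seq (does_findVar h hes hok hk hkL hr (by rw [heL]; simp only [List.length_nil]; omega))
    (by omega) (.seq (does_moveAll rfl (by decide) (by decide) ?_) ?_
    (.seq (does_clear rfl) ?_ ((does_rankOf (ws := ws) (k := v) (ws' := ws') ?_ hws hb ?_ ?_ ?_ ?_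
      ?_).weaken ?_ ?_)))
  · simp [heL, -List.length_flatMap]; omega
  · simp [heL, -List.length_flatMap]; omega
  · simp [heL, hk, -List.length_flatMap]; omega
  · simpa using hs
  · simp
  · simp
  · simpa using hkL
  · simpa using hsL
  · omega
  · simp [heL, hk, -List.length_flatMap]; omega
  · funext z
    simp only [Function.update_apply]
    cases z <;> simp [h, heL]

end SemiringFO

namespace SemiringFO

universe u

variable {K : Type u} [CommSemiring K] {n H : ℕ} {σ : State K}

/-! ### Unary arithmetic and access to the values of the literals -/

omit [CommSemiring K] in
theorem ones_add (r s : ℕ) : (ones (r + s) : List (Sym K)) = ones r ++ ones s :=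
  List.replicate_add r s _

omit [CommSemiring K] in
@[simp] theorem length_ones (r : ℕ) : (ones r : List (Sym K)).length = r := List.length_replicate

omit [CommSemiring K] in
@[simp] theorem ones_zero : (ones 0 : List (Sym K)) = [] := rfl

omit [CommSemiring K] in
@[simp] theorem reverse_ones (r : ℕ) : (ones r : List (Sym K)).reverse = ones r :=
  List.reverse_replicate

omit [CommSemiring K] in
theorem ones_cons (r : ℕ) : (ones (r + 1) : List (Sym K)) = .inl .one :: ones r := rfl

/-- Adding the cardinality of the universe to the unary number on a stack. -/
def addCard (i : Stk) : Code K Unit :=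
  (Code.iter (fun _ : Unit => (moveTop .card .cardL).bind fun t => match t with
    | .empty => .pure (.inr ())
    | _ => (push i .one).bind fun _ => .pure (.inl ())) ()).bind fun _ => moveAll .cardL .card

theorem does_addCard {i : Stk} {m : ℕ} (hi : i ≠ .inp) (hi' : i ≠ .card ∧ i ≠ .cardL)
    (hc : σ .card = ones m) (hcL : σ .cardL = []) (hm : m ≤ H) (hH : (σ i).length + m ≤ H) :
    Does n H (addCard i) σ (5 * m + 4) () (Function.update σ i (ones m ++ σ i)) := by
  have key : ∀ (p q : ℕ) (σ' : State K), p + q = m → σ' = Function.update (Function.update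
      (Function.update σ .card (ones p)) .cardL (ones q)) i (ones q ++ σ i) →
      Does n H (Code.iter (fun _ : Unit => (moveTop .card .cardL).bind fun t => match t with
        | .empty => .pure (.inr ())
        | _ => (push i .one).bind fun _ => .pure (.inl ())) ()) σ' (3 * p + 2) ()
        (Function.update (Function.update
          (Function.update σ .card []) .cardL (ones m)) i (ones m ++ σ i)) := by
    intro p
    induction p with
    | zero =>
      intro q σ' hpq hσ'
      refine .last (u := 1) (.seq (does_moveTop_nil ?_) le_rfl (.done ?_)) (by simp)
      · simp [hσ', hi'.1.symm]
      · rw [hσ', ← hpq]; simp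
    | succ p ih =>
      intro q σ' hpq hσ'
      refine .next (u := 2) (a' := ()) (.seq (does_moveTop (x := .inl .one) (l := ones p)
        ?_ (by decide) (by decide) ?_) (by omega) (.seq (does_push hi ?_) (by omega) (.done rfl)))
        (by omega) ((ih (q + 1) _ (by omega) ?_).weaken (by omega) rfl)
      · simp [hσ', hi'.1.symm, ones_cons]
      · simp [hσ', hi'.2.symm]; omega
      · simp [hσ', hi']; omega
      · funext z
        simp only [Function.update_apply, hσ', ones_cons]
        grind
  refine .seq (key m 0 σ (by omega) ?_) (by omega) ((does_moveAll rfl (by decide) (by decide)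
    ?_).weaken ?_ ?_)
  · funext z
    simp only [Function.update_apply, ones_zero]
    grind
  · simp [hi'.1.symm, hi'.2.symm]; omega
  · simp [hi'.2.symm]; omega
  · funext z
    simp only [Function.update_apply]
    split_ifs <;> simp_all

/-- Multiplying the unary number on a stack by the cardinality of the universe. -/
def mulCard (i : Stk) : Code K Unit :=
  (Code.iter (fun _ : Unit => (pop i).bind fun t => match t with
    | .empty => .pure (.inr ())
    | _ => (addCard .tmp).bind fun _ => .pure (.inl ())) ()).bind fun _ => moveAll .tmp i

theorem does_mulCard {i : Stk} {m r : ℕ} (hi : i ≠ .inp) (hi' : i ≠ .card ∧ i ≠ .cardL ∧ i ≠ .tmp)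
    (hc : σ .card = ones m) (hcL : σ .cardL = []) (ht : σ .tmp = []) (h : σ i = ones r)
    (hm : m ≤ H) (hH : r * m ≤ H) :
    Does n H (mulCard i) σ (7 * (r * m + r + 1)) () (Function.update σ i (ones (r * m))) := by
  have key : ∀ (p q : ℕ) (σ' : State K), p * m + q = r * m → σ' = Function.update (Function.update
      σ i (ones p)) .tmp (ones q) →
      Does n H (Code.iter (fun _ : Unit => (pop i).bind fun t => match t with
        | .empty => .pure (.inr ())
        | _ => (addCard .tmp).bind fun _ => .pure (.inl ())) ()) σ' (5 * (p * m) + 6 * p + 2) ()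
        (Function.update (Function.update σ i []) .tmp (ones (r * m))) := by
    intro p
    induction p with
    | zero =>
      intro q σ' hpq hσ'
      refine .last (u := 1) (.seq does_pop le_rfl ?_) (by simp)
      rw [hσ']
      simp only [hi'.2.2, ne_eq, not_false_eq_true, Function.update_of_ne, Function.update_self,
        ones_zero, topOf]
      refine .done (funext fun z => ?_)
      rw [← hpq, Nat.zero_mul, Nat.zero_add]
      simp only [Function.update_apply]
      grind
    | succ p ih =>
      intro q σ' hpq hσ'
      simp only [Nat.succ_mul] at hpq ⊢
      refine .next (u := 5 * m + 5) (a' := ()) (.seq does_pop (by omega)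
        (σ₂ := Function.update (Function.update σ i (ones p)) .tmp (ones (m + q))) ?_) (by omega)
        ((ih (m + q) _ (by omega) rfl).weaken (by omega) rfl)
      rw [hσ']
      simp only [hi'.2.2, ne_eq, not_false_eq_true, Function.update_of_ne, Function.update_self,
        ones_cons, topOf]
      refine .seq (does_addCard (m := m) (by decide) (by decide) ?_ ?_ hm ?_) (by omega)
        (.done (funext fun z => ?_))
      · simp [hi'.1.symm, hc]
      · simp [hi'.2.1.symm, hcL]
      · simp [hi'.2.2.symm]; omega
      · simp only [Function.update_apply, ones_add]
        grind
  refine .seq (key r 0 σ (by omega) ?_) (by omega) ((does_moveAll rfl hi'.2.2.symm hi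
    ?_).weaken ?_ ?_)
  · funext z
    simp only [Function.update_apply, ones_zero]
    grind
  · simp [hi'.2.2]; omega
  · simp; omega
  · funext z
    simp only [Function.update_apply]
    split_ifs <;> simp_all

/-- Doubling the unary number on the stack `cnt`. -/
def doubleCnt : Code K Unit :=
  (Code.iter (fun _ : Unit => (pop .cnt).bind fun t => match t with
    | .empty => .pure (.inr ())
    | _ => (push .tmp .one).bind fun _ => (push .tmp .one).bind fun _ => .pure (.inl ())) ()).bind
  fun _ => moveAll .tmp .cnt

theorem does_doubleCnt {r : ℕ} (ht : σ .tmp = []) (h : σ .cnt = ones r) (hH : 2 * r ≤ H) :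
    Does n H doubleCnt σ (8 * r + 4) () (Function.update σ .cnt (ones (2 * r))) := by
  have key : ∀ (p q : ℕ) (σ' : State K), 2 * p + q = 2 * r → σ' = Function.update (Function.update
      σ .cnt (ones p)) .tmp (ones q) →
      Does n H (Code.iter (fun _ : Unit => (pop .cnt).bind fun t => match t with
        | .empty => .pure (.inr ())
        | _ => (push .tmp .one).bind fun _ => (push .tmp .one).bind fun _ => .pure (.inl ())) ())
        σ' (4 * p + 2) ()
        (Function.update (Function.update σ .cnt []) .tmp (ones (2 * r))) := by
    intro p
    induction p with
    | zero =>
      intro q σ' hpq hσ'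
      refine .last (u := 1) (.seq does_pop le_rfl ?_) (by simp)
      subst hσ'
      refine .done (funext fun z => ?_)
      rw [← hpq]
      simp only [Function.update_apply]
      cases z <;> simp
    | succ p ih =>
      intro q σ' hpq hσ'
      refine .next (u := 3) (a' := ()) (.seq does_pop (by omega)
        (σ₂ := Function.update (Function.update σ .cnt (ones p)) .tmp (ones (q + 2))) ?_) (by omega)
        ((ih (q + 2) _ (by omega) rfl).weaken (by omega) rfl)
      subst hσ'
      refine .seq (does_push (by decide) ?_) (by omega) (.seq (does_push (by decide) ?_) (by omega)
        (.done (funext fun z => ?_)))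
      · simp; omega
      · simp; omega
      · simp only [Function.update_apply]
        cases z <;> simp [ones_cons]
  refine .seq (key r 0 σ (by omega) ?_) (by omega) ((does_moveAll rfl (by decide) (by decide)
    ?_).weaken ?_ ?_)
  · funext z
    simp only [Function.update_apply]
    cases z <;> simp [ht, h]
  · simp; omega
  · simp; omega
  · funext z
    simp only [Function.update_apply]
    cases z <;> simp [ht]

/-- Converting the number on the stack `key` from binary to unary. The most significant digit is on
top. -/
def toUnary : Code K Unit :=
  .iter (fun _ : Unit => (pop .key).bind fun t => match t with
    | .letter .one => doubleCnt.bind fun _ => (push .cnt .one).bind fun _ => .pure (.inl ())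
    | .letter .zero => doubleCnt.bind fun _ => .pure (.inl ())
    | _ => .pure (.inr ())) ()

theorem encNat_eq {N : ℕ} (hN : N ≠ 0) :
    encNat N = (if N % 2 = 1 then Letter.one else .zero) :: encNat (N / 2) := by
  unfold encNat
  conv_lhs => rw [← Nat.bit_bodd_div2 N]
  rw [Nat.bits_append_bit _ _ (by
    intro h
    rw [Nat.div2_val] at h
    have : N = 1 := by omega
    subst this
    rfl)]
  rw [List.map_cons, Nat.div2_val, Nat.mod_two_of_bodd]
  cases N.bodd <;> simp

/-- After the digits of `N` have been read, the stack `cnt` holds `N`. As the most significant digit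
is on top, the last digit read is the parity of `N`, and before it `N / 2` has been read. -/
theorem does_toUnary_loop {N u : ℕ} {k : List Letter} {σ' : State K} (ht : σ .tmp = [])
    (h : σ .key = str ((encNat N).reverse ++ k)) (hc : σ .cnt = []) (hH : N ≤ H)
    (hd : Does n H toUnary (Function.update (Function.update σ .key (str k)) .cnt (ones N)) u () σ') :
    Does n H toUnary σ ((encNat N).length * (8 * N + 8) + u) () σ' := by
  induction N using Nat.strong_induction_on generalizing k u with
  | _ N ih =>
    rcases Nat.eq_zero_or_pos N with rfl | hN
    · rw [show encNat 0 = [] from by simp [encNat]] at h ⊢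
      refine Does.weaken (u := u) ?_ (by simp) rfl
      convert hd using 1
      funext z
      simp only [Function.update_apply]
      cases z <;> simp [h, hc]
    · rw [encNat_eq (by omega)] at h ⊢
      rw [List.reverse_cons, List.append_assoc, List.singleton_append] at h
      have hmul : (encNat (N / 2)).length * (8 * (N / 2) + 8) ≤ (encNat (N / 2)).length * (8 * N + 8) :=
        Nat.mul_le_mul_left _ (by omega)
      rw [List.length_cons, Nat.succ_mul]
      refine (ih (N / 2) (by omega) (u := 8 * N + 8 + u) h (by omega) ?_).weaken (by omega) rfl
      refine .next (u := 8 * (N / 2) + 6) (a' := ()) (.seq does_pop (by omega)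
        (σ₂ := Function.update (Function.update σ .key (str k)) .cnt (ones N)) ?_) (by omega)
        (hd.weaken (by omega) rfl)
      simp only [Function.update_of_ne, Function.update_self, ne_eq, reduceCtorEq,
        not_false_eq_true, str_cons, topOf, List.tail_cons]
      have hdbl : ∀ b : Letter, Does n H doubleCnt (Function.update (Function.update
          (Function.update σ .key (.inl b :: str k)) .cnt (ones (N / 2))) .key (str k))
          (8 * (N / 2) + 4) ()
          (Function.update (Function.update σ .key (str k)) .cnt (ones (2 * (N / 2)))) := by
        intro b
        refine (does_doubleCnt (r := N / 2) (by simp [ht]) (by simp) (by omega)).weaken le_rfl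
          (funext fun z => ?_)
        simp only [Function.update_apply]
        cases z <;> simp
      split_ifs with hpar
      · refine .seq (hdbl _) (by omega) (.seq (does_push (by decide) ?_) (by omega) (.done ?_))
        · simp; omega
        · funext z
          simp only [Function.update_apply]
          cases z <;> simp
          rw [← ones_cons]; congr 1; omega
      · refine .seq (hdbl _) (by omega) (.done (funext fun z => ?_))
        simp only [Function.update_apply]
        cases z <;> simp
        congr 1; omega

theorem does_toUnary {N : ℕ} (ht : σ .tmp = []) (h : σ .key = str (encNat N).reverse)
    (hc : σ .cnt = []) (hH : N ≤ H) :
    Does n H toUnary σ ((encNat N).length * (8 * N + 8) + 2) ()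
      (Function.update (Function.update σ .key []) .cnt (ones N)) := by
  refine does_toUnary_loop ht (k := []) (by simpa using h) hc hH
    (.last (u := 1) (.seq does_pop le_rfl ?_) le_rfl)
  refine .done (funext fun z => ?_)
  simp only [Function.update_apply]
  cases z <;> simp

end SemiringFO

namespace SemiringFO

universe u

variable {K : Type u} [CommSemiring K] {n H : ℕ} {σ : State K}

/-- Reading the arity of the symbol on top of the stack `voc` and computing the number of its facts
in unary on the stack `siz`. -/
def symSize : Code K Unit :=
  (moveTop .voc .vocL).bind fun _ => (addCard .siz).bind fun _ =>
    Code.iter (fun first : Bool => (moveTop .voc .vocL).bind fun t => match t with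
      | .letter .var => if first then .pure (.inl false) else
          (mulCard .siz).bind fun _ => .pure (.inl false)
      | .empty => .pure (.inr ())
      | _ => (moveTop .vocL .voc).bind fun _ => .pure (.inr ())) true

/-- The number of values that are listed for the facts of a symbol of arity `k` over a universe
with `m` elements. -/
def blockSize (m k : ℕ) : ℕ := m ^ max k 1

/-- The word that describes a symbol in the encoding of a vocabulary. -/
def symWord (k : ℕ) : List Letter := .rel :: List.replicate k .var

theorem encVocabulary_cons (k : ℕ) (τ : Vocabulary) :
    encVocabulary (k :: τ) = symWord k ++ encVocabulary τ := rfl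

omit [CommSemiring K] in
theorem str_replicate_append (k : ℕ) (y : Letter) (l : List (Sym K)) :
    str (List.replicate k y) ++ .inl y :: l = .inl y :: (str (List.replicate k y) ++ l) := by
  induction k with
  | zero => rfl
  | succ k ih => simp only [List.replicate_succ, str_cons, List.cons_append, ih]

/-- The assumption `m = 1 → r = 1` makes the cost of multiplications with `1` proportional to the
arity. -/
theorem does_symSize_loop {m r k : ℕ} {τ : Vocabulary}
    (hc : σ .card = ones m) (hcL : σ .cardL = []) (ht : σ .tmp = []) (hs : σ .siz = ones r)
    (h : σ .voc = str (List.replicate k .var ++ encVocabulary τ)) (hm0 : 0 < m)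
    (hm : m ≤ H) (hr : m = 1 → r = 1) (hH : r * m ^ k ≤ H)
    (hvH : (σ .vocL).length + (σ .voc).length ≤ H) :
    Does n H (Code.iter (fun first : Bool => (moveTop .voc .vocL).bind fun t => match t with
      | .letter .var => if first then .pure (.inl false) else
          (mulCard .siz).bind fun _ => .pure (.inl false)
      | .empty => .pure (.inr ())
      | _ => (moveTop .vocL .voc).bind fun _ => .pure (.inr ())) false) σ
      (30 * (r * m ^ k) - 30 * r + 30 * (k + 1)) ()
      (Function.update (Function.update (Function.update σ .voc (str (encVocabulary τ))) .vocL
        (str (List.replicate k .var) ++ σ .vocL)) .siz (ones (r * m ^ k))) := by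
  induction k generalizing σ r with
  | zero =>
    simp only [List.replicate_zero, List.nil_append, pow_zero, mul_one] at h ⊢
    cases τ with
    | nil =>
      refine .last (u := 1) (.seq (does_moveTop_nil (by simpa [encVocabulary] using h)) le_rfl
        (.done (funext fun z => ?_))) (by omega)
      simp only [Function.update_apply]
      cases z <;> simp [h, hs]
    | cons k τ =>
      rw [encVocabulary_cons] at h ⊢
      rw [h] at hvH
      refine .last (u := 2) (.seq (does_moveTop (x := .inl .rel)
        (l := str (List.replicate k .var ++ encVocabulary τ)) (by rw [h]; rfl)
        (by decide) (by decide) (by simp [symWord] at hvH; omega)) (by omega) (.seq (does_moveTop (x := .inl .rel)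
        (l := σ .vocL) (by simp) (by decide) (by decide) ?_) (by omega)
        (.done (funext fun z => ?_)))) (by omega)
      · simp [symWord] at hvH ⊢; omega
      · simp only [Function.update_apply]
        cases z <;> simp [hs, symWord]
  | succ k ih =>
    simp only [List.replicate_succ, List.cons_append, pow_succ] at h hH ⊢
    have e : r * (m ^ k * m) = r * m * m ^ k := by ring
    rw [e] at hH ⊢
    have hpos : 1 ≤ m ^ k := Nat.one_le_pow _ _ hm0
    have hle : r * m ≤ r * m * m ^ k := Nat.le_mul_of_pos_right _ hpos
    have hcost : 7 * (r * m) + 7 * r + 30 * r ≤ 30 * (r * m) + 14 := by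
      rcases Nat.lt_or_ge m 2 with h1 | h1
      · obtain rfl : m = 1 := by omega
        rw [hr rfl]
      · have : r * 2 ≤ r * m := Nat.mul_le_mul_left _ h1
        omega
    refine .next (u := 7 * (r * m + r + 1) + 1) (a' := false) (.seq (does_moveTop (x := .inl .var)
      (l := str (List.replicate k .var ++ encVocabulary τ)) (by rw [h]; rfl) (by decide) (by decide)
      (by rw [h] at hvH; simp at hvH; omega)) (by omega) (.seq (does_mulCard (r := r) (m := m) (by decide) (by decide)
        (by simpa using hc) (by simpa using hcL) (by simpa using ht) (by simpa using hs) hm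
        (by omega)) (by omega) (.done rfl))) (by omega)
      ((ih (r := r * m) (by simpa using hc) (by simpa using hcL) (by simpa using ht) (by simp)
        (by simp) ?_ hH ?_).weaken (by omega) ?_)
    · intro h1; rw [hr h1, h1]
    · rw [h] at hvH; simp at hvH ⊢; omega
    · funext z
      simp only [Function.update_apply]
      cases z <;> simp [str_replicate_append]

theorem does_symSize {m k : ℕ} {τ : Vocabulary}
    (hc : σ .card = ones m) (hcL : σ .cardL = []) (ht : σ .tmp = []) (hs : σ .siz = [])
    (h : σ .voc = str (encVocabulary (k :: τ))) (hm0 : 0 < m) (hH : blockSize m k ≤ H)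
    (hvH : (σ .vocL).length + (σ .voc).length ≤ H) :
    Does n H symSize σ (40 * (blockSize m k + k + 1)) ()
      (Function.update (Function.update (Function.update σ .voc (str (encVocabulary τ))) .vocL
        (str (symWord k).reverse ++ σ .vocL)) .siz (ones (blockSize m k))) := by
  have hmb : m ≤ blockSize m k := by
    unfold blockSize
    exact Nat.le_self_pow (by omega) m
  rw [encVocabulary_cons] at h
  have hlen : (σ .voc).length = k + 1 + (encVocabulary τ).length := by
    rw [h]; simp [symWord]; omega
  have hm : m ≤ H := hmb.trans hH
  refine .seq (does_moveTop (x := .inl .rel) (l := str (List.replicate k .var ++ encVocabulary τ))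
    (by rw [h]; rfl) (by decide) (by decide) (by omega)) (by omega)
    (.seq (does_addCard (m := m) (by decide) (by decide) (by simpa using hc) (by simpa using hcL) hm
      (by simp [hs]; omega)) (by omega) ?_)
  cases k with
  | zero =>
    -- a symbol of arity `0` is treated as one of arity `1`
    have hb : blockSize m 0 = m := by simp [blockSize]
    cases τ with
    | nil =>
      refine .last (u := 1) (.seq (does_moveTop_nil (by simp [encVocabulary])) le_rfl
        (.done (funext fun z => ?_))) (by omega)
      simp only [Function.update_apply]
      cases z <;> simp [hs, hb, symWord, encVocabulary]
    | cons k τ =>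
      rw [encVocabulary_cons] at hlen ⊢
      refine .last (u := 2) (.seq (does_moveTop (x := .inl .rel)
        (l := str (List.replicate k .var ++ encVocabulary τ)) (by simp [symWord])
        (by decide) (by decide) ?_) (by omega) (.seq (does_moveTop (x := .inl .rel)
        (l := .inl .rel :: σ .vocL) (by simp) (by decide) (by decide) ?_) (by omega)
        (.done (funext fun z => ?_)))) (by omega)
      · simp [symWord] at hlen ⊢; omega
      · simp [symWord] at hlen ⊢; omega
      · simp only [Function.update_apply]
        cases z <;> simp [hs, hb, symWord]
  | succ k =>
    have hb : blockSize m (k + 1) = m * m ^ k := by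
      simp [blockSize, pow_succ, mul_comm]
    rw [hb] at hH hmb ⊢
    refine .next (u := 1) (a' := false) (.seq (does_moveTop (x := .inl .var)
      (l := str (List.replicate k .var ++ encVocabulary τ)) (by simp [List.replicate_succ])
      (by decide) (by decide) ?_) (by omega) (.done rfl)) (by omega)
      ((does_symSize_loop (r := m) (m := m) (k := k) (τ := τ) (by simpa using hc)
        (by simpa using hcL) (by simpa using ht) (by simp [hs]) (by simp) hm0 hm (fun h => h) hH
        ?_).weaken (by omega) ?_)
    · simp; omega
    · simp; omega
    · funext z
      simp only [Function.update_apply]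
      cases z <;> simp [symWord, List.replicate_succ, str_replicate_append]

/-- Skipping as many values as the unary number on the stack `c` says, or twice as many. -/
def skipBlock (c : Stk) (twice : Bool) : Code K Unit :=
  .iter (fun _ : Unit => (pop c).bind fun t => match t with
    | .empty => .pure (.inr ())
    | _ => (moveTop .val .valL).bind fun _ =>
      if twice then (moveTop .val .valL).bind fun _ => .pure (.inl ()) else .pure (.inl ())) ()

theorem does_skipBlock {c : Stk} {twice : Bool} {r p : ℕ} {v : List (Sym K)}
    (hc' : c ≠ .val ∧ c ≠ .valL) (hc : σ c = ones r) (h : σ .val = v)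
    (hp : p = if twice then 2 * r else r) (hv : p ≤ v.length)
    (hH : (σ .valL).length + v.length ≤ H) :
    Does n H (skipBlock c twice) σ (4 * r + 2) () (Function.update (Function.update
      (Function.update σ c []) .val (v.drop p)) .valL ((v.take p).reverse ++ σ .valL)) := by
  induction r generalizing σ v p with
  | zero =>
    obtain rfl : p = 0 := by rw [hp]; cases twice <;> rfl
    refine .last (u := 1) (.seq does_pop le_rfl ?_) (by omega)
    rw [hc]
    refine .done (funext fun z => ?_)
    simp only [Function.update_apply, List.drop_zero, List.take_zero, ones_zero, List.tail_nil]
    grind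
  | succ r ih =>
    obtain ⟨hcv, hcv'⟩ := hc'
    cases v with
    | nil => cases twice <;> simp at hp hv <;> omega
    | cons x v =>
      simp only [List.length_cons] at hH hv
      cases twice with
      | false =>
        simp only [Bool.false_eq_true, if_false] at hp ih
        refine .next (u := 2) (a' := ()) (.seq does_pop (by omega) (σ₂ := Function.update
          (Function.update (Function.update σ c (ones r)) .val v) .valL (x :: σ .valL)) ?_) (by omega)
          ((ih (p := r) (v := v) (by simp [hcv, hcv']) (by simp) rfl (by omega)
            (by simp; omega)).weaken (by omega) ?_)
        · rw [hc]
          refine .seq (does_moveTop (x := x) (l := v) (by simp [hcv.symm, h]) (by decide) (by decide)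
            (by simp [hcv'.symm]; omega)) le_rfl (.done (funext fun z => ?_))
          simp only [Function.update_apply, ones_cons]
          grind
        · subst hp
          funext z
          simp only [Function.update_apply]
          split_ifs <;> simp
      | true =>
        simp only [if_true] at hp ih
        cases v with
        | nil => simp at hv; omega
        | cons y v =>
          simp only [List.length_cons] at hH hv
          refine .next (u := 3) (a' := ()) (.seq does_pop (by omega) (σ₂ := Function.update
            (Function.update (Function.update σ c (ones r)) .val v) .valL (y :: x :: σ .valL)) ?_)
            (by omega) ((ih (p := 2 * r) (v := v) (by simp [hcv, hcv']) (by simp) rfl (by omega)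
              (by simp; omega)).weaken (by omega) ?_)
          · rw [hc]
            refine .seq (does_moveTop (x := x) (l := y :: v) (by simp [hcv.symm, h]) (by decide)
              (by decide) (by simp [hcv'.symm]; omega)) (by omega) (.seq (does_moveTop (x := y)
                (l := v) (by simp) (by decide) (by decide) (by simp [hcv'.symm]; omega)) (by omega)
              (.done (funext fun z => ?_)))
            simp only [Function.update_apply, ones_cons]
            grind
          · subst hp
            rw [show 2 * (r + 1) = 2 * r + 1 + 1 by ring]
            funext z
            simp only [Function.update_apply]
            split_ifs <;> simp

/-- The number of values that precede the values of the facts of a symbol. -/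
def offset (m : ℕ) (τ : Vocabulary) : ℕ := (τ.map fun k => 2 * blockSize m k).sum

/-- Skipping the values of as many symbols as the unary number on the stack `cnt` says. -/
def skipSyms : Code K Unit :=
  .iter (fun _ : Unit => (pop .cnt).bind fun t => match t with
    | .empty => .pure (.inr ())
    | _ => symSize.bind fun _ => (skipBlock .siz true).bind fun _ => .pure (.inl ())) ()

theorem does_skipSyms {m : ℕ} {τ τ' : Vocabulary} {v : List (Sym K)}
    (hc : σ .card = ones m) (hcL : σ .cardL = []) (ht : σ .tmp = []) (hs : σ .siz = [])
    (h : σ .voc = str (encVocabulary (τ ++ τ'))) (hn : σ .cnt = ones τ.length) (hm0 : 0 < m)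
    (hv : σ .val = v) (hvl : offset m τ ≤ v.length)
    (hH : (σ .valL).length + v.length ≤ H) (hvH : (σ .vocL).length + (σ .voc).length ≤ H) :
    Does n H skipSyms σ (50 * (offset m τ + (encVocabulary τ).length) + 2) ()
      (Function.update (Function.update (Function.update (Function.update (Function.update σ
        .voc (str (encVocabulary τ'))) .vocL (str (encVocabulary τ).reverse ++ σ .vocL))
        .val (v.drop (offset m τ))) .valL ((v.take (offset m τ)).reverse ++ σ .valL)) .cnt []) := by
  induction τ generalizing σ v with
  | nil =>
    refine .last (u := 1) (.seq does_pop le_rfl ?_) (by simp [offset])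
    rw [hn]
    refine .done (funext fun z => ?_)
    simp only [Function.update_apply]
    cases z <;> simp [h, hv, offset, encVocabulary]
  | cons k τ ih =>
    have ho : offset m (k :: τ) = 2 * blockSize m k + offset m τ := by simp [offset]
    have hl : (encVocabulary (k :: τ)).length = k + 1 + (encVocabulary τ).length := by
      rw [encVocabulary_cons]; simp [symWord]; omega
    have hl' : (encVocabulary (k :: (τ ++ τ'))).length = k + 1 + (encVocabulary (τ ++ τ')).length := by
      rw [encVocabulary_cons]; simp [symWord]; omega
    rw [ho] at hvl ⊢
    rw [List.cons_append] at h
    rw [h, length_str] at hvH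
    rw [hl]
    refine .next (u := 1 + 40 * (blockSize m k + k + 1) + (4 * blockSize m k + 2)) (a' := ())
      (.seq does_pop (by omega) (σ₂ := Function.update (Function.update (Function.update
        (Function.update (Function.update σ .voc (str (encVocabulary (τ ++ τ')))) .vocL
          (str (symWord k).reverse ++ σ .vocL)) .val (v.drop (2 * blockSize m k))) .valL
          ((v.take (2 * blockSize m k)).reverse ++ σ .valL)) .cnt (ones τ.length)) ?_) (by omega)
      ((ih (v := v.drop (2 * blockSize m k)) (by simpa using hc) (by simpa using hcL)
        (by simpa using ht) (by simpa using hs) (by simp) (by simp) (by simp)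
        (by rw [List.length_drop]; omega) ?_ ?_).weaken (by omega) ?_)
    · rw [hn, List.length_cons, ones_cons]
      refine .seq (does_symSize (m := m) (k := k) (τ := τ ++ τ') (by simpa using hc)
        (by simpa using hcL) (by simpa using ht) (by simpa using hs) (by simpa using h) hm0 (by omega)
        ?_) (by omega) (.seq (does_skipBlock (r := blockSize m k) (p := 2 * blockSize m k) (v := v)
          (by decide) (by simp) (by simpa using hv) rfl (by omega) ?_) (by omega)
          (.done (funext fun z => ?_)))
      · simp only [Function.update_of_ne, ne_eq, reduceCtorEq, not_false_eq_true, h, length_str]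
        omega
      · simpa using hH
      · simp only [Function.update_apply]
        cases z <;> simp [hs]
    · simp; omega
    · simp [symWord]; omega
    · have hv' : ((v.drop (2 * blockSize m k)).take (offset m τ)).reverse ++
          ((v.take (2 * blockSize m k)).reverse ++ σ .valL) =
          (v.take (2 * blockSize m k + offset m τ)).reverse ++ σ .valL := by
        rw [← List.append_assoc, ← List.reverse_append, ← List.take_add]
      funext z
      simp only [Function.update_apply]
      cases z <;> simp [encVocabulary_cons, hv']

/-- Skipping the values of the facts of the next symbol if a negated fact is to be read. -/
def skipFacts (neg : Bool) : Code K Unit :=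
  if neg then symSize.bind fun _ => skipBlock .siz false else .pure ()

theorem does_skipFacts {neg : Bool} {m k : ℕ} {τ : Vocabulary} {v : List (Sym K)} {w : List Letter}
    (hc : σ .card = ones m) (hcL : σ .cardL = []) (ht : σ .tmp = []) (hs : σ .siz = [])
    (h : σ .voc = str (encVocabulary (k :: τ))) (hL : σ .vocL = str w) (hm0 : 0 < m)
    (hv : σ .val = v) (hvl : (if neg then blockSize m k else 0) ≤ v.length)
    (hH : (σ .valL).length + v.length ≤ H) (hvH : (σ .vocL).length + (σ .voc).length ≤ H) :
    ∃ w₁ w₂, w₁.reverse ++ w₂ = w.reverse ++ encVocabulary (k :: τ) ∧ Does n H (skipFacts neg) σ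
      (44 * (if neg then blockSize m k else 0) + 40 * (k + 1) + 2) ()
      (Function.update (Function.update (Function.update (Function.update σ .voc (str w₂)) .vocL
        (str w₁)) .val (v.drop (if neg then blockSize m k else 0))) .valL
          ((v.take (if neg then blockSize m k else 0)).reverse ++ σ .valL)) := by
  cases neg with
  | false =>
    refine ⟨w, encVocabulary (k :: τ), rfl, .done (funext fun z => ?_)⟩
    simp only [Function.update_apply]
    cases z <;> simp [h, hv, hL]
  | true =>
    simp only [if_true] at hvl ⊢
    refine ⟨(symWord k).reverse ++ w, encVocabulary τ, by simp [encVocabulary_cons],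
      .seq (does_symSize hc hcL ht hs h hm0 (by omega) hvH) (by omega)
      ((does_skipBlock (r := blockSize m k) (p := blockSize m k) (v := v) (by decide) (by simp)
        (by simpa using hv) rfl hvl (by simpa using hH)).weaken (by omega) (funext fun z => ?_))⟩
    simp only [Function.update_apply]
    cases z <;> simp [hs, hL]

/-- Pushing the value of a literal on the stack `vs`. The number of the symbol is on the stack `cnt`
and the number of the tuple on the stack `idx`, both in unary. -/
def fetch (neg : Bool) : Code K Unit :=
  skipSyms.bind fun _ => (skipFacts neg).bind fun _ => (skipBlock .idx false).bind fun _ =>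
    (copyTop .val .vs).bind fun _ => (moveAll .valL .val).bind fun _ => moveAll .vocL .voc

theorem does_fetch {neg : Bool} {m k r : ℕ} {τ₁ τ₂ : Vocabulary} {v : List (Sym K)} {x : Sym K}
    (hc : σ .card = ones m) (hcL : σ .cardL = []) (ht : σ .tmp = []) (hs : σ .siz = [])
    (h : σ .voc = str (encVocabulary (τ₁ ++ k :: τ₂))) (hL : σ .vocL = []) (hm0 : 0 < m)
    (hv : σ .val = v) (hvL : σ .valL = []) (hn : σ .cnt = ones τ₁.length) (hi : σ .idx = ones r)
    (hx : v[offset m τ₁ + (if neg then blockSize m k else 0) + r]? = some x)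
    (hH : v.length ≤ H) (hvH : (σ .voc).length ≤ H) (hsH : (σ .vs).length < H) :
    Does n H (fetch neg) σ (60 * (v.length + (σ .voc).length) + 20) ()
      (Function.update (Function.update (Function.update σ .vs (x :: σ .vs)) .idx []) .cnt []) := by
  obtain ⟨hP, hx'⟩ := List.getElem?_eq_some_iff.1 hx
  have happ : encVocabulary (τ₁ ++ k :: τ₂) = encVocabulary τ₁ ++ encVocabulary (k :: τ₂) := by
    simp [encVocabulary]
  have hlen : (σ .voc).length = (encVocabulary τ₁).length + (encVocabulary (k :: τ₂)).length := by
    rw [h, happ]; simp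
  have hk : k + 1 ≤ (encVocabulary (k :: τ₂)).length := by
    rw [encVocabulary_cons]; simp [symWord]
  obtain ⟨w₁, w₂, hw, hd⟩ := does_skipFacts (n := n) (H := H) (neg := neg) (m := m) (k := k) (τ := τ₂)
    (v := v.drop (offset m τ₁)) (w := (encVocabulary τ₁).reverse)
    (σ := Function.update (Function.update (Function.update (Function.update (Function.update σ
        .voc (str (encVocabulary (k :: τ₂)))) .vocL (str (encVocabulary τ₁).reverse ++ σ .vocL))
        .val (v.drop (offset m τ₁))) .valL ((v.take (offset m τ₁)).reverse ++ σ .valL)) .cnt [])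
    (by simpa using hc) (by simpa using hcL) (by simpa using ht) (by simpa using hs) (by simp)
    (by simp [hL]) hm0 (by simp) (by simp; omega) (by simp [hvL]; omega) (by simp [hL]; omega)
  have hwl : w₁.length + w₂.length = (σ .voc).length := by
    have := congrArg List.length hw
    simp at this
    omega
  generalize hb : (if neg then blockSize m k else 0) = b at *
  refine .seq (does_skipSyms (τ := τ₁) (τ' := k :: τ₂) hc hcL ht hs h hn hm0 hv (by omega)
    (by rw [hvL]; simpa using hH) (by rw [hL]; simpa using hvH)) (by omega) (.seq hd (by omega)
    (.seq (does_skipBlock (r := r) (p := r) (v := v.drop (offset m τ₁ + b)) (by decide)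
      (by simpa using hi) (by simp [List.drop_drop]) rfl (by simp; omega) ?_) (by omega)
    (.seq (does_copyTop (x := x) (l := v.drop (offset m τ₁ + b + r + 1)) ?_ (by decide) (by decide)
      ?_) (by omega)
    (.seq (does_moveAll (l := (v.take (offset m τ₁ + b + r)).reverse) ?_ (by decide) (by decide)
      ?_) ?_
    ((does_moveAll (l := str w₁) ?_ (by decide) (by decide) ?_).weaken ?_ ?_)))))
  · simp [hvL]; omega
  · simp only [Function.update_self, ne_eq, reduceCtorEq, not_false_eq_true, Function.update_of_ne,
      List.drop_drop]
    rw [List.drop_eq_getElem_cons hP, hx']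
  · simpa using hsH
  · simp [hvL, List.take_add]
  · simp; omega
  · simp; omega
  · simp
  · simp; omega
  · simp; omega
  · funext z
    simp only [Function.update_apply]
    cases z <;> simp [hL, hvL, h, happ, hv, -str_append]
    rw [← str_append, hw]; simp

/-- Appending the digit on the stack `res` to the number on the stack `idx`, in the positional
system whose base is the cardinality of the universe. -/
def pushDigit : Code K Unit := (mulCard .idx).bind fun _ => moveAll .res .idx

theorem does_pushDigit {m r d : ℕ} (hc : σ .card = ones m) (hcL : σ .cardL = []) (ht : σ .tmp = [])
    (h : σ .idx = ones r) (hd : σ .res = ones d) (hm : m ≤ H) (hH : r * m + d ≤ H) :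
    Does n H pushDigit σ (7 * (r * m + r + 1) + (2 * d + 2)) ()
      (Function.update (Function.update σ .res []) .idx (ones (r * m + d))) := by
  refine .seq (does_mulCard (r := r) (m := m) (by decide) (by decide) hc hcL ht h hm (by omega))
    (by omega) ((does_moveAll (l := ones d) (by simpa using hd) (by decide) (by decide)
      (by simp; omega)).weaken (by simp) (funext fun z => ?_))
  simp only [Function.update_apply]
  cases z <;> simp [Nat.add_comm (r * m) d, ones_add]

end SemiringFO

namespace SemiringFO

universe u

variable {K : Type u} {n H : ℕ} {σ : State K}

/-! ### Positions in the encodings -/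

theorem length_elements (A : Finset ℕ) : (elements A).length = A.card := by
  simp [elements]

theorem nodup_elements (A : Finset ℕ) : (elements A).Nodup :=
  Finset.sort_nodup _ _

theorem mem_elements {A : Finset ℕ} (a : A) : a ∈ elements A := by
  simp [elements]

/-- The number of elements of `A` that are smaller than `a`. -/
noncomputable def rank {A : Finset ℕ} (a : A) : ℕ := (elements A).idxOf a

theorem rank_lt {A : Finset ℕ} (a : A) : rank a < A.card := by
  rw [← length_elements]; exact List.idxOf_lt_length_of_mem (mem_elements a)

theorem elements_split {A : Finset ℕ} (a : A) :
    ∃ l₁ l₂, elements A = l₁ ++ a :: l₂ ∧ l₁.length = rank a ∧ a ∉ l₂ := by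
  refine ⟨(elements A).take (rank a), (elements A).drop (rank a + 1), ?_, ?_, ?_⟩
  · have h : rank a < (elements A).length := by rw [length_elements]; exact rank_lt a
    conv_lhs => rw [← List.take_append_drop (rank a) (elements A), List.drop_eq_getElem_cons h]
    simp [rank]
  · rw [List.length_take, length_elements]; exact min_eq_left (rank_lt a).le
  · have h : rank a < (elements A).length := by rw [length_elements]; exact rank_lt a
    have h1 := (nodup_elements A).sublist (List.drop_sublist (rank a) _)
    rw [List.drop_eq_getElem_cons h] at h1
    have h2 := (List.nodup_cons.1 h1).1
    simpa [rank] using h2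

theorem rank_inj {A : Finset ℕ} {a b : A} (h : rank a = rank b) : a = b :=
  (List.idxOf_inj (mem_elements a)).1 h

theorem length_tuples (A : Finset ℕ) (k : ℕ) : (tuples A k).length = A.card ^ k := by
  induction k with
  | zero => rfl
  | succ k ih => simp [tuples, ih, length_elements, pow_succ, mul_comm]

theorem length_argTuples (A : Finset ℕ) (k : ℕ) : (argTuples A k).length = blockSize A.card k := by
  cases k with
  | zero => simp [argTuples, blockSize]
  | succ k => simp [argTuples, blockSize, length_tuples]

/-- The value of a word of digits in base `m`, appended to the number `r`. -/
def horner (m r : ℕ) (ds : List ℕ) : ℕ := ds.foldl (fun r d => r * m + d) r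

theorem horner_eq (m r : ℕ) (ds : List ℕ) : horner m r ds = r * m ^ ds.length + horner m 0 ds := by
  induction ds generalizing r with
  | nil => simp [horner]
  | cons d ds ih =>
    have h1 := ih (r * m + d)
    have h2 := ih (0 * m + d)
    simp only [horner, List.foldl_cons, List.length_cons] at h1 h2 ⊢
    rw [h1, h2]; ring

/-- The position of a tuple in the lexicographic order has the ranks as digits. -/
theorem getElem?_tuples (A : Finset ℕ) {k : ℕ} (v : Fin k → A) :
    (tuples A k)[horner A.card 0 (List.ofFn fun i => rank (v i))]? = some v := by
  induction k with
  | zero => simp [tuples, horner]; exact Subsingleton.elim _ _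
  | succ k ih =>
    obtain ⟨l₁, l₂, h, h1, -⟩ := elements_split (v 0)
    have h2 := ih (Fin.tail v)
    have hlt : horner A.card 0 (List.ofFn fun i => rank (Fin.tail v i)) < (tuples A k).length :=
      (List.getElem?_eq_some_iff.1 h2).1
    have h3 := horner_eq A.card (0 * A.card + rank (v 0)) (List.ofFn fun i => rank (Fin.tail v i))
    rw [List.length_ofFn] at h3
    have h4 : horner A.card 0 (List.ofFn fun i => rank (v i)) =
        rank (v 0) * A.card ^ k + horner A.card 0 (List.ofFn fun i => rank (Fin.tail v i)) := by
      rw [Nat.zero_mul, Nat.zero_add] at h3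
      rw [List.ofFn_succ, ← show _ = _ from h3]
      simp only [horner, List.foldl_cons, Nat.zero_mul, Nat.zero_add]
      rfl
    have h5 : ((l₁.flatMap fun a => (tuples A k).map fun v => (Fin.cons a v : Fin (k + 1) → A))).length =
        rank (v 0) * A.card ^ k := by
      simp [length_tuples, h1]
    rw [h4, tuples, h, List.flatMap_append, List.getElem?_append_right (by omega), h5,
      Nat.add_sub_cancel_left, List.flatMap_cons, List.getElem?_append_left (by simpa using hlt),
      List.getElem?_map, h2]
    exact congrArg some (Fin.cons_self_tail v)

theorem getElem?_argTuples {A : Finset ℕ} (hA : A.Nonempty) {k : ℕ} (v : Fin k → A) :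
    (argTuples A k)[horner A.card 0 (List.ofFn fun i => rank (v i))]? = some v := by
  cases k with
  | zero =>
    have h : 0 < A.card := hA.card_pos
    rw [List.ofFn_zero, horner, List.foldl_nil, argTuples, List.getElem?_replicate, if_pos h]
    exact congrArg some (Subsingleton.elim _ _)
  | succ k => exact getElem?_tuples A v

/-- The number of values of the symbols in a list. -/
theorem length_encValues_take {τ : Vocabulary} {A : Finset ℕ} (π : Literal τ A → K) (l : List τ.Symbol) :
    (l.flatMap fun R =>
      (argTuples A (τ.ar R)).map (fun a => π (.pos R a)) ++
      (argTuples A (τ.ar R)).map (fun a => π (.neg R a))).length =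
    offset A.card (l.map τ.ar) := by
  induction l with
  | nil => rfl
  | cons R l ih =>
    rw [List.flatMap_cons, List.length_append, ih]
    simp [offset, length_argTuples]; omega

theorem vocabulary_split (τ : Vocabulary) (R : τ.Symbol) :
    τ = List.take R τ ++ τ.ar R :: List.drop (R + 1) τ := by
  conv_lhs => rw [← List.take_append_drop R τ, List.drop_eq_getElem_cons R.2]
  rfl

theorem finRange_split (τ : Vocabulary) (R : τ.Symbol) :
    ∃ l₁ l₂, List.finRange (List.length τ) = l₁ ++ R :: l₂ ∧ l₁.map τ.ar = List.take R τ := by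
  refine ⟨(List.finRange (List.length τ)).take R, (List.finRange (List.length τ)).drop (R + 1), ?_, ?_⟩
  · have h : (R : ℕ) < (List.finRange (List.length τ)).length := by simp
    conv_lhs => rw [← List.take_append_drop R (List.finRange _), List.drop_eq_getElem_cons h]
    simp
  · rw [List.map_take]
    congr 1
    rw [← List.ofFn_eq_map]
    exact List.ofFn_get τ

/-- The literal that belongs to a tuple. -/
def lit {τ : Vocabulary} {A : Type} (neg : Bool) (R : τ.Symbol) (a : Fin (τ.ar R) → A) :
    Literal τ A := if neg then .neg R a else .pos R a

/-- The position of the value of a literal. -/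
theorem getElem?_encValues {τ : Vocabulary} {A : Finset ℕ} (hA : A.Nonempty) (π : Literal τ A → K)
    (neg : Bool) (R : τ.Symbol) (v : Fin (τ.ar R) → A) :
    (encValues π)[offset A.card (List.take R τ) + (if neg then blockSize A.card (τ.ar R) else 0) +
      horner A.card 0 (List.ofFn fun i => rank (v i))]? = some (π (lit neg R v)) := by
  obtain ⟨l₁, l₂, h, h1⟩ := finRange_split τ R
  have h2 := getElem?_argTuples hA v
  have h3 := (List.getElem?_eq_some_iff.1 h2).1
  have h4 := length_encValues_take π l₁
  rw [h1] at h4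
  rw [encValues, h, List.flatMap_append, List.getElem?_append_right (by omega), h4, List.flatMap_cons,
    Nat.add_assoc, Nat.add_sub_cancel_left]
  cases neg with
  | false =>
    rw [List.append_assoc, List.getElem?_append_left (by simpa using h3)]
    simp [h2, lit]
  | true =>
    rw [List.append_assoc, List.getElem?_append_right (by simp [length_argTuples]),
      List.getElem?_append_left (by simpa [length_argTuples] using h3)]
    simp [h2, lit, length_argTuples]

theorem isBit_encNat {x : ℕ} : ∀ y ∈ encNat x, y.isBit = true := by
  intro y hy
  simp only [encNat, List.mem_map] at hy
  obtain ⟨b, -, rfl⟩ := hy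
  cases b <;> rfl

theorem isBit_encNat_reverse {x : ℕ} : ∀ y ∈ (encNat x).reverse, y.isBit = true :=
  fun y hy => isBit_encNat y (List.mem_reverse.1 hy)

theorem encNat_inj {x y : ℕ} (h : encNat x = encNat y) : x = y := by
  have hf : Function.Injective fun b : Bool => if b then Letter.one else Letter.zero := by
    intro a b; cases a <;> cases b <;> simp
  have hb : x.bits = y.bits := List.map_injective_iff.2 hf h
  exact Nat.eq_of_testBit_eq fun i => by rw [Nat.testBit_eq_inth, Nat.testBit_eq_inth, hb]

theorem encSet_eq (A : Finset ℕ) : encSet A = (elements A).flatMap fun a : A => encElem (a : ℕ) := by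
  unfold encSet
  generalize elements A = l
  induction l with
  | nil => rfl
  | cons a l ih => exact congrArg (encElem a ++ ·) ih

theorem encSet_reverse (A : Finset ℕ) : (encSet A).reverse =
    setWord ((elements A).reverse.map fun a : A => (encNat (a : ℕ)).reverse) := by
  rw [encSet_eq]
  unfold setWord
  generalize elements A = l
  induction l with
  | nil => rfl
  | cons a l ih =>
    rw [List.flatMap_cons, List.reverse_append, ih]
    simp [encElem]

/-! ### Assignments on the tape -/

/-- An entry of the current assignment: a variable, its value, and whether the value is given by its
rank, as for quantified variables, or by its binary notation, as in the input. -/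
abbrev Entry (A : Finset ℕ) := ℕ × A × Bool

/-- The item on the stack `env` that stands for an entry. -/
noncomputable def Entry.item {A : Finset ℕ} (e : Entry A) : List Letter × Letter × List Letter :=
  if e.2.2 then (List.replicate (rank e.2.1) .one, .close, (encNat e.1).reverse)
  else ((encNat (e.2.1 : ℕ)).reverse, .elem, (encNat e.1).reverse)

/-- The content of the stack `env`. -/
noncomputable def envWord {A : Finset ℕ} (es : List (Entry A)) : List Letter :=
  es.flatMap fun e => itemWord e.item

/-- The first entry for the variable `x` assigns the value `a`. -/
def Binds {A : Finset ℕ} (es : List (Entry A)) (x : ℕ) (a : A) : Prop :=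
  ∃ es₁ b es₂, es = es₁ ++ (x, a, b) :: es₂ ∧ ∀ e ∈ es₁, e.1 ≠ x

theorem binds_cons {A : Finset ℕ} {es : List (Entry A)} {s : ℕ → A} {x y : ℕ} (a : A) (b : Bool)
    (h : y ≠ x → Binds es y (s y)) : Binds ((x, a, b) :: es) y (Function.update s x a y) := by
  by_cases hy : y = x
  · subst hy
    exact ⟨[], b, es, by simp, by simp⟩
  · obtain ⟨es₁, b', es₂, h1, h2⟩ := h hy
    rw [Function.update_of_ne hy]
    refine ⟨(x, a, b) :: es₁, b', es₂, by simp [h1], ?_⟩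
    simpa [Ne.symm hy] using h2

theorem binds_map {A : Finset ℕ} {V : List ℕ} {s : ℕ → A} {x : ℕ} (hx : x ∈ V) :
    Binds (V.map fun x => (x, s x, false)) x (s x) := by
  induction V with
  | nil => cases hx
  | cons y V ih =>
    by_cases h : y = x
    · subst h
      exact ⟨[], false, _, rfl, by simp⟩
    · obtain ⟨es₁, b, es₂, h1, h2⟩ := ih (by simpa [Ne.symm h] using hx)
      refine ⟨(y, s y, false) :: es₁, b, es₂, by simp [h1], ?_⟩
      simpa [h] using h2

theorem encAssignment_reverse {A : Finset ℕ} (V : List ℕ) (s : ℕ → A) :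
    (encAssignment V s).reverse = envWord (V.reverse.map fun x => (x, s x, false)) := by
  unfold encAssignment envWord
  induction V with
  | nil => rfl
  | cons x V ih =>
    rw [List.flatMap_cons, List.reverse_append, ih]
    simp [Entry.item, itemWord, encElem, encVar]

theorem itemOk_item {A : Finset ℕ} (e : Entry A) : ItemOk e.item := by
  obtain ⟨x, a, b⟩ := e
  cases b with
  | true => exact ⟨by simp [Entry.item, Letter.isBit], rfl, isBit_encNat_reverse⟩
  | false => exact ⟨isBit_encNat_reverse, rfl, isBit_encNat_reverse⟩

theorem key_item {A : Finset ℕ} (e : Entry A) : e.item.2.2 = (encNat e.1).reverse := by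
  obtain ⟨x, a, b⟩ := e
  cases b <;> rfl

theorem key_item_ne {A : Finset ℕ} {e : Entry A} {x : ℕ} (h : e.1 ≠ x) :
    e.item.2.2 ≠ (encNat x).reverse := by
  rw [key_item]
  exact fun h' => h (encNat_inj (List.reverse_injective h'))

variable [CommSemiring K]

theorem does_lookup {A : Finset ℕ} {es : List (Entry A)} {x : ℕ} {a : A}
    (he : Binds es x a) (h : σ .env = str (envWord es)) (hk : σ .key = str (encNat x).reverse)
    (hkL : σ .keyL = []) (hr : σ .res = []) (heL : σ .envL = [])
    (hs : σ .set = str (encSet A).reverse) (hsL : σ .setL = []) (hH : (σ .env).length ≤ H)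
    (hsH : (σ .set).length ≤ H) :
    Does n H lookup σ (40 * (H + 1)) ()
      (Function.update (Function.update σ .key []) .res (ones (rank a))) := by
  obtain ⟨es₁, b, es₂, rfl, hes⟩ := he
  have henv : σ .env = str ((es₁.map Entry.item).flatMap itemWord) ++
      (str (itemWord (Entry.item (x, a, b))) ++ str (envWord es₂)) := by
    rw [h]; simp [envWord, List.flatMap_map]
  have hes' : ∀ e ∈ es₁.map Entry.item, ItemOk e ∧ e.2.2 ≠ (encNat x).reverse := by
    intro e he
    obtain ⟨e', he', rfl⟩ := List.mem_map.1 he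
    exact ⟨itemOk_item e', key_item_ne (hes e' he')⟩
  have hok := itemOk_item (x, a, b)
  cases b with
  | true => exact (does_lookup_rank henv hes' hok hk hkL hr heL hH).weaken (by omega) rfl
  | false =>
    obtain ⟨l₁, l₂, hA, hl, hn⟩ := elements_split a
    have hs' : (encSet A).reverse = setWord ((l₂.reverse.map fun a : A => (encNat (a : ℕ)).reverse) ++
        (encNat (a : ℕ)).reverse :: l₁.reverse.map fun a : A => (encNat (a : ℕ)).reverse) := by
      rw [encSet_reverse, hA]; simp
    refine (does_lookup_elem henv hes' hok hk hkL hr heL hH (hs.trans (by rw [hs'])) ?_ ?_ hsL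
      hsH).weaken (by omega) (by simp [hl])
    · intro w hw hwa
      obtain ⟨c, hc, rfl⟩ := List.mem_map.1 hw
      have : c = a := Subtype.ext (encNat_inj (List.reverse_injective hwa))
      subst this
      exact hn (List.mem_reverse.1 hc)
    · intro w hw
      simp only [List.mem_append, List.mem_cons, List.mem_map] at hw
      obtain ⟨c, -, rfl⟩ | rfl | ⟨c, -, rfl⟩ := hw <;> exact isBit_encNat_reverse

end SemiringFO

namespace SemiringFO

universe u

variable {K : Type u} [CommSemiring K] {α β : Type} {n H : ℕ} {σ : State K}

/-! ### Evaluation of literals -/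

/-- The heights of the stacks before a run may be assumed to be bounded. -/
theorem Does.of_height {c : Code K α} {u : ℕ} {a : α} {σ' : State K}
    (h : (∀ i ≠ .inp, (σ i).length ≤ H) → Does n H c σ u a σ') : Does n H c σ u a σ' :=
  fun hn m hm => h hm.height hn m hm

/-- The stacks while no literal is evaluated: the universe and the interpretation are in their
places, and all auxiliary stacks are empty. -/
structure Idle {τ : Vocabulary} {A : Finset ℕ} (π : Literal τ A → K) (σ : State K) : Prop where
  envL : σ .envL = []
  key : σ .key = []
  keyL : σ .keyL = []
  res : σ .res = []
  setL : σ .setL = []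
  cardL : σ .cardL = []
  vocL : σ .vocL = []
  valL : σ .valL = []
  idx : σ .idx = []
  cnt : σ .cnt = []
  siz : σ .siz = []
  tmp : σ .tmp = []
  set : σ .set = str (encSet A).reverse
  card : σ .card = ones A.card
  voc : σ .voc = str (encVocabulary τ)
  val : σ .val = (encValues π).map .inr

/-- The stacks `σ` with new contents of the stacks on which the evaluation operates. -/
def work (σ : State K) (fL fR cs vs env : List (Sym K)) : State K
  | .fL => fL
  | .fR => fR
  | .cs => cs
  | .vs => vs
  | .env => env
  | i => σ i

/-- Reading the index of a variable, up to and including the letter that follows it, and looking up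
the variable. The exit tells the following letter. -/
def lookupVar : Code K Top :=
  (moveUntil (fun l => !l.isBit) .fR .fL (some .key)).bind fun t => lookup.bind fun _ => .pure t

theorem does_lookupVar {A : Finset ℕ} {es : List (Entry A)} {x : ℕ} {a : A} {l : Letter}
    {rest : List (Sym K)}
    (he : Binds es x a) (h : σ .env = str (envWord es)) (hf : σ .fR = str (encNat x) ++ .inl l :: rest)
    (hl : l.isBit = false) (hk : σ .key = [])
    (hkL : σ .keyL = []) (hr : σ .res = []) (heL : σ .envL = [])
    (hs : σ .set = str (encSet A).reverse) (hsL : σ .setL = [])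
    (hH : (σ .fL).length + (encNat x).length < H) :
    Does n H lookupVar σ (50 * (H + 1)) (.letter l)
      (Function.update (Function.update (Function.update σ .fR rest) .fL
        (.inl l :: (str (encNat x).reverse ++ σ .fL))) .res (ones (rank a))) := by
  refine .of_height fun hh => ?_
  have h1 := hh .env (by decide)
  have h2 := hh .set (by decide)
  refine .seq (does_moveUntil_copy hf (fun y hy => by simp [isBit_encNat y hy]) (by simpa using hl)
    (by decide) (by decide) (by decide) (by decide) (by decide) hH (by simp [hk]; omega)) (by omega)
    (.seq (does_lookup (x := x) (a := a) he (by simpa using h) (by simp [hk]) (by simpa using hkL)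
      (by simpa using hr) (by simpa using heL) (by simpa using hs) (by simpa using hsL)
      (by simpa using h1) (by simpa using h2)) (by omega) (.done (funext fun z => ?_)))
  simp only [Function.update_apply]
  cases z <;> simp [hk]

/-- Comparing the unary numbers on the stacks `res` and `idx`, which are removed. -/
def sameOnes : Code K Bool :=
  (Code.iter (fun _ : Unit => (pop .res).bind fun t => (pop .idx).bind fun t' => match t, t' with
    | .empty, .empty => .pure (.inr true)
    | .letter _, .letter _ => .pure (.inl ())
    | _, _ => .pure (.inr false)) ()).bind fun r =>
  (clear .res).bind fun _ => (clear .idx).bind fun _ => .pure r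

theorem does_sameOnes {r q : ℕ} (hr : σ .res = ones r) (hq : σ .idx = ones q) :
    Does n H sameOnes σ (5 * (r + q) + 10) (decide (r = q))
      (Function.update (Function.update σ .res []) .idx []) := by
  have key : ∀ (r q : ℕ) (σ' : State K), σ' = Function.update (Function.update σ .res (ones r)) .idx
      (ones q) → ∃ r' q', r' ≤ r ∧ q' ≤ q ∧
      Does n H (Code.iter (fun _ : Unit => (pop .res).bind fun t => (pop .idx).bind fun t' =>
        match t, t' with
        | .empty, .empty => .pure (.inr true)
        | .letter _, .letter _ => .pure (.inl ())
        | _, _ => .pure (.inr false)) ()) σ' (3 * r + 3) (decide (r = q))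
        (Function.update (Function.update σ .res (ones r')) .idx (ones q')) := by
    intro r
    induction r with
    | zero =>
      intro q σ' hσ'
      refine ⟨0, q - 1, le_rfl, by omega, .last (u := 2) (.seq does_pop (by omega)
        (.seq does_pop le_rfl ?_)) le_rfl⟩
      subst hσ'
      cases q with
      | zero =>
        refine .done (funext fun z => ?_)
        simp only [Function.update_apply]
        cases z <;> simp
      | succ q =>
        refine .done (funext fun z => ?_)
        simp only [Function.update_apply]
        cases z <;> simp [ones_cons]
    | succ r ih =>
      intro q σ' hσ'
      cases q with
      | zero =>
        refine ⟨r, 0, by omega, le_rfl, .last (u := 2) (.seq does_pop (by omega)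
          (.seq does_pop le_rfl ?_)) (by omega)⟩
        subst hσ'
        refine .done (funext fun z => ?_)
        simp only [Function.update_apply]
        cases z <;> simp [ones_cons]
      | succ q =>
        obtain ⟨r', q', h1, h2, hd⟩ := ih q _ rfl
        refine ⟨r', q', by omega, by omega, .next (u := 2) (a' := ()) (.seq does_pop (by omega)
          (.seq does_pop le_rfl (σ₂ := Function.update (Function.update σ .res (ones r)) .idx
            (ones q)) ?_)) (by omega) ?_⟩
        · subst hσ'
          refine .done (funext fun z => ?_)
          simp only [Function.update_apply]
          cases z <;> simp [ones_cons]
        · rw [show decide (r + 1 = q + 1) = decide (r = q) by simp]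
          exact hd.weaken (by omega) rfl
  obtain ⟨r', q', h1, h2, hd⟩ := key r q σ (funext fun z => by
    simp only [Function.update_apply]
    cases z <;> simp [hr, hq])
  refine .seq hd (by omega) (.seq (does_clear (l := ones r') (by simp)) (by simp; omega)
    (.seq (does_clear (l := ones q') (by simp)) (by simp; omega) (.done (funext fun z => ?_))))
  simp only [Function.update_apply]
  cases z <;> simp

/-- Evaluating an equality, or an inequality, whose first letter has been read. -/
def evalEq (b : Bool) : Code K Unit :=
  (moveTop .fR .fL).bind fun _ => lookupVar.bind fun _ => (moveAll .res .idx).bind fun _ =>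
    lookupVar.bind fun _ => sameOnes.bind fun r => pushConst .vs (if r = b then 1 else 0)

/-- Two elements are equal if their ranks are. -/
theorem does_evalEq {τ : Vocabulary} {A : Finset ℕ} {π : Literal τ A → K} (hσ : Idle π σ)
    {es : List (Entry A)} {x y : ℕ} {a a' : A} {b : Bool} {l : Letter}
    {fL rest cs vs : List (Sym K)} (hx : Binds es x a) (hy : Binds es y a')
    (hH : fL.length + (encVar x).length + (encVar y).length + 2 < H) (hv : vs.length < H) :
    Does n H (evalEq b)
      (work σ (.inl l :: fL) (str (encVar x ++ encVar y ++ [.close]) ++ rest) cs vs (str (envWord es)))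
      (150 * (H + 1)) ()
      (work σ (str (l :: (encVar x ++ encVar y ++ [.close])).reverse ++ fL) rest cs
        (.inr (if decide (a = a') = b then 1 else 0) :: vs) (str (envWord es))) := by
  refine .of_height fun hh => ?_
  have hA : A.card ≤ H := by
    have := hh .card (by decide)
    simpa [work, hσ.card] using this
  have h1 := rank_lt a
  have h2 := rank_lt a'
  simp only [encVar, List.length_cons] at hH
  have hdec : decide (a = a') = decide (rank a' = rank a) := by
    by_cases h : a = a'
    · simp [h]
    · rw [decide_eq_false h, decide_eq_false fun h' => h (rank_inj h').symm]
  rw [hdec]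
  refine .seq (does_moveTop (x := .inl .var) (l := str (encNat x) ++ .inl .var :: (str (encNat y) ++
    .inl .close :: rest)) (by simp [work, encVar]) (by decide) (by decide) (by simp [work]; omega))
    (by omega) (.seq (does_lookupVar (l := .var)
      (rest := str (encNat y) ++ .inl .close :: rest) hx (by simp [work]) (by simp)
      rfl (by simp [work, hσ.key]) (by simp [work, hσ.keyL]) (by simp [work, hσ.res])
      (by simp [work, hσ.envL]) (by simp [work, hσ.set]) (by simp [work, hσ.setL])
      (by simp [work]; omega)) (by omega)
    (.seq (does_moveAll (l := ones (rank a)) (by simp) (by decide) (by decide)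
      (by simp [work, hσ.idx]; omega)) (by simp; omega)
    (.seq (does_lookupVar (l := .close) (rest := rest) hy (by simp [work]) (by simp)
      rfl (by simp [work, hσ.key]) (by simp [work, hσ.keyL]) (by simp)
      (by simp [work, hσ.envL]) (by simp [work, hσ.set]) (by simp [work, hσ.setL])
      (by simp [work]; omega)) (by simp; omega)
    (.seq (does_sameOnes (r := rank a') (q := rank a) (by simp) (by simp [work, hσ.idx]))
      (by simp; omega)
      ((does_pushConst (by decide) (by simpa [work] using hv)).weaken (by simp; omega)
        (funext fun z => ?_))))))
  simp only [Function.update_apply]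
  cases z <;> simp [work, encVar, hσ.res, hσ.idx]

/-- Reading the variables of an atom; the number of the tuple of their values is appended to the
number on the stack `idx`. The letter in front of the first variable has already been read. -/
def evalArgs : Top → Code K Unit :=
  .iter fun t => match t with
    | .letter .var => lookupVar.bind fun t' => pushDigit.bind fun _ => .pure (.inl t')
    | _ => .pure (.inr ())

theorem le_horner {m : ℕ} (hm : 0 < m) (r : ℕ) (ds : List ℕ) : r ≤ horner m r ds := by
  rw [horner_eq]
  have : r * 1 ≤ r * m ^ ds.length := Nat.mul_le_mul_left _ (Nat.one_le_pow _ _ hm)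
  omega

theorem does_evalArgs {A : Finset ℕ} {es : List (Entry A)} {s : ℕ → A} {xs : List ℕ} {r : ℕ}
    {l : Letter} {w : List Letter} {L rest : List (Sym K)}
    (hxs : ∀ x ∈ xs, Binds es x (s x)) (h : σ .env = str (envWord es))
    (hw : xs.flatMap encVar ++ [.close] = l :: w) (hf : σ .fR = str w ++ rest)
    (hfL : σ .fL = .inl l :: L) (hk : σ .key = [])
    (hkL : σ .keyL = []) (hr : σ .res = []) (heL : σ .envL = [])
    (hs : σ .set = str (encSet A).reverse) (hsL : σ .setL = [])
    (hc : σ .card = ones A.card) (hcL : σ .cardL = []) (ht : σ .tmp = [])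
    (hi : σ .idx = ones r) (hA : 0 < A.card)
    (hrH : horner A.card r (xs.map fun x => rank (s x)) ≤ H)
    (hH : L.length + (l :: w).length < H) :
    Does n H (evalArgs (.letter l)) σ (75 * (H + 1) * xs.length + 1) ()
      (Function.update (Function.update (Function.update σ .fR rest) .fL
        (str (l :: w).reverse ++ L)) .idx
        (ones (horner A.card r (xs.map fun x => rank (s x))))) := by
  induction xs generalizing σ r l w L with
  | nil =>
    obtain ⟨rfl, rfl⟩ : Letter.close = l ∧ [] = w := by simpa using hw
    refine .last (u := 0) (.done (funext fun z => ?_)) (by simp)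
    simp only [Function.update_apply]
    cases z <;> simp [hf, hfL, hi, horner]
  | cons x xs ih =>
    refine .of_height fun hh => ?_
    have hcH : A.card ≤ H := by simpa [hc] using hh .card (by decide)
    obtain ⟨l', w', hw'⟩ : ∃ l' w', xs.flatMap encVar ++ [.close] = l' :: w' := by
      cases xs <;> simp [encVar]
    have hl' : l'.isBit = false := by
      cases xs <;> simp [encVar] at hw' <;> rw [← hw'.1] <;> rfl
    simp only [List.flatMap_cons, List.append_assoc, hw', encVar, List.cons_append,
      List.cons.injEq] at hw
    obtain ⟨rfl, rfl⟩ := hw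
    simp only [List.length_cons, List.length_append] at hH
    have e : horner A.card r ((x :: xs).map fun x => rank (s x)) =
        horner A.card (r * A.card + rank (s x)) (xs.map fun x => rank (s x)) := rfl
    rw [e] at hrH ⊢
    have h1 := le_horner hA (r * A.card + rank (s x)) (xs.map fun x => rank (s x))
    have h2 : r * 1 ≤ r * A.card := Nat.mul_le_mul_left _ hA
    rw [List.length_cons, Nat.mul_succ]
    refine .next (u := 74 * (H + 1)) (a' := .letter l')
      (σ₁ := Function.update (Function.update (Function.update σ .fR (str w' ++ rest)) .fL
        (.inl l' :: (str (encNat x).reverse ++ .inl .var :: L))) .idx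
        (ones (r * A.card + rank (s x))))
      (.seq (does_lookupVar (l := l') (rest := str w' ++ rest) (hxs x List.mem_cons_self) h
        (by simp [hf]) hl' hk hkL hr heL hs hsL (by simp [hfL]; omega)) (by omega)
      (.seq (does_pushDigit (m := A.card) (r := r) (d := rank (s x)) (by simp [hc]) (by simp [hcL])
        (by simp [ht]) (by simp [hi]) (by simp) hcH (by omega)) (by omega)
      (.done (funext fun z => ?_)))) (by omega)
      ((ih (L := str (encNat x).reverse ++ .inl .var :: L)
        (fun y hy => hxs y (List.mem_cons_of_mem _ hy)) (by simpa using h) hw' (by simp) (by simp)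
        (by simpa using hk) (by simpa using hkL) (by simpa using hr) (by simpa using heL)
        (by simpa using hs) (by simpa using hsL) (by simpa using hc) (by simpa using hcL)
        (by simpa using ht) (by simp) hrH (by simp; omega)).weaken (by omega) (funext fun z => ?_))
    · simp only [Function.update_apply]
      cases z <;> simp [hr, hfL]
    · simp only [Function.update_apply]
      cases z <;> simp

/-- Evaluating an atom or a negated atom whose first letter has been read. -/
def evalRel (neg : Bool) : Code K Unit :=
  (moveUntil (fun l => !l.isBit) .fR .fL (some .key)).bind fun t => toUnary.bind fun _ =>
    (evalArgs t).bind fun _ => fetch neg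

/-- The number of a symbol, the number of a tuple and the number of values are bounded by the height
`H`, because the vocabulary and all values are on stacks. Hence the conversion of the number of the
symbol to unary, which takes `O(H)` operations for every digit, is within the bound. -/
theorem does_evalRel {τ : Vocabulary} {A : Finset ℕ} {π : Literal τ A → K} (hσ : Idle π σ)
    (hA : A.Nonempty) {es : List (Entry A)} {s : ℕ → A} {neg : Bool} {l : Letter} {R : τ.Symbol}
    {x : Fin (τ.ar R) → ℕ}
    {fL rest cs vs : List (Sym K)} (hx : ∀ i, Binds es (x i) (s (x i)))
    (hH : fL.length + (encNat R ++ (List.ofFn x).flatMap encVar ++ [Letter.close]).length + 2 < H)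
    (hv : vs.length < H) :
    Does n H (evalRel neg)
      (work σ (.inl l :: fL) (str (encNat R ++ (List.ofFn x).flatMap encVar ++ [.close]) ++ rest) cs vs
        (str (envWord es)))
      (150 * (H + 1) * (l :: (encNat R ++ (List.ofFn x).flatMap encVar ++ [.close])).length) ()
      (work σ (str (l :: (encNat R ++ (List.ofFn x).flatMap encVar ++ [.close])).reverse ++ fL) rest
        cs (.inr (π (lit neg R fun i => s (x i))) :: vs) (str (envWord es))) := by
  refine .of_height fun hh => ?_
  have hvoc : (encVocabulary τ).length ≤ H := by simpa [work, hσ.voc] using hh .voc (by decide)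
  have hval : (encValues π).length ≤ H := by simpa [work, hσ.val] using hh .val (by decide)
  have hsplit := vocabulary_split τ R
  have hR : (R : ℕ) ≤ H := by
    have h1 : List.length τ ≤ (encVocabulary τ).length := by
      clear hσ hx hH hh hvoc hval hsplit
      rw [encVocabulary, List.length_flatMap]
      exact (List.length_le_sum_of_one_le _ (by simp)).trans_eq' (by simp)
    have := R.2
    omega
  obtain ⟨l', w, hw⟩ : ∃ l' w, (List.ofFn x).flatMap encVar ++ [.close] = l' :: w := by
    cases List.ofFn x <;> simp [encVar]
  have hl' : l'.isBit = false := by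
    revert hw
    cases List.ofFn x <;> simp [encVar] <;> rintro rfl - <;> rfl
  have hg := getElem?_encValues hA π neg R fun i => s (x i)
  have hds : List.ofFn (fun i => rank (s (x i))) = (List.ofFn x).map fun y => rank (s y) := by
    rw [List.map_ofFn]; rfl
  have hrank : horner A.card 0 ((List.ofFn x).map fun y => rank (s y)) ≤ H := by
    have := (List.getElem?_eq_some_iff.1 hg).1
    rw [hds] at this
    omega
  rw [hds] at hg
  have hlen : τ.ar R ≤ ((List.ofFn x).flatMap encVar).length := by
    rw [List.length_flatMap]
    exact (List.length_le_sum_of_one_le _ (by simp [encVar])).trans_eq' (by simp)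
  simp only [List.append_assoc, hw] at hH ⊢
  have hlen' : (l' :: w).length = ((List.ofFn x).flatMap encVar).length + 1 := by
    rw [← hw]; simp
  simp only [List.length_append, List.length_cons] at hH hlen' ⊢
  have hq : (encNat R).length * (8 * R + 8) ≤ (encNat R).length * (8 * (H + 1)) :=
    Nat.mul_le_mul_left _ (by omega)
  have hcost : 3 * (encNat R).length + 2 + ((encNat R).length * (8 * R + 8) + 2) +
      (75 * (H + 1) * (List.ofFn x).length + 1) + (60 * (H + H) + 20) ≤
      150 * (H + 1) * ((encNat R).length + (w.length + 1) + 1) := by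
    rw [List.length_ofFn]
    have h1 : τ.ar R ≤ w.length := by omega
    have h2 : 75 * (H + 1) * τ.ar R ≤ 75 * (H + 1) * w.length := Nat.mul_le_mul_left _ h1
    have h3 : (encNat R).length * (8 * (H + 1)) = 8 * ((H + 1) * (encNat R).length) := by ring
    have h4 : 75 * (H + 1) * w.length = 75 * ((H + 1) * w.length) := by ring
    have h5 : 150 * (H + 1) * ((encNat R).length + (w.length + 1) + 1) =
      150 * ((H + 1) * (encNat R).length) + 150 * ((H + 1) * w.length) + 300 * (H + 1) := by ring
    have h6 : 1 * (encNat R).length ≤ (H + 1) * (encNat R).length :=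
      Nat.mul_le_mul_right _ (by omega)
    omega
  refine .seq (does_moveUntil_copy (w := encNat R) (x := l') (l := str w ++ rest)
    (by simp [work]) (fun y hy => by simp [isBit_encNat y hy]) (by simpa using hl')
    (by decide) (by decide) (by decide) (by decide) (by decide) (by simp [work]; omega)
    (by simp [work, hσ.key]; omega)) (by omega)
    (.seq (does_toUnary (N := R) (by simp [work, hσ.tmp]) (by simp [work, hσ.key])
      (by simp [work, hσ.cnt]) hR) (by omega)
    (.seq (does_evalArgs (s := s) (xs := List.ofFn x) (r := 0) (w := w)
      (L := str (encNat R).reverse ++ .inl l :: fL) (rest := rest)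
      (fun y hy => by
        obtain ⟨i, rfl⟩ := (List.mem_ofFn' x y).1 hy
        exact hx i) (by simp [work]) hw (by simp) (by simp [work])
      (by simp [work, hσ.key]) (by simp [work, hσ.keyL]) (by simp [work, hσ.res])
      (by simp [work, hσ.envL]) (by simp [work, hσ.set]) (by simp [work, hσ.setL])
      (by simp [work, hσ.card]) (by simp [work, hσ.cardL]) (by simp [work, hσ.tmp])
      (by simp [work, hσ.idx]) hA.card_pos hrank (by simp; omega)) (by omega)
    ((does_fetch (m := A.card) (k := τ.ar R)
      (r := horner A.card 0 ((List.ofFn x).map fun y => rank (s y)))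
      (τ₁ := List.take R τ) (τ₂ := List.drop (R + 1) τ)
      (v := (encValues π).map .inr) (x := .inr (π (lit neg R fun i => s (x i))))
      (by simp [work, hσ.card]) (by simp [work, hσ.cardL]) (by simp [work, hσ.tmp])
      (by simp [work, hσ.siz]) (by rw [← hsplit]; simp [work, hσ.voc]) (by simp [work, hσ.vocL])
      hA.card_pos (by simp [work, hσ.val]) (by simp [work, hσ.valL])
      (by simp) (by simp) (by rw [List.getElem?_map, hg]; rfl) (by simpa using hval)
      (by simpa [work, hσ.voc] using hvoc) (by simpa [work] using hv)).weaken ?_ ?_)))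
  · simp [work, hσ.voc] at *; omega
  · funext z
    simp only [Function.update_apply]
    cases z <;> simp [work, hσ.key, hσ.cnt, hσ.idx]

end SemiringFO

namespace SemiringFO

universe u

variable {K : Type u} [CommSemiring K] {n H : ℕ} {σ : State K}

/-! ### Quantifiers -/

/-- Whether a letter starts a variable. -/
def Letter.isVar : Letter → Bool
  | .var => true
  | _ => false

theorem isVar_of_isBit {y : Letter} (h : y.isBit = true) : y.isVar = false := by
  cases y <;> first | rfl | cases h

/-- Whether a letter marks the beginning of the scope of a quantifier. -/
def Letter.isSep : Letter → Bool
  | .sep => true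
  | _ => false

/-- Reading a quantifier and its variable. The quantifier is pushed on the stack `cs`, the value of
the variable is the element of rank `0`, the sum or product starts with `k`, and the beginning of
the scope is marked. -/
def openQuant (q : Letter) (k : K) : Code K Unit :=
  (push .cs q).bind fun _ => (moveTop .fR .fL).bind fun _ => (push .env .var).bind fun _ =>
    (moveUntil (fun l => !l.isBit) .fR .fL (some .env)).bind fun _ => (moveTop .fL .fR).bind fun _ =>
    (push .env .close).bind fun _ => (pushConst .vs k).bind fun _ => push .fL .sep

/-- The item for a variable whose value is the element of rank `r`, on top of the stack `env`. -/
def rankEnv (r x : ℕ) (env : List (Sym K)) : List (Sym K) :=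
  ones r ++ .inl .close :: (str (encNat x).reverse ++ .inl .var :: env)

theorem does_openQuant {q l : Letter} {k : K} {x : ℕ} {w : List Letter}
    {fL rest cs vs env : List (Sym K)} (hl : l.isBit = false)
    (hf : fL.length + (encNat x).length + 3 < H) (hr : rest.length + w.length + 1 < H)
    (hc : cs.length < H) (hv : vs.length < H) (he : env.length + (encNat x).length + 2 < H) :
    Does n H (openQuant q k) (work σ fL (str (encVar x ++ l :: w) ++ rest) cs vs env)
      (3 * (encNat x).length + 9) ()
      (work σ (.inl .sep :: (str (encVar x).reverse ++ fL)) (str (l :: w) ++ rest) (.inl q :: cs)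
        (.inr k :: vs) (rankEnv 0 x env)) := by
  refine .seq (does_push (by decide) (by simpa [work] using hc)) (by omega)
    (.seq (does_moveTop (x := .inl .var) (l := str (encNat x) ++ .inl l :: (str w ++ rest))
      (by simp [work, encVar]) (by decide) (by decide) (by simp [work]; omega)) (by omega)
    (.seq (does_push (by decide) (by simp [work]; omega)) (by omega)
    (.seq (does_moveUntil_copy (w := encNat x) (x := l) (l := str w ++ rest) (by simp)
      (fun y hy => by simp [isBit_encNat y hy]) (by simpa using hl) (by decide) (by decide)
      (by decide) (by decide) (by decide) (by simp [work]; omega) (by simp [work]; omega)) (by omega)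
    (.seq (does_moveTop (x := .inl l) (l := str (encNat x).reverse ++ .inl .var :: fL)
      (by simp [work]) (by decide) (by decide) (by simp; omega)) (by omega)
    (.seq (does_push (by decide) (by simp [work]; omega)) (by omega)
    (.seq (does_pushConst (by decide) (by simpa [work] using hv)) (by omega)
    ((does_push (by decide) (by simp; omega)).weaken (by omega) (funext fun z => ?_))))))))
  simp only [Function.update_apply]
  cases z <;> simp [work, encVar, rankEnv]

/-- Comparing the rank on top of the stack `env` with the cardinality of the universe. -/
def compareCard : Code K Unit :=
  .iter (fun _ : Unit => (moveTop .env .envL).bind fun t => match t with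
    | .letter .one => (moveTop .card .cardL).bind fun _ => .pure (.inl ())
    | _ => .pure (.inr ())) ()

theorem does_compareCard {r p : ℕ} {e : List (Sym K)} (h : σ .env = ones r ++ .inl .close :: e)
    (hc : σ .card = ones (r + p)) (hH : (σ .envL).length + r < H)
    (hH' : (σ .cardL).length + r ≤ H) :
    Does n H compareCard σ (3 * r + 2) ()
      (Function.update (Function.update (Function.update (Function.update σ .env e) .envL
        (.inl .close :: (ones r ++ σ .envL))) .card (ones p)) .cardL (ones r ++ σ .cardL)) := by
  induction r generalizing σ with
  | zero =>
    refine .last (u := 1) (.seq (does_moveTop (x := .inl .close) (l := e) (by simpa using h)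
      (by decide) (by decide) (by omega)) le_rfl (.done (funext fun z => ?_))) (by simp)
    simp only [Function.update_apply]
    rw [Nat.zero_add] at hc
    cases z <;> simp [hc]
  | succ r ih =>
    rw [Nat.add_right_comm, ones_cons] at hc
    rw [ones_cons] at h
    refine .next (u := 2) (a' := ()) (.seq (does_moveTop (x := .inl .one)
      (l := ones r ++ .inl .close :: e) (by simpa using h)
      (by decide) (by decide) (by omega)) (by omega) (.seq (does_moveTop (x := .inl .one)
      (l := ones (r + p)) (by simpa using hc) (by decide) (by decide) (by simp; omega)) (by omega)
      (.done rfl))) (by omega)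
      ((ih (by simp) (by simp) (by simp; omega) (by simp; omega)).weaken (by omega)
        (funext fun z => ?_))
    simp only [Function.update_apply]
    cases z <;> simp [ones_succ]

/-- Leaving the scope of a quantifier: its item is removed from the stack `env`, and the mark of
the beginning of the scope is removed. -/
def leaveScope : Code K Unit :=
  (moveUntil Letter.isVar .env .envL none).bind fun _ => (clear .envL).bind fun _ =>
    (moveUntil Letter.isSep .fL .tmp none).bind fun _ => (pop .tmp).bind fun _ => moveAll .tmp .fL

/-- Returning to the beginning of the scope of a quantifier. -/
def rewind (q : Letter) : Code K Unit :=
  (moveAll .envL .env).bind fun _ => (moveUntil Letter.isSep .fL .fR none).bind fun _ =>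
    (moveTop .fR .fL).bind fun _ => push .cs q

/-- The end of the scope of a quantifier: the value is added to the sum, or multiplied with the
product, and the scope is evaluated for the element of the next rank, if there is one. -/
def closeQuant (o : ArithOp) (q : Letter) : Code K Unit :=
  (arith o .vs).bind fun _ => (push .env .one).bind fun _ => compareCard.bind fun _ =>
    (moveTop .card .cardL).bind fun t => (moveAll .cardL .card).bind fun _ => match t with
      | .empty => leaveScope
      | _ => rewind q

variable {τ : Vocabulary} {A : Finset ℕ} {π : Literal τ A → K}

/-- The rank of the value has not reached the cardinality of the universe yet. -/
theorem does_closeQuant_next (hσ : Idle π σ) {o : ArithOp} {q : Letter} {r x : ℕ} {w : List Letter}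
    {a b : K} {F rest cs vs env : List (Sym K)} (hw : ∀ y ∈ w, y.isSep = false)
    (hr : r + 1 < A.card)
    (hF : F.length + w.length + rest.length + 2 < H) (hc : cs.length < H)
    (he : env.length + (encNat x).length + A.card + 2 ≤ H) :
    Does n H (closeQuant o q) (work σ (str w.reverse ++ .inl .sep :: F) rest cs
        (.inr b :: .inr a :: vs) (rankEnv r x env))
      (20 * (H + 1)) ()
      (work σ (.inl .sep :: F) (str w ++ rest) (.inl q :: cs) (.inr (o.apply a b) :: vs)
        (rankEnv (r + 1) x env)) := by
  have hcard : A.card = r + 1 + (A.card - (r + 2) + 1) := by omega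
  refine .seq (does_arith (x := a) (y := b) rfl (by decide)) (by omega)
    (.seq (does_push (by decide) ?_) (by omega)
    (.seq (does_compareCard (r := r + 1) (p := A.card - (r + 2) + 1)
      (e := str (encNat x).reverse ++ .inl .var :: env) ?_ ?_ ?_ ?_) (by omega)
    (.seq (does_moveTop (x := .inl .one) (l := ones (A.card - (r + 2))) ?_ (by decide) (by decide) ?_)
      (by omega)
    (.seq (does_moveAll (l := ones (r + 2)) ?_ (by decide) (by decide) ?_) ?_
    (.seq (does_moveAll rfl (by decide) (by decide) ?_) ?_
    (.seq (does_moveUntil (w := w.reverse) (x := .sep) (l := F) ?_ ?_ rfl (by decide) (by decide) ?_)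
      ?_
    (.seq (does_moveTop (x := .inl .sep) (l := str w ++ rest) ?_ (by decide) (by decide) ?_) ?_
    ((does_push (by decide) ?_).weaken ?_ ?_))))))))
  · simp [work, rankEnv]; omega
  · simp [work, rankEnv, ones_cons]
  · simp [work, hσ.card]; rw [← hcard]
  · simp [work, hσ.envL]; omega
  · simp [work, hσ.cardL]; omega
  · simp [ones_cons]
  · simp [work, hσ.cardL]; omega
  · simp [work, hσ.cardL, ones_cons]
  · simp; omega
  · simp; omega
  · simp [work, hσ.envL]; omega
  · simp [work, hσ.envL]; omega
  · simp [work]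
  · intro y hy; exact hw y (List.mem_reverse.1 hy)
  · simp [work]; omega
  · simp [work, hσ.envL]; omega
  · simp [work]
  · simp; omega
  · simp [work, hσ.envL]; omega
  · simp [work]; omega
  · simp [work, hσ.envL]; omega
  · have h1 : ones (r + 2) ++ ones (A.card - (r + 2)) = (ones A.card : List (Sym K)) := by
      rw [← ones_add]; congr 1; omega
    funext z
    simp only [Function.update_apply]
    cases z <;> simp [work, rankEnv, hσ.card, hσ.cardL, hσ.envL, h1]

/-- All elements of the universe have been treated. -/
theorem does_closeQuant_last (hσ : Idle π σ) {o : ArithOp} {q : Letter} {r x : ℕ} {w : List Letter}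
    {a b : K} {F rest cs vs env : List (Sym K)} (hw : ∀ y ∈ w, y.isSep = false)
    (hr : r + 1 = A.card)
    (hF : F.length + w.length + rest.length + 2 < H)
    (he : env.length + (encNat x).length + A.card + 2 ≤ H) :
    Does n H (closeQuant o q) (work σ (str w.reverse ++ .inl .sep :: F) rest cs
        (.inr b :: .inr a :: vs) (rankEnv r x env))
      (20 * (H + 1)) ()
      (work σ (str w.reverse ++ F) rest cs (.inr (o.apply a b) :: vs) env) := by
  refine .seq (does_arith (x := a) (y := b) rfl (by decide)) (by omega)
    (.seq (does_push (by decide) ?_) (by omega)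
    (.seq (does_compareCard (r := r + 1) (p := 0)
      (e := str (encNat x).reverse ++ .inl .var :: env) ?_ ?_ ?_ ?_) (by omega)
    (.seq (does_moveTop_nil ?_) (by omega)
    (.seq (does_moveAll (l := ones (r + 1)) ?_ (by decide) (by decide) ?_) ?_
    (.seq (does_moveUntil (w := (encNat x).reverse) (x := .var) (l := env) ?_ ?_ rfl (by decide)
      (by decide) ?_) ?_
    (.seq (does_clear rfl) ?_
    (.seq (does_moveUntil (w := w.reverse) (x := .sep) (l := F) ?_ ?_ rfl (by decide) (by decide) ?_)
      ?_
    (.seq does_pop ?_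
    ((does_moveAll (l := str w) ?_ (by decide) (by decide) ?_).weaken ?_ ?_)))))))))
  · simp [work, rankEnv]; omega
  · simp [work, rankEnv, ones_cons]
  · simp [work, hσ.card, hr]
  · simp [work, hσ.envL]; omega
  · simp [work, hσ.cardL]; omega
  · simp
  · simp [work, hσ.cardL]
  · simp; omega
  · simp; omega
  · simp [work]
  · intro y hy; exact isVar_of_isBit (isBit_encNat_reverse y hy)
  · simp [work, hσ.envL]; omega
  · simp; omega
  · simp [work, hσ.envL]; omega
  · simp [work]
  · intro y hy; exact hw y (List.mem_reverse.1 hy)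
  · simp [work, hσ.tmp]; omega
  · simp [work, hσ.envL]; omega
  · simp [work, hσ.envL]; omega
  · simp [work, hσ.tmp]
  · simp; omega
  · simp [work, hσ.envL]; omega
  · funext z
    simp only [Function.update_apply]
    cases z <;> simp [work, hσ.card, hσ.cardL, hσ.envL, hr, hσ.tmp]

end SemiringFO

namespace SemiringFO

universe u

variable {K : Type u} [CommSemiring K] {n H : ℕ} {σ : State K}
  {τ : Vocabulary} {A : Finset ℕ} {π : Literal τ A → K}

/-! ### Evaluation of formulas -/

/-- The end of a composed formula. -/
def closeFormula : Code K Unit :=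
  (pop .cs).bind fun t => match t with
    | .letter .and => arith .mul .vs
    | .letter .or => arith .add .vs
    | .letter .ex => closeQuant .add .ex
    | .letter .all => closeQuant .mul .all
    | _ => .pure ()

/-- Evaluating the formula on the stack `fR`; its value is pushed on the stack `vs`. -/
def evalLoop : Code K Unit :=
  .iter (fun _ : Unit => (moveTop .fR .fL).bind fun t => match t with
    | .letter .eq => (evalEq true).bind fun _ => .pure (.inl ())
    | .letter .neq => (evalEq false).bind fun _ => .pure (.inl ())
    | .letter .rel => (evalRel false).bind fun _ => .pure (.inl ())
    | .letter .nrel => (evalRel true).bind fun _ => .pure (.inl ())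
    | .letter .and => (push .cs .and).bind fun _ => .pure (.inl ())
    | .letter .or => (push .cs .or).bind fun _ => .pure (.inl ())
    | .letter .ex => (openQuant .ex 0).bind fun _ => .pure (.inl ())
    | .letter .all => (openQuant .all 1).bind fun _ => .pure (.inl ())
    | .letter .close => closeFormula.bind fun _ => .pure (.inl ())
    | _ => .pure (.inr ())) ()

section
variable {fL fR cs vs env l : List (Sym K)}
omit [CommSemiring K]

theorem update_work_fL : Function.update (work σ fL fR cs vs env) .fL l = work σ l fR cs vs env := by
  funext z
  simp only [Function.update_apply]
  cases z <;> rfl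

theorem update_work_fR : Function.update (work σ fL fR cs vs env) .fR l = work σ fL l cs vs env := by
  funext z
  simp only [Function.update_apply]
  cases z <;> rfl

theorem update_work_cs : Function.update (work σ fL fR cs vs env) .cs l = work σ fL fR l vs env := by
  funext z
  simp only [Function.update_apply]
  cases z <;> rfl

theorem update_work_vs : Function.update (work σ fL fR cs vs env) .vs l = work σ fL fR cs l env := by
  funext z
  simp only [Function.update_apply]
  cases z <;> rfl

end

theorem does_work_moveTop {fL fR cs vs env : List (Sym K)} {x : Sym K} (hH : fL.length < H) :
    Does n H (moveTop .fR .fL) (work σ fL (x :: fR) cs vs env) 1 (topOf (x :: fR))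
      (work σ (x :: fL) fR cs vs env) :=
  (does_moveTop (x := x) (l := fR) rfl (by decide) (by decide) hH).weaken le_rfl
    (by rw [update_work_fR, update_work_fL]; rfl)

/-- The first letter of a formula terminates the index that precedes it. -/
theorem encFormula_eq_cons (φ : Formula τ) : ∃ l w, encFormula φ = l :: w ∧ l.isBit = false := by
  cases φ <;> exact ⟨_, _, rfl, rfl⟩

theorem isSep_encVar {x : ℕ} : ∀ y ∈ encVar x, y.isSep = false := by
  intro y hy
  rcases List.mem_cons.1 hy with rfl | hy
  · rfl
  · have := isBit_encNat y hy
    cases y <;> first | rfl | cases this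

theorem isSep_encFormula (φ : Formula τ) : ∀ y ∈ encFormula φ, y.isSep = false := by
  have hrel : ∀ {k : ℕ} (x : Fin k → ℕ), ∀ y ∈ (List.ofFn x).flatMap encVar, y.isSep = false := by
    intro k x y hy
    obtain ⟨z, -, hy⟩ := List.mem_flatMap.1 hy
    exact isSep_encVar y hy
  have hnat : ∀ {x : ℕ}, ∀ y ∈ encNat x, y.isSep = false :=
    fun y hy => isSep_encVar y (List.mem_cons_of_mem _ hy)
  induction φ with
  | eq x y | neq x y =>
    intro z hz
    simp only [encFormula, List.mem_cons, List.mem_append, List.not_mem_nil, or_false] at hz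
    obtain rfl | (hz | hz) | rfl := hz
    exacts [rfl, isSep_encVar z hz, isSep_encVar z hz, rfl]
  | rel R x | nrel R x =>
    intro z hz
    simp only [encFormula, List.mem_cons, List.mem_append, List.not_mem_nil, or_false] at hz
    obtain rfl | (hz | hz) | rfl := hz
    exacts [rfl, hnat z hz, hrel x z hz, rfl]
  | and φ ψ ih ih' | or φ ψ ih ih' =>
    intro z hz
    simp only [encFormula, List.mem_cons, List.mem_append, List.not_mem_nil, or_false] at hz
    obtain rfl | (hz | hz) | rfl := hz
    exacts [rfl, ih z hz, ih' z hz, rfl]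
  | ex x φ ih | all x φ ih =>
    intro z hz
    simp only [encFormula, List.mem_cons, List.mem_append, List.not_mem_nil, or_false] at hz
    obtain rfl | (hz | hz) | rfl := hz
    exacts [rfl, isSep_encVar z hz, ih z hz, rfl]

/-- The nesting depth of the quantifiers. -/
def quantDepth : Formula τ → ℕ
  | .and φ ψ | .or φ ψ => max (quantDepth φ) (quantDepth ψ)
  | .ex _ φ | .all _ φ => quantDepth φ + 1
  | _ => 0

theorem quantDepth_add_two_le (φ : Formula τ) : quantDepth φ + 2 ≤ (encFormula φ).length := by
  induction φ with
  | eq | neq | rel | nrel =>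
    simp only [quantDepth, encFormula, List.length_cons, List.length_append, List.length_nil]
    omega
  | and φ ψ ih ih' | or φ ψ ih ih' =>
    simp only [quantDepth, encFormula, List.length_cons, List.length_append, List.length_nil]
    omega
  | ex x φ ih | all x φ ih =>
    simp only [quantDepth, encFormula, encVar, List.length_cons, List.length_append, List.length_nil]
    omega

/-- A bound for the number of units of time that the evaluation of a formula takes. -/
def evalCost (H m : ℕ) (φ : Formula τ) : ℕ :=
  200 * (H + 1) * (encFormula φ).length * m ^ quantDepth φ

omit [CommSemiring K] in
theorem envWord_cons {es : List (Entry A)} {x : ℕ} {a : A} :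
    (str (envWord ((x, a, true) :: es)) : List (Sym K)) =
      rankEnv (rank a) x (str (envWord es)) := by
  simp [envWord, Entry.item, itemWord, rankEnv, str, ones]

omit [CommSemiring K] in
theorem length_rankEnv {r x : ℕ} {env : List (Sym K)} :
    (rankEnv r x env).length = r + (encNat x).length + 2 + env.length := by
  simp [rankEnv]; omega

theorem rank_eq {l₁ l₂ : List A} {a : A} (h : elements A = l₁ ++ a :: l₂) : rank a = l₁.length := by
  have hn := nodup_elements A
  rw [h, List.nodup_append] at hn
  have ha : a ∉ l₁ := fun ha => hn.2.2 a ha a List.mem_cons_self rfl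
  rw [rank, h, List.idxOf_append_of_notMem ha, List.idxOf_cons_self, Nat.add_zero]

theorem does_evalLoop_close {σ₁ σ' : State K} {fL rest cs vs env : List (Sym K)} {u v : ℕ}
    (hH : fL.length < H)
    (h : Does n H closeFormula (work σ (.inl .close :: fL) rest cs vs env) u () σ₁)
    (h' : Does n H evalLoop σ₁ v () σ') :
    Does n H evalLoop (work σ fL (.inl .close :: rest) cs vs env) (u + 2 + v) () σ' := by
  exact .next (u := u + 1) (a' := ()) (.seq (does_work_moveTop hH) (by omega)
    (.seq h (by omega) (.done rfl))) (by omega) (h'.weaken (by omega) rfl)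

/-- The rounds of a quantifier. If the scope of the quantifier evaluates to `val a` for the element
`a`, then the rounds for all elements combine these values to the sum or product. -/
theorem does_rounds (hσ : Idle π σ) {o : ArithOp} {q : Letter}
    (hq : q = .ex ∧ o = .add ∨ q = .all ∧ o = .mul) {x c : ℕ} {w : List Letter}
    {val : A → K} {F rest cs vs : List (Sym K)} {es : List (Entry A)} {σ' : State K}
    (hw : ∀ y ∈ w, y.isSep = false)
    (hF : F.length + w.length + rest.length + 3 < H) (hc : cs.length < H)
    (he : (envWord es).length + (encNat x).length + A.card + 2 ≤ H)
    (hval : ∀ a acc v, Does n H evalLoop (work σ (str w.reverse ++ .inl .sep :: F)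
        (.inl .close :: rest) (.inl q :: cs) (.inr (val a) :: .inr acc :: vs)
        (rankEnv (rank a) x (str (envWord es)))) v () σ' →
      Does n H evalLoop (work σ (.inl .sep :: F) (str w ++ .inl .close :: rest) (.inl q :: cs)
        (.inr acc :: vs) (rankEnv (rank a) x (str (envWord es)))) (c + v) () σ')
    {l₁ l₂ : List A} {a : A} {acc : K} {v : ℕ} (hl : elements A = l₁ ++ a :: l₂)
    (h : Does n H evalLoop (work σ (.inl .close :: (str w.reverse ++ F)) rest cs
      (.inr ((a :: l₂).foldl (fun acc a => o.apply acc (val a)) acc) :: vs) (str (envWord es)))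
      v () σ') :
    Does n H evalLoop (work σ (.inl .sep :: F) (str w ++ .inl .close :: rest) (.inl q :: cs)
      (.inr acc :: vs) (rankEnv (rank a) x (str (envWord es))))
      ((c + 20 * (H + 1) + 3) * (l₂.length + 1) + v) () σ' := by
  have hw' : ∀ y ∈ w ++ [.close], y.isSep = false := by
    intro y hy
    rcases List.mem_append.1 hy with hy | hy
    · exact hw y hy
    · rw [List.mem_singleton.1 hy]; rfl
  have hcl : ∀ {fL vs env : List (Sym K)} {σ₁ : State K}, Does n H (closeQuant o q)
      (work σ fL rest cs vs env) (20 * (H + 1)) () σ₁ →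
      Does n H closeFormula (work σ fL rest (.inl q :: cs) vs env) (20 * (H + 1) + 1) () σ₁ := by
    intro fL vs env σ₁ hd
    refine .seq does_pop (by omega) ?_
    rw [update_work_cs]
    obtain ⟨rfl, rfl⟩ | ⟨rfl, rfl⟩ := hq <;> exact hd
  have hlen := length_elements A
  rw [hl] at hlen
  simp only [List.length_append, List.length_cons] at hlen
  have hra := rank_eq hl
  induction l₂ generalizing l₁ a acc with
  | nil =>
    have hd := does_closeQuant_last (n := n) (H := H) hσ (o := o) (q := q) (r := rank a) (x := x)
      (w := w ++ [.close]) (a := acc) (b := val a) (F := F) (rest := rest) (cs := cs) (vs := vs)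
      (env := str (envWord es)) hw' (by simp at hlen; omega) (by simp; omega) (by simpa using he)
    refine (hval a acc (20 * (H + 1) + 1 + 2 + v) (does_evalLoop_close (by simp; omega)
      (hcl (by simpa using hd)) (by simpa using h))).weaken ?_ rfl
    simp; omega
  | cons b l₂ ih =>
    have hl' : elements A = (l₁ ++ [a]) ++ b :: l₂ := by simpa using hl
    have hrb := rank_eq hl'
    simp only [List.length_append, List.length_cons, List.length_nil] at hrb hlen
    have hd := does_closeQuant_next (n := n) (H := H) hσ (o := o) (q := q) (r := rank a) (x := x)
      (w := w ++ [.close]) (a := acc) (b := val a) (F := F) (rest := rest) (cs := cs) (vs := vs)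
      (env := str (envWord es)) hw' (by omega) (by simp; omega) hc (by simpa using he)
    have hi := ih (l₁ := l₁ ++ [a]) (a := b) (acc := o.apply acc (val a)) hl' (by simpa using h)
      (by simp; omega) (by simp; omega)
    rw [show rank b = rank a + 1 by omega] at hi
    refine (hval a acc _ (does_evalLoop_close (by simp; omega)
      (hcl (by simpa using hd)) (by simpa using hi))).weaken ?_ rfl
    rw [List.length_cons, Nat.mul_succ _ (l₂.length + 1)]
    omega

/-- A quantified formula, given what the loop does on the scope of the quantifier. -/
theorem does_evalLoop_quant (hσ : Idle π σ) (hA : A.Nonempty) {o : ArithOp} {q : Letter} {k : K}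
    (hq : q = .ex ∧ o = .add ∧ k = 0 ∨ q = .all ∧ o = .mul ∧ k = 1) {x c : ℕ} {φ : Formula τ}
    {val : A → K} {fL rest cs vs : List (Sym K)} {es : List (Entry A)} {σ' : State K} {v : ℕ}
    (hF : fL.length + rest.length + 2 * (encFormula φ).length + (encNat x).length + 10 < H)
    (hc : cs.length < H) (hv : vs.length < H)
    (he : (envWord es).length + (encNat x).length + A.card + 2 < H)
    (hval : ∀ a acc v, Does n H evalLoop (work σ (str (encFormula φ).reverse ++ .inl .sep ::
        (str (encVar x).reverse ++ .inl q :: fL))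
        (.inl .close :: rest) (.inl q :: cs) (.inr (val a) :: .inr acc :: vs)
        (str (envWord ((x, a, true) :: es)))) v () σ' →
      Does n H evalLoop (work σ (.inl .sep :: (str (encVar x).reverse ++ .inl q :: fL))
        (str (encFormula φ) ++ .inl .close :: rest) (.inl q :: cs)
        (.inr acc :: vs) (str (envWord ((x, a, true) :: es)))) (c + v) () σ')
    (h : Does n H evalLoop (work σ (str (q :: (encVar x ++ encFormula φ ++ [.close])).reverse ++ fL)
      rest cs (.inr ((elements A).foldl (fun acc a => o.apply acc (val a)) k) :: vs)
      (str (envWord es))) v () σ') :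
    Does n H evalLoop (work σ fL (str (q :: (encVar x ++ encFormula φ ++ [.close])) ++ rest) cs vs
      (str (envWord es)))
      ((c + 20 * (H + 1) + 3) * A.card + (3 * (encNat x).length + 11) + v) () σ' := by
  obtain ⟨l, w, hφ, hl⟩ := encFormula_eq_cons φ
  obtain ⟨a, l₂, hl₂⟩ : ∃ a l₂, elements A = a :: l₂ := by
    cases h : elements A with
    | nil =>
      have h1 := length_elements A
      have h2 := hA.card_pos
      rw [h, List.length_nil] at h1
      omega
    | cons a l => exact ⟨a, l, rfl⟩
  have hra : rank a = 0 := rank_eq (l₁ := []) hl₂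
  have hcard := length_elements A
  rw [hl₂] at h hcard
  rw [List.length_cons] at hcard
  simp only [envWord_cons] at hval
  have hx : (encVar x).length = (encNat x).length + 1 := rfl
  have hlen : (encFormula φ).length = w.length + 1 := by rw [hφ]; rfl
  have hd := does_rounds (n := n) (H := H) hσ (o := o) (q := q) (by tauto) (x := x) (c := c)
    (w := encFormula φ) (val := val) (F := str (encVar x).reverse ++ .inl q :: fL) (rest := rest)
    (cs := cs) (vs := vs) (es := es) (isSep_encFormula φ) (by simp; omega) hc (by omega) hval
    (l₁ := []) (acc := k) hl₂ (by simpa using h)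
  rw [hra, hφ] at hd
  rw [hφ]
  rw [hcard] at hd
  have ho := does_openQuant (n := n) (H := H) (σ := σ) (q := q) (l := l) (k := k) (x := x) (w := w)
    (fL := .inl q :: fL) (rest := .inl .close :: rest) (cs := cs) (vs := vs)
    (env := str (envWord es)) hl (by simp; omega) (by simp; omega) hc hv (by simp; omega)
  have e : (str (q :: (encVar x ++ l :: w ++ [.close])) ++ rest : List (Sym K)) =
      .inl q :: (str (encVar x ++ l :: w) ++ .inl .close :: rest) := by simp
  rw [e]
  refine .next (u := 3 * (encNat x).length + 10) (a' := ()) (.seq (does_work_moveTop (by omega))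
    (by omega) ?_) (by omega) (hd.weaken (by omega) rfl)
  obtain ⟨rfl, rfl, rfl⟩ | ⟨rfl, rfl, rfl⟩ := hq <;>
    exact .seq ho (by omega) (.done rfl)

/-- The cost of an atom. -/
theorem le_evalCost {m : ℕ} {φ : Formula τ} (h : quantDepth φ = 0) :
    150 * (H + 1) * (encFormula φ).length + 2 ≤ evalCost H m φ ∧
      150 * (H + 1) + 2 ≤ evalCost H m φ := by
  have h2 := quantDepth_add_two_le φ
  have h3 : (H + 1) * 2 ≤ (H + 1) * (encFormula φ).length := Nat.mul_le_mul_left _ (by omega)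
  rw [evalCost, h, pow_zero, mul_one, mul_assoc, mul_assoc]
  omega

theorem sum_elements {val : A → K} :
    ∑ a, val a = (elements A).foldl (fun acc a => ArithOp.add.apply acc (val a)) 0 := by
  have h : ∀ (l : List A) (c : K), l.foldl (fun acc a => ArithOp.add.apply acc (val a)) c =
      c + (l.map val).sum := by
    intro l
    induction l with
    | nil => simp
    | cons a l ih =>
      intro c
      rw [List.foldl_cons, ih, List.map_cons, List.sum_cons, ← add_assoc]
      rfl
  rw [h, zero_add, ← List.sum_toFinset _ (nodup_elements A)]
  congr 1
  ext a; simp [mem_elements]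

theorem prod_elements {val : A → K} :
    ∏ a, val a = (elements A).foldl (fun acc a => ArithOp.mul.apply acc (val a)) 1 := by
  have h : ∀ (l : List A) (c : K), l.foldl (fun acc a => ArithOp.mul.apply acc (val a)) c =
      c * (l.map val).prod := by
    intro l
    induction l with
    | nil => simp
    | cons a l ih =>
      intro c
      rw [List.foldl_cons, ih, List.map_cons, List.prod_cons, ← mul_assoc]
      rfl
  rw [h, one_mul, ← List.prod_toFinset _ (nodup_elements A)]
  congr 1
  ext a; simp [mem_elements]

/-- A conjunction or disjunction, given what the loop does on the two subformulas. -/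
theorem does_evalLoop_binary (hA : A.Nonempty) {o : ArithOp} {q : Letter}
    (hq : q = .and ∧ o = .mul ∨ q = .or ∧ o = .add) {φ ψ χ : Formula τ} {k k' : K}
    {fL rest cs vs env : List (Sym K)} {σ' : State K} {v : ℕ}
    (hχ : encFormula χ = q :: (encFormula φ ++ encFormula ψ ++ [.close]))
    (hd : quantDepth χ = max (quantDepth φ) (quantDepth ψ))
    (hF : fL.length + rest.length + 2 * (encFormula χ).length + 10 < H)
    (hc : cs.length + (encFormula χ).length < H)
    (hφ : ∀ {v : ℕ}, Does n H evalLoop (work σ (str (encFormula φ).reverse ++ .inl q :: fL)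
        (str (encFormula ψ) ++ .inl .close :: rest) (.inl q :: cs) (.inr k :: vs) env) v () σ' →
      Does n H evalLoop (work σ (.inl q :: fL) (str (encFormula φ) ++
        (str (encFormula ψ) ++ .inl .close :: rest)) (.inl q :: cs) vs env)
        (evalCost H A.card φ + v) () σ')
    (hψ : ∀ {v : ℕ}, Does n H evalLoop (work σ (str (encFormula ψ).reverse ++
        (str (encFormula φ).reverse ++ .inl q :: fL))
        (.inl .close :: rest) (.inl q :: cs) (.inr k' :: .inr k :: vs) env) v () σ' →
      Does n H evalLoop (work σ (str (encFormula φ).reverse ++ .inl q :: fL)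
        (str (encFormula ψ) ++ .inl .close :: rest) (.inl q :: cs) (.inr k :: vs) env)
        (evalCost H A.card ψ + v) () σ')
    (h : Does n H evalLoop (work σ (str (encFormula χ).reverse ++ fL) rest cs
      (.inr (o.apply k k') :: vs) env) v () σ') :
    Does n H evalLoop (work σ fL (str (encFormula χ) ++ rest) cs vs env)
      (evalCost H A.card χ + v) () σ' := by
  have hcost : evalCost H A.card φ + evalCost H A.card ψ + 10 ≤ evalCost H A.card χ := by
    have h1 := Nat.pow_le_pow_right hA.card_pos (le_max_left (quantDepth φ) (quantDepth ψ))
    have h2 := Nat.pow_le_pow_right hA.card_pos (le_max_right (quantDepth φ) (quantDepth ψ))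
    have h3 := Nat.pow_le_pow_right hA.card_pos (Nat.zero_le (max (quantDepth φ) (quantDepth ψ)))
    have h4 : (encFormula χ).length = (encFormula φ).length + (encFormula ψ).length + 2 := by
      rw [hχ]; simp; omega
    rw [evalCost, evalCost, evalCost, hd, h4, Nat.mul_add _ (_ + _) 2, Nat.mul_add _ (encFormula φ).length,
      Nat.add_mul, Nat.add_mul]
    refine add_le_add (add_le_add (Nat.mul_le_mul_left _ h1) (Nat.mul_le_mul_left _ h2)) ?_
    calc 10 ≤ 200 * (H + 1) * 2 * 1 := by omega
      _ ≤ _ := Nat.mul_le_mul_left _ (by simpa using h3)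
  have hlen : (encFormula χ).length = (encFormula φ).length + (encFormula ψ).length + 2 := by
    rw [hχ]; simp; omega
  have hcl : Does n H closeFormula (work σ (.inl .close :: (str (encFormula ψ).reverse ++
      (str (encFormula φ).reverse ++ .inl q :: fL))) rest (.inl q :: cs)
      (.inr k' :: .inr k :: vs) env) 2 ()
      (work σ (str (encFormula χ).reverse ++ fL) rest cs (.inr (o.apply k k') :: vs) env) := by
    refine .seq does_pop (by omega) ?_
    rw [update_work_cs]
    obtain ⟨rfl, rfl⟩ | ⟨rfl, rfl⟩ := hq <;>
    · refine (does_arith (x := k) (y := k') rfl (by decide)).weaken (by omega) ?_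
      rw [update_work_vs, hχ]
      simp [work]
  have h1 := hφ (hψ (does_evalLoop_close (by simp; omega) hcl h))
  have e : (str (encFormula χ) ++ rest : List (Sym K)) =
      .inl q :: (str (encFormula φ) ++ (str (encFormula ψ) ++ .inl .close :: rest)) := by
    rw [hχ]; simp
  rw [e]
  refine .next (u := 2) (a' := ()) (.seq (does_work_moveTop (by omega)) (by omega) ?_) (by omega)
    (h1.weaken (by omega) rfl)
  obtain ⟨rfl, rfl⟩ | ⟨rfl, rfl⟩ := hq <;>
  · refine .seq (does_push (by decide) (by simp [work]; omega)) le_rfl (.done ?_)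
    rw [update_work_cs]; rfl

/-- The cost of a quantified formula: one round for every element of the universe. -/
theorem evalCost_quant {m x : ℕ} {φ χ : Formula τ} (hm : 0 < m)
    (hlen : (encFormula χ).length = (encNat x).length + (encFormula φ).length + 3)
    (hd : quantDepth χ = quantDepth φ + 1) :
    (evalCost H m φ + 20 * (H + 1) + 3) * m + (3 * (encNat x).length + 11) ≤ evalCost H m χ := by
  rw [evalCost, evalCost, hlen, hd, pow_succ]
  have h1 : 1 * m ≤ m ^ quantDepth φ * m := Nat.mul_le_mul_right _ (Nat.one_le_pow _ _ hm)
  rw [one_mul] at h1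
  have h2 : 200 * (H + 1) * ((encNat x).length + (encFormula φ).length + 3) * (m ^ quantDepth φ * m) =
      200 * (H + 1) * (encFormula φ).length * m ^ quantDepth φ * m +
      200 * ((H + 1) * ((encNat x).length * (m ^ quantDepth φ * m))) +
      600 * ((H + 1) * (m ^ quantDepth φ * m)) := by ring
  have h3 : (H + 1) * m ≤ (H + 1) * (m ^ quantDepth φ * m) := Nat.mul_le_mul_left _ h1
  have h4 : 1 * ((encNat x).length * 1) ≤ (H + 1) * ((encNat x).length * (m ^ quantDepth φ * m)) :=
    Nat.mul_le_mul (by omega) (Nat.mul_le_mul_left _ (by omega))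
  have h5 : 1 * m ≤ (H + 1) * m := Nat.mul_le_mul_right _ (by omega)
  have h6 : (200 * (H + 1) * (encFormula φ).length * m ^ quantDepth φ + 20 * (H + 1) + 3) * m =
      200 * (H + 1) * (encFormula φ).length * m ^ quantDepth φ * m + 20 * ((H + 1) * m) + 3 * m := by
    ring
  omega

/-- The loop evaluates the formula on the stack `fR`. As the evaluation of a subformula is not a
piece of code of its own, but a part of the run of the loop, this is stated as a property of the
remaining run: it is enough to know what the loop does after the formula has been read and its
value has been pushed. -/
theorem does_evalLoop (hσ : Idle π σ) (hA : A.Nonempty) (φ : Formula τ) {s : ℕ → A}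
    {fL rest cs vs : List (Sym K)} {es : List (Entry A)} {σ' : State K} {v : ℕ}
    (hs : ∀ x ∈ φ.freeVars, Binds es x (s x))
    (hF : fL.length + rest.length + 2 * (encFormula φ).length + 10 < H)
    (hc : cs.length + (encFormula φ).length < H) (hv : vs.length + (encFormula φ).length < H)
    (he : (envWord es).length + (encFormula φ).length * (A.card + 1) < H)
    (h : Does n H evalLoop (work σ (str (encFormula φ).reverse ++ fL) rest cs
      (.inr (φ.eval π s) :: vs) (str (envWord es))) v () σ') :
    Does n H evalLoop (work σ fL (str (encFormula φ) ++ rest) cs vs (str (envWord es)))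
      (evalCost H A.card φ + v) () σ' := by
  induction φ generalizing s fL rest cs vs es v with
  | eq x y =>
    have hd := does_evalEq (n := n) (H := H) hσ (hs x (by simp [Formula.freeVars]))
      (hs y (by simp [Formula.freeVars])) (b := true) (l := .eq) (fL := fL) (rest := rest) (cs := cs)
      (vs := vs) (by simp [encFormula] at hF; omega) (by omega)
    have hcost := le_evalCost (H := H) (m := A.card) (φ := Formula.eq (τ := τ) x y) rfl
    have e : (Formula.eq x y).eval π s = if decide (s x = s y) = true then 1 else 0 := by
      simp [Formula.eval]
    rw [e] at h
    exact .next (u := 150 * (H + 1) + 1) (a' := ()) (.seq (does_work_moveTop (by omega))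
      (by omega) (.seq hd (by omega) (.done rfl))) (by omega) (h.weaken (by omega) rfl)
  | neq x y =>
    have hd := does_evalEq (n := n) (H := H) hσ (hs x (by simp [Formula.freeVars]))
      (hs y (by simp [Formula.freeVars])) (b := false) (l := .neq) (fL := fL) (rest := rest) (cs := cs)
      (vs := vs) (by simp [encFormula] at hF; omega) (by omega)
    have hcost := le_evalCost (H := H) (m := A.card) (φ := Formula.neq (τ := τ) x y) rfl
    have e : (Formula.neq x y).eval π s = if decide (s x = s y) = false then 1 else 0 := by
      simp [Formula.eval]
    rw [e] at h
    exact .next (u := 150 * (H + 1) + 1) (a' := ()) (.seq (does_work_moveTop (by omega))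
      (by omega) (.seq hd (by omega) (.done rfl))) (by omega) (h.weaken (by omega) rfl)
  | rel R x =>
    have hd := does_evalRel (n := n) (H := H) hσ hA (s := s) (neg := false) (l := .rel) (R := R)
      (x := x) (fL := fL) (rest := rest) (cs := cs) (vs := vs)
      (fun i => hs _ (Set.mem_range_self i))
      (by simp only [encFormula, List.length_cons] at hF; omega) (by omega)
    have hcost := le_evalCost (H := H) (m := A.card) (φ := Formula.rel R x) rfl
    exact .next (u := 150 * (H + 1) * (encFormula (.rel R x)).length + 1) (a' := ())
      (.seq (does_work_moveTop (by omega)) (by omega) (.seq hd (by simp [encFormula]) (.done rfl)))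
      (by omega) (h.weaken (by omega) rfl)
  | nrel R x =>
    have hd := does_evalRel (n := n) (H := H) hσ hA (s := s) (neg := true) (l := .nrel) (R := R)
      (x := x) (fL := fL) (rest := rest) (cs := cs) (vs := vs)
      (fun i => hs _ (Set.mem_range_self i))
      (by simp only [encFormula, List.length_cons] at hF; omega) (by omega)
    have hcost := le_evalCost (H := H) (m := A.card) (φ := Formula.nrel R x) rfl
    exact .next (u := 150 * (H + 1) * (encFormula (.nrel R x)).length + 1) (a' := ())
      (.seq (does_work_moveTop (by omega)) (by omega) (.seq hd (by simp [encFormula]) (.done rfl)))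
      (by omega) (h.weaken (by omega) rfl)
  | and φ ψ ih ih' =>
    have hlen : (encFormula (.and φ ψ)).length = (encFormula φ).length + (encFormula ψ).length + 2 := by
      simp [encFormula]; omega
    have hmul : ((encFormula φ).length + (encFormula ψ).length + 2) * (A.card + 1) =
      (encFormula φ).length * (A.card + 1) + (encFormula ψ).length * (A.card + 1) +
        2 * (A.card + 1) := by ring
    refine does_evalLoop_binary hA (Or.inl ⟨rfl, rfl⟩) (k := φ.eval π s) (k' := ψ.eval π s) rfl rfl hF hc
      (fun h => ih (fun x hx => hs x (Or.inl hx)) ?_ ?_ ?_ ?_ h)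
      (fun h => ih' (fun x hx => hs x (Or.inr hx)) ?_ ?_ ?_ ?_ h) h
    all_goals rw [hlen] at hF hc hv he
    all_goals
      try simp only [List.length_cons, List.length_append, length_str, List.length_reverse]
      omega
  | or φ ψ ih ih' =>
    have hlen : (encFormula (.or φ ψ)).length = (encFormula φ).length + (encFormula ψ).length + 2 := by
      simp [encFormula]; omega
    have hmul : ((encFormula φ).length + (encFormula ψ).length + 2) * (A.card + 1) =
      (encFormula φ).length * (A.card + 1) + (encFormula ψ).length * (A.card + 1) +
        2 * (A.card + 1) := by ring
    refine does_evalLoop_binary hA (Or.inr ⟨rfl, rfl⟩) (k := φ.eval π s) (k' := ψ.eval π s) rfl rfl hF hc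
      (fun h => ih (fun x hx => hs x (Or.inl hx)) ?_ ?_ ?_ ?_ h)
      (fun h => ih' (fun x hx => hs x (Or.inr hx)) ?_ ?_ ?_ ?_ h) h
    all_goals rw [hlen] at hF hc hv he
    all_goals
      try simp only [List.length_cons, List.length_append, length_str, List.length_reverse]
      omega
  | ex x φ ih =>
    have hlen : (encFormula (.ex x φ)).length = (encNat x).length + (encFormula φ).length + 3 := by
      simp [encFormula, encVar]; omega
    have hmul : ((encNat x).length + (encFormula φ).length + 3) * (A.card + 1) =
      (encNat x).length * (A.card + 1) + (encFormula φ).length * (A.card + 1) + 3 * (A.card + 1) := by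
      ring
    have hmul' : (encNat x).length * 1 ≤ (encNat x).length * (A.card + 1) :=
      Nat.mul_le_mul_left _ (by omega)
    have hcost := evalCost_quant (H := H) hA.card_pos hlen rfl
    have e : (Formula.ex x φ).eval π s = _ := sum_elements
    rw [e] at h
    rw [hlen] at hF hc hv he
    refine (does_evalLoop_quant hσ hA (c := evalCost H A.card φ) (Or.inl ⟨rfl, rfl, rfl⟩) (by omega)
      (by omega) (by omega) (by omega) (fun a acc v h => ih (s := Function.update s x a)
        (fun y hy => binds_cons a true fun hne => hs y ⟨hy, hne⟩) ?_ ?_ ?_ ?_ h) h).weaken ?_ rfl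
    · simp [encVar]; omega
    · simp; omega
    · simp; omega
    · have hr := rank_lt a
      have := congrArg List.length (envWord_cons (K := K) (es := es) (x := x) (a := a))
      rw [length_rankEnv, length_str, length_str] at this
      omega
    · omega
  | all x φ ih =>
    have hlen : (encFormula (.all x φ)).length = (encNat x).length + (encFormula φ).length + 3 := by
      simp [encFormula, encVar]; omega
    have hmul : ((encNat x).length + (encFormula φ).length + 3) * (A.card + 1) =
      (encNat x).length * (A.card + 1) + (encFormula φ).length * (A.card + 1) + 3 * (A.card + 1) := by
      ring
    have hmul' : (encNat x).length * 1 ≤ (encNat x).length * (A.card + 1) :=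
      Nat.mul_le_mul_left _ (by omega)
    have hcost := evalCost_quant (H := H) hA.card_pos hlen rfl
    have e : (Formula.all x φ).eval π s = _ := prod_elements
    rw [e] at h
    rw [hlen] at hF hc hv he
    refine (does_evalLoop_quant hσ hA (c := evalCost H A.card φ) (Or.inr ⟨rfl, rfl, rfl⟩) (by omega)
      (by omega) (by omega) (by omega) (fun a acc v h => ih (s := Function.update s x a)
        (fun y hy => binds_cons a true fun hne => hs y ⟨hy, hne⟩) ?_ ?_ ?_ ?_ h) h).weaken ?_ rfl
    · simp [encVar]; omega
    · simp; omega
    · simp; omega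
    · have hr := rank_lt a
      have := congrArg List.length (envWord_cons (K := K) (es := es) (x := x) (a := a))
      rw [length_rankEnv, length_str, length_str] at this
      omega
    · omega

end SemiringFO

namespace SemiringFO

universe u

variable {K : Type u} [CommSemiring K] {n H : ℕ} {σ : State K}
  {τ : Vocabulary} {A : Finset ℕ} {π : Literal τ A → K}

/-! ### Reading the input -/

/-- Distributing an interpretation to the stacks `vocL` and `valL`. -/
def readInterpretation : Code K Unit :=
  .iter (fun _ : Unit => (moveTop .inp .vocL).bind fun t => match t with
    | .letter .sep => (pop .vocL).bind fun _ => .pure (.inr ())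
    | .val => (moveTop .vocL .valL).bind fun _ => .pure (.inl ())
    | _ => .pure (.inl ())) ()

theorem does_readInterpretation {w : List Letter} {l : List K} {rest : List (Sym K)}
    (h : σ .inp = str w ++ (l.map .inr ++ .inl .sep :: rest)) (hw : ∀ y ∈ w, y.isSep = false)
    (hH : (σ .vocL).length + w.length < H) (hvH : (σ .valL).length + l.length ≤ H) :
    Does n H readInterpretation σ (2 * w.length + 3 * l.length + 3) ()
      (Function.update (Function.update (Function.update σ .inp rest) .vocL
        (str w.reverse ++ σ .vocL)) .valL ((l.map .inr).reverse ++ σ .valL)) := by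
  induction w generalizing σ with
  | nil =>
    simp only [str_nil, List.nil_append, List.length_nil, Nat.mul_zero, Nat.zero_add, List.reverse_nil,
      Nat.add_zero] at h hH ⊢
    induction l generalizing σ with
    | nil =>
      refine .last (u := 2) (.seq (does_moveTop (x := .inl .sep) (l := rest) h (by decide)
        (by decide) hH) (by omega) (.seq does_pop (by omega) (.done (funext fun z => ?_)))) (by simp)
      simp only [Function.update_apply]
      cases z <;> simp
    | cons a l ih =>
      simp only [List.map_cons, List.cons_append, List.length_cons] at h hvH ⊢
      refine .next (u := 2) (a' := ()) (.seq (does_moveTop (x := .inr a) (l := l.map .inr ++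
        .inl .sep :: rest) h (by decide) (by decide) hH) (by omega) (.seq (does_moveTop
        (x := .inr a) (l := σ .vocL) (by simp) (by decide) (by decide) (by simp; omega)) (by omega)
        (.done rfl))) (by omega) ((ih (by simp) (by simpa using hH) (by simp; omega)).weaken
          (by omega) (funext fun z => ?_))
      simp only [Function.update_apply]
      cases z <;> simp
  | cons y w ih =>
    have hy := hw y List.mem_cons_self
    simp only [str_cons, List.cons_append, List.length_cons] at h hH ⊢
    refine .next (u := 1) (a' := ()) (.seq (does_moveTop (x := .inl y) (l := str w ++ (l.map .inr ++
      .inl .sep :: rest)) h (by decide) (by decide) (by omega)) (by omega)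
      (σ₂ := Function.update (Function.update σ .inp (str w ++ (l.map .inr ++
        .inl .sep :: rest))) .vocL (.inl y :: σ .vocL)) ?_) (by omega)
      ((ih (by simp) (fun z hz => hw z (List.mem_cons_of_mem _ hz)) (by simp; omega)
        (by simpa using hvH)).weaken (by omega) (funext fun z => ?_))
    · cases y <;> first | exact .done rfl | cases hy
    · simp only [Function.update_apply]
      cases z <;> simp

/-- Reading the universe and counting its elements. -/
def readSet : Code K Unit :=
  .iter (fun _ : Unit => (moveTop .inp .set).bind fun t => match t with
    | .letter .elem => (push .card .one).bind fun _ => .pure (.inl ())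
    | .letter _ => .pure (.inl ())
    | _ => .pure (.inr ())) ()

theorem does_readSet {w : List Letter} (h : σ .inp = str w)
    (hH : (σ .set).length + w.length ≤ H) (hcH : (σ .card).length + w.length ≤ H) :
    Does n H readSet σ (3 * w.length + 2) ()
      (Function.update (Function.update (Function.update σ .inp []) .set
        (str w.reverse ++ σ .set)) .card (ones (w.countP Letter.isElem) ++ σ .card)) := by
  induction w generalizing σ with
  | nil =>
    refine .last (u := 1) (.seq (does_moveTop_nil h) le_rfl (.done (funext fun z => ?_))) (by simp)
    simp only [Function.update_apply]
    cases z <;> simp [h]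
  | cons y w ih =>
    simp only [List.length_cons] at hH hcH ⊢
    have h1 := does_moveTop (n := n) (H := H) (σ := σ) (x := .inl y) (l := str w) (i := .inp)
      (j := .set) h (by decide) (by decide) (by omega)
    by_cases hy : y.isElem = true
    · obtain rfl : y = .elem := by cases y <;> first | rfl | cases hy
      refine .next (u := 2) (a' := ()) (.seq h1 (by omega) (.seq (does_push (by decide)
        (by simp; omega)) (by omega) (.done rfl))) (by omega)
        ((ih (by simp) (by simp; omega) (by simp; omega)).weaken (by omega) (funext fun z => ?_))
      simp only [Function.update_apply]
      cases z <;> simp [ones_succ, List.countP_cons_of_pos (p := Letter.isElem) (l := w) hy]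
    · refine .next (u := 1) (a' := ()) (.seq h1 (by omega)
        (σ₂ := Function.update (Function.update σ .inp (str w)) .set (.inl y :: σ .set)) ?_) (by omega)
        ((ih (by simp) (by simp; omega) (by simp; omega)).weaken (by omega) (funext fun z => ?_))
      · cases y <;> first | exact .done rfl | exact absurd rfl hy
      · simp only [Function.update_apply]
        cases z <;> simp [hy]

theorem countP_encSet (A : Finset ℕ) : (encSet A).countP Letter.isElem = A.card := by
  rw [encSet_eq, ← length_elements]
  have h : ∀ x : ℕ, (encNat x).countP Letter.isElem = 0 := fun x =>
    List.countP_eq_zero.2 fun y hy => by simp [isElem_of_isBit (isBit_encNat y hy)]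
  induction elements A with
  | nil => rfl
  | cons a l ih =>
    rw [List.flatMap_cons, List.countP_append, ih, encElem, List.countP_cons_of_pos rfl, h,
      List.length_cons]
    omega

/-- Distributing the input to the stacks. -/
def readInput : Code K Unit :=
  (moveUntil Letter.isSep .inp .fL none).bind fun _ => (pop .fL).bind fun _ =>
  (moveAll .fL .fR).bind fun _ => readInterpretation.bind fun _ => (moveAll .vocL .voc).bind fun _ =>
  (moveAll .valL .val).bind fun _ => (moveUntil Letter.isSep .inp .env none).bind fun _ =>
  (pop .env).bind fun _ => readSet

/-- The stacks before the input is read. -/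
def initial (w : List (Sym K)) : State K
  | .inp => w
  | _ => []

/-- The stacks after the input has been read. -/
def ready (φ : Formula τ) (π : Literal τ A → K) (V : List ℕ) (s : ℕ → A) : State K
  | .fR => str (encFormula φ)
  | .env => str (encAssignment V s).reverse
  | .set => str (encSet A).reverse
  | .card => ones A.card
  | .voc => str (encVocabulary τ)
  | .val => (encValues π).map .inr
  | _ => []

theorem isSep_encVocabulary (τ : Vocabulary) : ∀ y ∈ encVocabulary τ, y.isSep = false := by
  intro y hy
  obtain ⟨k, -, hy⟩ := List.mem_flatMap.1 hy
  rcases List.mem_cons.1 hy with rfl | hy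
  · rfl
  · rw [List.eq_of_mem_replicate hy]; rfl

theorem isSep_encAssignment (V : List ℕ) (s : ℕ → A) :
    ∀ y ∈ encAssignment V s, y.isSep = false := by
  intro y hy
  obtain ⟨x, -, hy⟩ := List.mem_flatMap.1 hy
  rcases List.mem_append.1 hy with hy | hy
  · exact isSep_encVar y hy
  · rcases List.mem_cons.1 hy with rfl | hy
    · rfl
    · exact isSep_encVar (x := s x) y (List.mem_cons_of_mem _ hy)

theorem does_readInput (φ : Formula τ) (V : List ℕ) (s : ℕ → A) (hH : inputSize φ π V s + 3 ≤ H) :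
    Does n H readInput (initial (encInput φ π V s)) (20 * (H + 1)) () (ready φ π V s) := by
  unfold inputSize encInterpretation at hH
  simp only [List.length_append, List.length_map] at hH
  refine .seq (does_moveUntil (w := encFormula φ) (x := .sep) (l := (encInterpretation π ++
      Sum.inl .sep :: ((encAssignment V s).map Sum.inl ++
      Sum.inl .sep :: (encSet A).map Sum.inl))) rfl (isSep_encFormula φ) rfl (by decide) (by decide)
      ?_) ?_
    (.seq does_pop ?_
    (.seq (does_moveAll (l := str (encFormula φ).reverse) ?_ (by decide) (by decide) ?_) ?_
    (.seq (does_readInterpretation (w := encVocabulary τ) (l := encValues π)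
      (rest := (encAssignment V s).map Sum.inl ++ Sum.inl .sep :: (encSet A).map Sum.inl)
      ?_ (isSep_encVocabulary τ) ?_ ?_) ?_
    (.seq (does_moveAll (l := str (encVocabulary τ).reverse) ?_ (by decide) (by decide) ?_) ?_
    (.seq (does_moveAll (l := ((encValues π).map .inr).reverse) ?_ (by decide) (by decide) ?_) ?_
    (.seq (does_moveUntil (w := encAssignment V s) (x := .sep) (l := (encSet A).map Sum.inl) ?_
      (isSep_encAssignment V s) rfl (by decide) (by decide) ?_) ?_
    (.seq does_pop ?_
    ((does_readSet (w := encSet A) ?_ ?_ ?_).weaken ?_ ?_))))))))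
  · simp [initial]; omega
  · omega
  · omega
  · simp [initial]
  · simp [initial]; omega
  · simp; omega
  · simp [initial, encInterpretation, str]
  · simp [initial]; omega
  · simp [initial]; omega
  · simp; omega
  · simp [initial]
  · simp [initial]; omega
  · simp; omega
  · simp [initial]
  · simp [initial]; omega
  · simp; omega
  · simp [initial, str]
  · simp [initial]; omega
  · simp; omega
  · simp; omega
  · simp [str]
  · simp [initial]; omega
  · simp [initial]; omega
  · simp; omega
  · rw [countP_encSet]
    funext z
    simp only [Function.update_apply]
    cases z <;> simp [initial, ready]

omit [CommSemiring K] in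
theorem idle_ready (φ : Formula τ) (π : Literal τ A → K) (V : List ℕ) (s : ℕ → A) :
    Idle π (ready φ π V s) := by
  constructor <;> rfl

omit [CommSemiring K] in
theorem ready_eq_work (φ : Formula τ) (π : Literal τ A → K) (V : List ℕ) (s : ℕ → A) :
    ready φ π V s = work (ready φ π V s) [] (str (encFormula φ) ++ []) [] []
      (str (envWord (V.reverse.map fun x => (x, s x, false)))) := by
  rw [← encAssignment_reverse, List.append_nil]
  funext z
  cases z <;> rfl

/-! ### The machine -/

/-- Marking the cell to which all operations return. -/
def markHome : Code K Unit :=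
  (moveBy .right 1).bind fun _ => .prim fun _ => ((), ⟨.sym .home, none, .id⟩)

theorem runs_markHome {w : List (Sym K)} {m : Mem K}
    (htape : ∀ i, m.tape i = if 1 ≤ i then cellOf w[(i - 1).toNat]? else .inl .blank)
    (hhead : m.head = 1) :
    ∃ m', (markHome : Code K Unit).Runs (low H) (w.length + 1) 2 m () m' ∧
      Rep w.length H (initial w) m' := by
  have hlow : low H ≤ 0 := by unfold low; omega
  have h1 := runs_moveBy (lo := low H) (hi := w.length + 1) .right 1 (m := m) (by omega) (by omega)
    (by rw [hhead]; simp only [Shift.move]; omega) (by rw [hhead]; simp only [Shift.move]; omega)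
  have e : m.head + (1 : ℕ) * Shift.right.move = 0 := by rw [hhead]; rfl
  rw [e] at h1
  refine ⟨⟨m.reg, Function.update m.tape 0 (.inl .home), 0⟩, Code.Runs.mono (T := 1 + 1)
    (h1.bind (Code.runs_prim hlow ?_ rfl ?_)) le_rfl, ?_⟩
  · simp only; omega
  · simp [Mem.act, Mem.written, Mem.loaded, Shift.move]
  have hneg : ∀ z : ℤ, z < 0 → Function.update m.tape 0 (.inl .home) z = .inl .blank := by
    intro z hz
    rw [Function.update_of_ne hz.ne, htape, if_neg (by omega)]
  have hpos : ∀ i j, pos i j < 0 := fun i j => by unfold pos; omega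
  refine ⟨rfl, by simp, ?_, fun j => hneg _ (hpos _ _), ?_, le_rfl, ?_, ?_⟩
  · intro i hi j
    simp only
    rw [hneg _ (hpos _ _)]
    cases i <;> first | rfl | exact absurd rfl hi
  · intro i hi
    cases i <;> first | exact Nat.zero_le _ | exact absurd rfl hi
  · intro j hj
    simp only [initial] at hj
    omega
  · intro j
    simp only [initial]
    rw [Function.update_of_ne (by omega), htape, if_pos (by omega)]
    congr 2
    omega

/-- Writing the value on top of the stack `vs` as output. -/
def output : Code K Unit :=
  (popReg .vs false).bind fun _ => (emitReg false).bind fun _ => (moveBy .left 1).bind fun _ =>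
    .prim fun _ => ((), ⟨.sym .blank, none, .right⟩)

theorem runs_output {m : Mem K} {k : K} {l : List (Sym K)} (hm : Rep n H σ m) (hn : n ≤ H)
    (h : σ .vs = .inr k :: l) :
    ∃ m', output.Runs (low H) (n + 1) (90 * (H + 2) + 4) m () m' ∧ m'.head = 0 ∧
      m'.tape 0 = .inr k ∧ m'.tape 1 = .inl .blank := by
  have hlow : low H ≤ 0 := by unfold low; omega
  obtain ⟨m₁, h1, h2, h3⟩ := runs_popReg hm hn .vs false
  have h4 := runs_emitReg (ρ := m₁.reg) (τ := m₁.tape) (lo := low H) (hi := n + 1) (p := 0) hlow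
    (by omega) false
  have hreg : m₁.reg false = k := by rw [h3, h]; simp [loadTop]
  have e : (⟨m₁.reg, m₁.tape, 0⟩ : Mem K) = m₁ := by rw [← h2.head]
  rw [e, hreg] at h4
  have h5 := runs_moveBy (lo := low H) (hi := n + 1) .left 1
    (m := ⟨m₁.reg, Function.update m₁.tape 0 (cellOf (some (.inr k))), 0⟩) hlow (by simp only; omega)
    (by simp only [Shift.move]; omega) (by simp only [Shift.move]; omega)
  refine ⟨⟨m₁.reg, Function.update (Function.update m₁.tape 0 (cellOf (some (.inr k)))) 1
    (.inl .blank), 0⟩, Code.Runs.mono (h1.bind (h4.bind (h5.bind (Code.runs_prim ?_ ?_ rfl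
      ?_)))) (T := 90 * (H + 2) + (2 + (1 + 1))) (by omega), rfl, ?_, ?_⟩
  · simp only [Shift.move]; omega
  · simp only [Shift.move]; omega
  · simp [Mem.act, Mem.written, Mem.loaded, Shift.move]
  · simp [cellOf]
  · simp

/-- The program of the machine. -/
def program : Code K Unit :=
  markHome.bind fun _ => (readInput.bind fun _ => evalLoop).bind fun _ => output

theorem does_readInput_evalLoop (φ : Formula τ) (π : Literal τ A → K) (V : List ℕ) (s : ℕ → A)
    (hA : A.Nonempty) (hV : ∀ x ∈ φ.freeVars, x ∈ V) (hH : inputSize φ π V s + 3 ≤ H)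
    (hH' : 2 * (encFormula φ).length + 10 < H)
    (hH'' : (encAssignment V s).length + (encFormula φ).length * (A.card + 1) < H) :
    Does n H (readInput.bind fun _ => evalLoop) (initial (encInput φ π V s))
      (20 * (H + 1) + (evalCost H A.card φ + 2)) ()
      (work (ready φ π V s) (str (encFormula φ).reverse ++ []) [] [] [.inr (φ.eval π s)]
        (str (envWord (V.reverse.map fun x => (x, s x, false))))) := by
  have h := does_readInput (n := n) (π := π) φ V s hH
  rw [ready_eq_work] at h
  refine h.bind ?_
  refine does_evalLoop (idle_ready φ π V s) hA φ
    (fun x hx => binds_map (List.mem_reverse.2 (hV x hx))) ?_ ?_ ?_ ?_ ?_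
  · simpa using hH'
  · simp; omega
  · simp; omega
  · rw [← encAssignment_reverse, List.length_reverse]; exact hH''
  · exact .last (u := 1) (.seq (does_moveTop_nil rfl) le_rfl (.done rfl)) le_rfl

/-- The machine evaluates the formula. Here `H` is a bound for the heights of all stacks. -/
theorem computesWithin_program (φ : Formula τ) (π : Literal τ A → K) (V : List ℕ) (s : ℕ → A)
    (hA : A.Nonempty) (hV : ∀ x ∈ φ.freeVars, x ∈ V) (hH : inputSize φ π V s + 3 ≤ H)
    (hH' : 2 * (encFormula φ).length + 10 < H)
    (hH'' : (encAssignment V s).length + (encFormula φ).length * (A.card + 1) < H) :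
    (program : Code K Unit).toKTM.ComputesWithin
      ((encInput φ π V s).map (Sum.map Cell.letter id)) [Sum.inr (φ.eval π s)]
      ((20 * (H + 1) + (evalCost H A.card φ + 2)) * unitTime H + 90 * (H + 2) + 6)
      (inputSize φ π V s + 22 * (H + 2) + 5) := by
  have hlen : (encInput φ π V s).length = inputSize φ π V s + 3 := by
    simp [encInput, inputSize]; omega
  set w := encInput φ π V s with hw
  obtain ⟨m₁, h1, hm₁⟩ := runs_markHome (H := H) (w := w)
    (m := ⟨((program : Code K Unit).toKTM.init (w.map (Sum.map Cell.letter id))).reg,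
      ((program : Code K Unit).toKTM.init (w.map (Sum.map Cell.letter id))).tape, 1⟩) (by
      intro i
      simp only [KTM.init]
      split_ifs with hi
      · rw [List.getD_eq_getElem?_getD, List.getElem?_map]
        rcases w[(i - 1).toNat]? with _ | _ | _ <;> rfl
      · rfl) rfl
  obtain ⟨m₂, h2, hm₂⟩ := does_readInput_evalLoop (n := w.length) φ π V s hA hV hH hH' hH''
    (by omega) m₁ hm₁
  obtain ⟨m₃, h3, h4, h5, h6⟩ := runs_output hm₂ (by omega) rfl
  have h : (program : Code K Unit).Runs (low H) (w.length + 1) _ _ () m₃ := h1.bind (h2.bind h3)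
  refine Code.Runs.computesWithin (h.mono (by omega)) ?_ ?_ ?_ ?_ ?_ ?_ ?_
  · rw [h4]; unfold low; omega
  · rw [h4]; omega
  · unfold low; omega
  · intro a ha
    obtain ⟨x, -, rfl⟩ := List.mem_map.1 ha
    rcases x with _ | _ <;> nofun
  · intro a ha
    rw [List.mem_singleton.1 ha]; nofun
  · intro i hi
    obtain rfl : i = 0 := Nat.lt_one_iff.1 hi
    rw [h4]; exact h5
  · rw [h4]; exact h6

/-- The bound for the number of steps. Its factor `m ^ 2` is absorbed in `m ^ L`, because the formula
is longer than the nesting depth of its quantifiers. -/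
theorem steps_le {n m L H : ℕ} {φ : Formula τ} (hn : 0 < n) (hm : 0 < m)
    (hL : L = (encFormula φ).length) (hH : H = 20 * (n * m)) :
    (20 * (H + 1) + (evalCost H m φ + 2)) * unitTime H + 90 * (H + 2) + 6 ≤
      34000000 * n ^ 2 * L * m ^ L := by
  have hd := quantDepth_add_two_le φ
  rw [← hL] at hd
  have hP : 1 ≤ n * m := Nat.mul_pos hn hm
  set P := n * m with hPdef
  set D := m ^ quantDepth φ with hD
  have hD1 : 1 ≤ D := Nat.one_le_pow _ _ hm
  have hLD : 1 ≤ L * D := Nat.mul_pos (by omega) hD1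
  -- all quantities are bounded by multiples of `P * (L * D)` and of `P`
  have h1 : evalCost H m φ ≤ 4200 * (P * (L * D)) := by
    rw [evalCost, ← hL, ← hD]
    calc 200 * (H + 1) * L * D = 200 * ((H + 1) * (L * D)) := by ring
      _ ≤ 200 * ((21 * P) * (L * D)) := by gcongr; omega
      _ = _ := by ring
  have h2 : P * 1 ≤ P * (L * D) := Nat.mul_le_mul_left _ hLD
  have h3 : 20 * (H + 1) + (evalCost H m φ + 2) ≤ 5000 * (P * (L * D)) := by omega
  have h4 : unitTime H ≤ 6600 * P := by unfold unitTime; omega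
  have h5 : P * 1 ≤ P * (P * (L * D)) := Nat.mul_le_mul_left _ (by omega)
  calc (20 * (H + 1) + (evalCost H m φ + 2)) * unitTime H + 90 * (H + 2) + 6
      ≤ 5000 * (P * (L * D)) * (6600 * P) + 2000 * P :=
        add_le_add_three (Nat.mul_le_mul h3 h4) le_rfl le_rfl |>.trans (by omega)
    _ = 33000000 * (P * (P * (L * D))) + 2000 * P := by ring
    _ ≤ 34000000 * (P * (P * (L * D))) := by omega
    _ = 34000000 * n ^ 2 * L * m ^ (quantDepth φ + 2) := by rw [hPdef, hD]; ring
    _ ≤ 34000000 * n ^ 2 * L * m ^ L := Nat.mul_le_mul_left _ (Nat.pow_le_pow_right hm hd)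

end SemiringFO

theorem mainTheorem2 {K : Type*} [CommSemiring K] [Nontrivial K]
    (hK : SemiringFO.IsPositiveSemiring K) :
    ∃ (M : SemiringFO.KTM K) (ι : SemiringFO.Letter → M.Γ) (C : ℕ) (p : Polynomial ℕ),
      Function.Injective ι ∧
      ∀ (τ : SemiringFO.Vocabulary) (A : Finset ℕ) (φ : SemiringFO.Formula τ)
        (π : SemiringFO.Literal τ A → K) (V : List ℕ) (s : ℕ → A),
        A.Nonempty → (∀ x ∈ φ.freeVars, x ∈ V) →
        M.ComputesWithin
          ((SemiringFO.encInput φ π V s).map (Sum.map ι id))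
          [Sum.inr (φ.eval π s)]
          (C * (SemiringFO.inputSize φ π V s) ^ 2 * (SemiringFO.encFormula φ).length *
            A.card ^ (SemiringFO.encFormula φ).length)
          (p.eval (SemiringFO.inputSize φ π V s)) := by
  open SemiringFO in
  refine ⟨(program : Code K Unit).toKTM, Cell.letter, 34000000, 440 * Polynomial.X ^ 2 +
    Polynomial.X + 49, fun a b h => by injection h, fun τ A φ π V s hA hV => ?_⟩
  have hm : A.card ≤ (encSet A).length := by
    rw [← countP_encSet]; exact List.countP_le_length
  have hm' := hA.card_pos
  have hφ := quantDepth_add_two_le φ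
  obtain ⟨n, hn⟩ : ∃ n, inputSize φ π V s = n := ⟨_, rfl⟩
  have hsum := hn
  unfold inputSize at hsum
  -- the stacks have heights at most `20 * n * |A|`
  have h1 : n * 1 ≤ n * A.card := Nat.mul_le_mul_left _ hm'
  have h2 : (encFormula φ).length * (A.card + 1) ≤ n * A.card + n := by
    rw [Nat.mul_succ]
    exact add_le_add (Nat.mul_le_mul_right _ (by omega)) (by omega)
  obtain ⟨T, S, h, hT, hS⟩ : ∃ T S, (program : Code K Unit).toKTM.ComputesWithin
      ((encInput φ π V s).map (Sum.map Cell.letter id)) [Sum.inr (φ.eval π s)] T S ∧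
      T ≤ 34000000 * n ^ 2 * (encFormula φ).length * A.card ^ (encFormula φ).length ∧
      S ≤ (440 * Polynomial.X ^ 2 + Polynomial.X + 49 : Polynomial ℕ).eval n := by
    refine ⟨_, _, computesWithin_program (H := 20 * (n * A.card)) φ π V s hA hV (by omega)
      (by omega) (by omega), steps_le (by omega) hm' rfl rfl, ?_⟩
    -- besides the input, there are `22` cells for each level of the stacks
    have h3 : n * A.card ≤ n * n := Nat.mul_le_mul_left _ (by omega)
    rw [hn]
    simp only [Polynomial.eval_add, Polynomial.eval_mul, Polynomial.eval_X,
      Polynomial.eval_ofNat, pow_two]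
    omega
  rw [hn]
  obtain ⟨hw, hv, t, ht, hstep, hspace, hout⟩ := h
  exact ⟨hw, hv, t, ht.trans hT, hstep, hspace.trans hS, hout⟩
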